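/- **Language.** We use two-sorted first-order logic with equality, with sorts $B$ (bodies) and $Q$ (quantities), and $\vdash$ denotes derivability in classical first-order logic. Let $L=\{B,Q;IOb,Ph,+,\cdot,\le,W\}$, where $IOb$ and $Ph$ are unary on $B$ and $W\subseteq B^2\times Q^4$. Let $L_E=L\cup\{E\}$ with $E$ unary on $B$. Write $\bar x\in wl_k(b)$ for $W(k,b,\bar x)$, and $ev_k(\bar x)=ev_h(\bar y)$ (also written $w_{kh}(\bar x,\bar y)$) for $\forall b\,[W(k,b,\bar x)\leftrightarrow W(h,b,\bar y)]$. Let $space(\bar x,\bar y)=\sqrt{\sum_{i=1}^3(x_i-y_i)^2}$ and $time(\bar x,\bar y)=|x_0-y_0|$. We write $speed_k(b)=v$ iff $wl_k(b)$ has two distinct points and $space(\bar x,\bar y)=v\cdot time(\bar x,\bar y)$ for all $\bar x,\bar y\in wl_k(b)$. We write $\bar v_k(b)=\bar v\in Q^3$ iff $wl_k(b)$ has two distinct points and $(y_1-x_1,y_2-x_2,y_3-x_3)=(y_0-x_0)\bar v$ for all $\bar x,\bar y\in wl_k(b)$. Partial functions abbreviate relations: an atomic formula containing $f(x)$ also asserts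 that $f(x)$ is defined. A *trivial transformation* is an affine map $T:Q^4\to Q^4$ that preserves $space$ and satisfies $T(\bar x)_0-T(\bar y)_0=x_0-y_0$ for all $\bar x,\bar y$. If instead $T$ preserves $space$ and $time$, it is *trivial up to the direction of time*. Both kinds of $T$ are quantified over by their 20 coefficients. **Common axioms** $\mathsf{Kin_{Full}}$: - AxEField: $\langle Q,+,\cdot,\le\rangle$ is an ordered field in which positive elements have square roots. - AxEv: $\forall k,h\in IOb\ \forall\bar x\,\exists\bar y\ ev_k(\bar x)=ev_h(\bar y)$. - AxSelf: $\forall k\in IOb\ \forall\bar x\,[W(k,k,\bar x)\leftrightarrow x_1=x_2=x_3=0]$. - AxSymD: for $k,k'\in IOb$, if $time(\bar x,\bar y)=time(\bar x',\bar y')=0$, $ev_k(\bar x)=ev_{k'}(\bar x')$ and $ev_k(\bar y)=ev_{k'}(\bar y')$, then $space(\bar x,\bar y)=space(\bar x',\bar y')$. - AxLine: for $k,h\in IOb$ and $\bar x,\bar y,\bar z\in wl_k(h)$ there is $a\in Q$ with $\bar z-\bar x=a(\bar y-\bar x)$ or $\bar y-\bar z=a(\bar z-\bar x)$. - AxTriv: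 for each trivial $T$ and $k\in IOb$ there is $k'\in IOb$ with $w_{kk'}=T$. - AxNoAcc: if $W(k,b,\bar x)$ for some $b,\bar x$, then $IOb(k)$. **Special relativity.** Let $\Lambda_k(c)$ be the formula $\forall\bar x,\bar y\,[\exists p\in Ph\,(\bar x,\bar y\in wl_k(p))\leftrightarrow space(\bar x,\bar y)=c\cdot time(\bar x,\bar y)]$. The theory $\mathsf{SpecRel_{Full}}$ is $\mathsf{Kin_{Full}}$ together with - AxPh$_c$: $\exists c>0\ \forall k\in IOb\ \Lambda_k(c)$. Denote this $c$ by $\mathfrak c$. - AxThExp: $IOb\ne\emptyset$, and for all $k\in IOb$ and $\bar x,\bar y$, if $space(\bar x,\bar y)<\mathfrak c\cdot time(\bar x,\bar y)$ then $\bar x,\bar y\in wl_k(k')$ for some $k'\in IOb$. The theory $\mathsf{SpecRel^e_{Full}}$, in the language $L_E$, adds - AxPrimitiveEther: there is $e\in IOb$ such that for every $k\in B$: $E(k)$ iff $IOb(k)$ and $w_{ek}=T$ for some $T$ that is trivial up to the direction of time. **Classical kinematics.** Let $Ether(e):\Leftrightarrow IOb(e)\wedge\exists c>0\ \Lambda_e(c)$,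 and let $\mathfrak c_e$ be the quantity with $\forall e\in Ether\ \forall p\in Ph\ [speed_e(p)=\mathfrak c_e]$. The theory $\mathsf{ClassicalKin^{STL}_{Full}}$, in the language $L$, is $\mathsf{Kin_{Full}}$ together with - AxAbsTime: for $k,k'\in IOb$, if $ev_k(\bar x)=ev_{k'}(\bar x')$ and $ev_k(\bar y)=ev_{k'}(\bar y')$, then $time(\bar x,\bar y)=time(\bar x',\bar y')$. - AxEther: $\exists e\,Ether(e)$. - AxNoFTL: $\forall k\in IOb\ \forall e\in Ether\ [speed_e(k)<\mathfrak c_e]$. - AxThExp$^{STL}$: $IOb\neq\emptyset$, and for all $e\in Ether$ and $\bar x,\bar y$, if $space(\bar x,\bar y)<\mathfrak c_e\cdot time(\bar x,\bar y)$ then $\bar x,\bar y\in wl_e(k)$ for some $k\in IOb$. **Translations.** A translation maps each atomic formula $R(x_1,\dots,x_n)$ to $\varphi_R(x_1,\dots,x_n)$ for a formula $\varphi_R$ with $n$ free variables of the same sorts, and preserves equality, connectives and quantifiers. An interpretation of $S$ in $T$ is a translation $\tau$ such that $S\vdash\varphi$ implies $T\vdash\tau(\varphi)$ for every formula $\varphi$.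 For $\bar v=(v_x,v_y,v_z)\in Q^3$ with $v=|\bar v|<\mathfrak c_e$, let $Rad_{\bar v}=R_{\bar v}^{-1}\circ S_v\circ E_v\circ G_v\circ R_{\bar v}$. Here $R_{\bar v}$ fixes the time coordinate and acts on space as follows. If $v_y=v_z=0$, it is the identity for $v_x\le0$ and $-\mathrm{id}$ for $v_x>0$. Otherwise its matrix on space is $$\frac1v\begin{pmatrix}-v_x&-v_y&-v_z\\ v_y&-v_x-v_z^2d&v_yv_zd\\ v_z&v_yv_zd&-v_x-v_y^2d\end{pmatrix},\qquad d=\frac{v-v_x}{v_y^2+v_z^2}.$$ The map $G_v$ is $(t,x,y,z)\mapsto(t,x+vt,y,z)$, and $S_v$ is multiplication by $\sqrt{1-v^2/\mathfrak c_e^2}$. With $q=1-v^2/\mathfrak c_e^2$, the map $E_v$ is $(t,x,y,z)\mapsto\big(\tfrac{t-vx/\mathfrak c_e^2}{q},\tfrac{x-vt}{q},\tfrac{y}{\sqrt q},\tfrac{z}{\sqrt q}\big)$. The translation $Tr$ from $L$ to $L$ leaves $Ph$, $+$, $\cdot$, $\le$ and $=$ unchanged, and $$Tr(IOb(k))=IOb(k)\wedge\forall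 e\in Ether\,[speed_e(k)<\mathfrak c_e],$$ $$Tr(W(k,b,\bar x))=\forall e\in Ether\,[W(k,b,Rad^{-1}_{\bar v_k(e)}(\bar x))].$$ The translation $Tr_+$ from $L_E$ to $L$ is given by the same clauses together with $Tr_+(E(x))=Ether(x)$. **Theorem.** $Tr_+$ is an interpretation of $\mathsf{SpecRel^e_{Full}}$ in $\mathsf{ClassicalKin^{STL}_{Full}}$; that is, $Tr_+$ is a translation, and $\mathsf{ClassicalKin^{STL}_{Full}}\vdash Tr_+(\varphi)$ whenever $\mathsf{SpecRel^e_{Full}}\vdash\varphi$. Moreover $Tr_+(\varphi)=Tr(\varphi)$ for every formula $\varphi$ of $L$, and $Tr_+(E(x))=Ether(x)$. -/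

import Mathlib

/-! ## Two-sorted first-order logic of kinematics

The sorts are bodies and quantities.  Variables of both sorts are de Bruijn indices, with a separate
count for each sort: `allB` binds body variable `0` and shifts only the body variables, `allQ` binds
quantity variable `0` and shifts only the quantity variables. -/

namespace Kinematics

/-- Quantity terms, built from quantity variables by `+` and `·`. -/
inductive QTerm where
  | var : ℕ → QTerm
  | add : QTerm → QTerm → QTerm
  | mul : QTerm → QTerm → QTerm

/-- Formulas of the language `{B, Q; IOb, Ph, +, ·, ≤, W}` extended by one unary relation symbol of
sort body for every element of `ε`.  Body terms are body variables. -/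
inductive Formula (ε : Type) where
  | falsum : Formula ε
  | imp : Formula ε → Formula ε → Formula ε
  | allB : Formula ε → Formula ε
  | allQ : Formula ε → Formula ε
  | eqB : ℕ → ℕ → Formula ε
  | eqQ : QTerm → QTerm → Formula ε
  | le : QTerm → QTerm → Formula ε
  | iob : ℕ → Formula ε
  | ph : ℕ → Formula ε
  | ext : ε → ℕ → Formula ε
  | W : ℕ → ℕ → (Fin 4 → QTerm) → Formula ε

/-- Simultaneous substitution in quantity terms. -/
def QTerm.subst (σ : ℕ → QTerm) : QTerm → QTerm
  | .var n => σ n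
  | .add s t => .add (s.subst σ) (t.subst σ)
  | .mul s t => .mul (s.subst σ) (t.subst σ)

/-- Put `a` in front of the sequence `f`. -/
def scons {α : Type} (a : α) (f : ℕ → α) : ℕ → α
  | 0 => a
  | n + 1 => f n

/-- A substitution for body variables, moved under a body quantifier. -/
def upB (ρ : ℕ → ℕ) : ℕ → ℕ := scons 0 (fun n => ρ n + 1)

/-- A substitution for quantity variables, moved under a quantity quantifier. -/
def upQ (σ : ℕ → QTerm) : ℕ → QTerm :=
  scons (.var 0) (fun n => (σ n).subst (fun m => .var (m + 1)))

namespace Formula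

variable {ε δ : Type}

/-- Simultaneous capture-avoiding substitution. -/
def subst : (ℕ → ℕ) → (ℕ → QTerm) → Formula ε → Formula ε
  | _, _, falsum => falsum
  | ρ, σ, imp φ ψ => imp (subst ρ σ φ) (subst ρ σ ψ)
  | ρ, σ, allB φ => allB (subst (upB ρ) σ φ)
  | ρ, σ, allQ φ => allQ (subst ρ (upQ σ) φ)
  | ρ, _, eqB a b => eqB (ρ a) (ρ b)
  | _, σ, eqQ s t => eqQ (s.subst σ) (t.subst σ)
  | _, σ, le s t => le (s.subst σ) (t.subst σ)
  | ρ, _, iob k => iob (ρ k)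
  | ρ, _, ph p => ph (ρ p)
  | ρ, _, ext R b => ext R (ρ b)
  | ρ, σ, W k b x => W (ρ k) (ρ b) (fun i => (x i).subst σ)

/-- Instantiate body variable `0` by the body variable `b`. -/
def instB (φ : Formula ε) (b : ℕ) : Formula ε := φ.subst (scons b id) .var

/-- Instantiate quantity variable `0` by the quantity term `t`. -/
def instQ (φ : Formula ε) (t : QTerm) : Formula ε := φ.subst id (scons t .var)

/-- Shift all free body variables by one. -/
def liftB (φ : Formula ε) : Formula ε := φ.subst (fun n => n + 1) .var

/-- Shift all free quantity variables by one. -/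
def liftQ (φ : Formula ε) : Formula ε := φ.subst id (fun n => .var (n + 1))

/-- The other connectives and quantifiers, as the usual classical abbreviations. -/
def neg (φ : Formula ε) : Formula ε := imp φ falsum

def and (φ ψ : Formula ε) : Formula ε := neg (imp φ (neg ψ))

def or (φ ψ : Formula ε) : Formula ε := imp (neg φ) ψ

def iff (φ ψ : Formula ε) : Formula ε := and (imp φ ψ) (imp ψ φ)

def exB (φ : Formula ε) : Formula ε := neg (allB (neg φ))

def exQ (φ : Formula ε) : Formula ε := neg (allQ (neg φ))

/-- Blocks of `n` quantity quantifiers, binding the variables `0, …, n - 1`. -/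
def allQs : ℕ → Formula ε → Formula ε
  | 0, φ => φ
  | n + 1, φ => allQ (allQs n φ)

def exQs : ℕ → Formula ε → Formula ε
  | 0, φ => φ
  | n + 1, φ => exQ (exQs n φ)

/-- Inclusion of the language without additional symbols in every extended language. -/
def embed : Formula Empty → Formula ε
  | falsum => falsum
  | imp φ ψ => imp (embed φ) (embed ψ)
  | allB φ => allB (embed φ)
  | allQ φ => allQ (embed φ)
  | eqB a b => eqB a b
  | eqQ s t => eqQ s t
  | le s t => le s t
  | iob k => iob k
  | ph p => ph p
  | ext R _ => R.elim
  | W k b x => W k b x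

end Formula

infixr:35 " ⩓ " => Formula.and
infixr:30 " ⩔ " => Formula.or
infixr:25 " ⤇ " => Formula.imp
infix:20 " ⬄ " => Formula.iff
prefix:max "∼" => Formula.neg

/-- Syntactic consequence: classical natural deduction for two-sorted first-order logic with
equality. -/
inductive Provable {ε : Type} : Set (Formula ε) → Formula ε → Prop
  | hyp {Γ : Set (Formula ε)} {φ : Formula ε} : φ ∈ Γ → Provable Γ φ
  | impI {Γ : Set (Formula ε)} {φ ψ : Formula ε} :
      Provable (insert φ Γ) ψ → Provable Γ (φ ⤇ ψ)
  | impE {Γ : Set (Formula ε)} {φ ψ : Formula ε} :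
      Provable Γ (φ ⤇ ψ) → Provable Γ φ → Provable Γ ψ
  | raa {Γ : Set (Formula ε)} {φ : Formula ε} :
      Provable (insert (∼φ) Γ) Formula.falsum → Provable Γ φ
  | allBI {Γ : Set (Formula ε)} {φ : Formula ε} :
      Provable (Formula.liftB '' Γ) φ → Provable Γ φ.allB
  | allBE {Γ : Set (Formula ε)} {φ : Formula ε} (b : ℕ) :
      Provable Γ φ.allB → Provable Γ (φ.instB b)
  | allQI {Γ : Set (Formula ε)} {φ : Formula ε} :
      Provable (Formula.liftQ '' Γ) φ → Provable Γ φ.allQ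
  | allQE {Γ : Set (Formula ε)} {φ : Formula ε} (t : QTerm) :
      Provable Γ φ.allQ → Provable Γ (φ.instQ t)
  | reflB {Γ : Set (Formula ε)} (b : ℕ) : Provable Γ (.eqB b b)
  | reflQ {Γ : Set (Formula ε)} (t : QTerm) : Provable Γ (.eqQ t t)
  | substB {Γ : Set (Formula ε)} {φ : Formula ε} {a b : ℕ} :
      Provable Γ (.eqB a b) → Provable Γ (φ.instB a) → Provable Γ (φ.instB b)
  | substQ {Γ : Set (Formula ε)} {φ : Formula ε} {s t : QTerm} :
      Provable Γ (.eqQ s t) → Provable Γ (φ.instQ s) → Provable Γ (φ.instQ t)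

/-! ## Translations and interpretations -/

/-- All quantity variables of the term are `< m`. -/
def QTerm.VarsBelow (m : ℕ) : QTerm → Prop
  | .var n => n < m
  | .add s t => s.VarsBelow m ∧ t.VarsBelow m
  | .mul s t => s.VarsBelow m ∧ t.VarsBelow m

/-- All free body variables are `< n` and all free quantity variables are `< m`. -/
def Formula.FreeBelow {ε : Type} : ℕ → ℕ → Formula ε → Prop
  | _, _, .falsum => True
  | n, m, .imp φ ψ => φ.FreeBelow n m ∧ ψ.FreeBelow n m
  | n, m, .allB φ => φ.FreeBelow (n + 1) m
  | n, m, .allQ φ => φ.FreeBelow n (m + 1)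
  | n, _, .eqB a b => a < n ∧ b < n
  | _, m, .eqQ s t => s.VarsBelow m ∧ t.VarsBelow m
  | _, m, .le s t => s.VarsBelow m ∧ t.VarsBelow m
  | n, _, .iob k => k < n
  | n, _, .ph p => p < n
  | n, _, .ext _ b => b < n
  | n, m, .W k b x => k < n ∧ b < n ∧ ∀ i, (x i).VarsBelow m

/-- `φ(b)` for a formula `φ` in body variable `0`. -/
def Formula.app1 {ε : Type} (φ : Formula ε) (b : ℕ) : Formula ε := φ.subst (fun _ => b) .var

/-- `φ(s, t)` for a formula `φ` in quantity variables `0, 1`. -/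
def Formula.appLe {ε : Type} (φ : Formula ε) (s t : QTerm) : Formula ε :=
  φ.subst id (scons s (fun _ => t))

/-- `φ(k, b, x₀, x₁, x₂, x₃)` for a formula `φ` in body variables `0, 1` and quantity variables
`0, 1, 2, 3`. -/
def Formula.appW {ε : Type} (φ : Formula ε) (k b : ℕ) (x : Fin 4 → QTerm) : Formula ε :=
  φ.subst (scons k (fun _ => b)) (scons (x 0) (scons (x 1) (scons (x 2) (fun _ => x 3))))

/-- A translation between two such languages: atomic formulas `R(x₁, …, xₙ)` go to `φ_R(x₁, …, xₙ)`
for a formula `φ_R` in `n` free variables of the same sorts; equality (also between compound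
terms), connectives and quantifiers are preserved. -/
structure IsTranslation {ε δ : Type} (τ : Formula ε → Formula δ) : Prop where
  falsum : τ .falsum = .falsum
  imp : ∀ φ ψ, τ (φ ⤇ ψ) = (τ φ ⤇ τ ψ)
  allB : ∀ φ, τ (.allB φ) = .allB (τ φ)
  allQ : ∀ φ, τ (.allQ φ) = .allQ (τ φ)
  eqB : ∀ a b, τ (.eqB a b) = .eqB a b
  eqQ : ∀ s t, τ (.eqQ s t) = .eqQ s t
  le : ∃ φ : Formula δ, φ.FreeBelow 0 2 ∧ ∀ s t, τ (.le s t) = φ.appLe s t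
  iob : ∃ φ : Formula δ, φ.FreeBelow 1 0 ∧ ∀ k, τ (.iob k) = φ.app1 k
  ph : ∃ φ : Formula δ, φ.FreeBelow 1 0 ∧ ∀ p, τ (.ph p) = φ.app1 p
  ext : ∀ R, ∃ φ : Formula δ, φ.FreeBelow 1 0 ∧ ∀ b, τ (.ext R b) = φ.app1 b
  W : ∃ φ : Formula δ, φ.FreeBelow 2 4 ∧ ∀ k b x, τ (.W k b x) = φ.appW k b x

/-- `τ` is an interpretation of the theory `S` in the theory `T`. -/
def IsInterpretation {ε δ : Type} (S : Set (Formula ε)) (T : Set (Formula δ))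
    (τ : Formula ε → Formula δ) : Prop :=
  IsTranslation τ ∧ ∀ φ, Provable S φ → Provable T (τ φ)

/-! ## Defined partial functions on quantities

`PTerm`s are terms with the defined (partial) operations.  They only abbreviate formulas:
an atomic formula containing `f(x)` means that there is a `y` with `f(x) = y` for which the
formula holds. -/

inductive PTerm where
  | var : ℕ → PTerm
  | zero : PTerm
  | one : PTerm
  | add : PTerm → PTerm → PTerm
  | sub : PTerm → PTerm → PTerm
  | mul : PTerm → PTerm → PTerm
  | div : PTerm → PTerm → PTerm
  | sqrt : PTerm → PTerm
  | abs : PTerm → PTerm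

namespace PTerm

instance : Zero PTerm := ⟨zero⟩
instance : One PTerm := ⟨one⟩
instance : Add PTerm := ⟨add⟩
instance : Sub PTerm := ⟨sub⟩
instance : Neg PTerm := ⟨fun a => sub zero a⟩
instance : Mul PTerm := ⟨mul⟩
instance : Div PTerm := ⟨div⟩

end PTerm

section Defined

variable {ε : Type}

/-- `t = 0`. -/
def isZero (t : QTerm) : Formula ε := .eqQ (t.add t) t

/-- `t = 1`. -/
def isOne (t : QTerm) : Formula ε := .eqQ (t.mul t) t ⩓ ∼(isZero t)

/-- `0 ≤ x` for the quantity variable `x`. -/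
def isNonneg (x : ℕ) : Formula ε := .exQ (isZero (.var 0) ⩓ .le (.var 0) (.var (x + 1)))

/-- Rename quantity variable `0` to `i` and `n + 1` to `n + m`. -/
def moveTo (i m : ℕ) (φ : Formula ε) : Formula ε :=
  φ.subst id (scons (.var i) (fun n => .var (n + m)))

/-- The formula "the value of `t` is defined and equals variable `0`"; here variable `n` of `t` is
variable `n + 1` of the formula. -/
def PTerm.graph : PTerm → Formula ε
  | .var n => .eqQ (.var 0) (.var (n + 1))
  | .zero => isZero (.var 0)
  | .one => isOne (.var 0)
  | .add a b => .exQs 2 (moveTo 0 3 a.graph ⩓ moveTo 1 3 b.graph ⩓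
      .eqQ (.var 2) (.add (.var 0) (.var 1)))
  | .sub a b => .exQs 2 (moveTo 0 3 a.graph ⩓ moveTo 1 3 b.graph ⩓
      .eqQ (.add (.var 2) (.var 1)) (.var 0))
  | .mul a b => .exQs 2 (moveTo 0 3 a.graph ⩓ moveTo 1 3 b.graph ⩓
      .eqQ (.var 2) (.mul (.var 0) (.var 1)))
  | .div a b => .exQs 2 (moveTo 0 3 a.graph ⩓ moveTo 1 3 b.graph ⩓
      ∼(isZero (.var 1)) ⩓ .eqQ (.mul (.var 2) (.var 1)) (.var 0))
  | .sqrt a => .exQ (moveTo 0 2 a.graph ⩓ isNonneg 1 ⩓ .eqQ (.mul (.var 1) (.var 1)) (.var 0))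
  | .abs a => .exQ (moveTo 0 2 a.graph ⩓ isNonneg 1 ⩓
      (.eqQ (.var 1) (.var 0) ⩔ isZero (.add (.var 1) (.var 0))))

/-- `s = t`. -/
def eqP (s t : PTerm) : Formula ε := .exQ (s.graph ⩓ t.graph)

/-- `s < t`. -/
def ltP (s t : PTerm) : Formula ε :=
  .exQs 2 (moveTo 0 2 s.graph ⩓ moveTo 1 2 t.graph ⩓
    .le (.var 0) (.var 1) ⩓ ∼(.eqQ (.var 0) (.var 1)))

/-- Space-time points with given coordinates: `0` is time, `1, 2, 3` are space. -/
abbrev Point := Fin 4 → PTerm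

/-- The point whose coordinates are the variables `o, o + 1, o + 2, o + 3`. -/
def pt (o : ℕ) : Point := fun i => .var (o + i)

def eqPt (x y : Point) : Formula ε :=
  eqP (x 0) (y 0) ⩓ eqP (x 1) (y 1) ⩓ eqP (x 2) (y 2) ⩓ eqP (x 3) (y 3)

/-- Spatial distance. -/
def space (x y : Point) : PTerm :=
  .sqrt ((x 1 - y 1) * (x 1 - y 1) + (x 2 - y 2) * (x 2 - y 2) + (x 3 - y 3) * (x 3 - y 3))

/-- Time difference. -/
def time (x y : Point) : PTerm := .abs (x 0 - y 0)

/-! ## Defined relations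

Body arguments are body variables.  A quantity argument is the index of a variable, and a
point argument `x` is the index of the first of four consecutive variables `x, …, x + 3`. -/

/-- `W(k, b, x)`, that is `x ∈ wl_k(b)`. -/
def wl (k b x : ℕ) : Formula ε := .W k b (fun i => .var (x + i))

/-- `ev_k(x) = ev_h(y)`, that is `w_{kh}(x, y)`. -/
def sameEv (k h x y : ℕ) : Formula ε := .allB (wl (k + 1) 0 x ⬄ wl (h + 1) 0 y)

/-- `speed_k(b) = v`. -/
def speedIs (k b v : ℕ) : Formula ε :=
  .exQs 8 (wl k b 4 ⩓ wl k b 0 ⩓ ∼(eqPt (pt 4) (pt 0))) ⩓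
  .allQs 8 (wl k b 4 ⩓ wl k b 0 ⤇
    eqP (space (pt 4) (pt 0)) (.var (v + 8) * time (pt 4) (pt 0)))

/-- `v̄_k(b) = (v, v + 1, v + 2)` (variables). -/
def velocityIs (k b v : ℕ) : Formula ε :=
  .exQs 8 (wl k b 4 ⩓ wl k b 0 ⩓ ∼(eqPt (pt 4) (pt 0))) ⩓
  .allQs 8 (wl k b 4 ⩓ wl k b 0 ⤇
    eqP (pt 0 1 - pt 4 1) (.var (v + 8) * (pt 0 0 - pt 4 0)) ⩓
    eqP (pt 0 2 - pt 4 2) (.var (v + 9) * (pt 0 0 - pt 4 0)) ⩓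
    eqP (pt 0 3 - pt 4 3) (.var (v + 10) * (pt 0 0 - pt 4 0)))

/-- `k` is an observer. -/
def isOb (k : ℕ) : Formula ε := .exB (.exQs 4 (wl (k + 1) 0 0))

/-- The image of `x` under the affine map with matrix entries `m, …, m + 15` (by rows) and
translation vector `m + 16, …, m + 19` (variables). -/
def affine (m : ℕ) (x : Point) : Point := fun i =>
  .var (m + 4 * i) * x 0 + .var (m + 4 * i + 1) * x 1 + .var (m + 4 * i + 2) * x 2 +
    .var (m + 4 * i + 3) * x 3 + .var (m + 16 + i)

/-- The affine map with parameters `m, …, m + 19` is a trivial transformation: an isometry on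
space and a translation along the time axis. -/
def isTriv (m : ℕ) : Formula ε :=
  .allQs 8 (eqP (affine (m + 8) (pt 4) 0 - affine (m + 8) (pt 0) 0) (pt 4 0 - pt 0 0) ⩓
    eqP (space (affine (m + 8) (pt 4)) (affine (m + 8) (pt 0))) (space (pt 4) (pt 0)))

/-- The affine map with parameters `m, …, m + 19` is a trivial transformation up to the direction
of time: an isometry on space, and a translation of the time axis possibly after a reversal. -/
def isTrivUpToReversal (m : ℕ) : Formula ε :=
  .allQs 8 (eqP (time (affine (m + 8) (pt 4)) (affine (m + 8) (pt 0))) (time (pt 4) (pt 0)) ⩓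
    eqP (space (affine (m + 8) (pt 4)) (affine (m + 8) (pt 0))) (space (pt 4) (pt 0)))

/-- `w_{kh} = T` for the affine map `T` with parameters `m, …, m + 19`. -/
def worldviewIs (k h m : ℕ) : Formula ε :=
  .allQs 8 (sameEv k h 4 0 ⬄ eqPt (affine (m + 8) (pt 4)) (pt 0))

/-- According to `k`, the pairs of points connected by light signals are exactly those with
`space = c · time`. -/
def lightSpeedIs (k c : ℕ) : Formula ε :=
  .allQs 8 (.exB (.ph 0 ⩓ wl (k + 1) 0 4 ⩓ wl (k + 1) 0 0) ⬄
    eqP (space (pt 4) (pt 0)) (.var (c + 8) * time (pt 4) (pt 0)))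

/-- `e` is an ether observer. -/
def ether (e : ℕ) : Formula ε := .iob e ⩓ .exQ (ltP 0 (.var 0) ⩓ lightSpeedIs e 0)

/-- `c` is the speed of light `𝔠_e` of the ether frame. -/
def isEtherLightSpeed (c : ℕ) : Formula ε :=
  .allB (ether 0 ⤇ .allB (.ph 0 ⤇ speedIs 1 0 c))

/-- `speed_e(k) < 𝔠_e`. -/
def slowerThanLight (e k : ℕ) : Formula ε :=
  .exQs 2 (speedIs e k 0 ⩓ isEtherLightSpeed 1 ⩓ ltP (.var 0) (.var 1))

/-- `c` is the observer-independent speed of light `𝔠` of special relativity. -/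
def isLightSpeed (c : ℕ) : Formula ε :=
  ltP 0 (.var c) ⩓ .allB (.iob 0 ⤇ lightSpeedIs 0 c)

/-! ## Axioms -/

/-- `⟨Q, +, ·, ≤⟩` is a Euclidean field. In the second half, variable `z` is `0`. -/
def AxEField : Formula ε :=
  .allQs 3 (.eqQ (.add (.add (.var 0) (.var 1)) (.var 2)) (.add (.var 0) (.add (.var 1) (.var 2)))) ⩓
  .allQs 2 (.eqQ (.add (.var 0) (.var 1)) (.add (.var 1) (.var 0))) ⩓
  .allQs 3 (.eqQ (.mul (.mul (.var 0) (.var 1)) (.var 2)) (.mul (.var 0) (.mul (.var 1) (.var 2)))) ⩓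
  .allQs 2 (.eqQ (.mul (.var 0) (.var 1)) (.mul (.var 1) (.var 0))) ⩓
  .allQs 3 (.eqQ (.mul (.var 0) (.add (.var 1) (.var 2)))
    (.add (.mul (.var 0) (.var 1)) (.mul (.var 0) (.var 2)))) ⩓
  .allQ (.le (.var 0) (.var 0)) ⩓
  .allQs 2 (.le (.var 0) (.var 1) ⩓ .le (.var 1) (.var 0) ⤇ .eqQ (.var 0) (.var 1)) ⩓
  .allQs 3 (.le (.var 0) (.var 1) ⩓ .le (.var 1) (.var 2) ⤇ .le (.var 0) (.var 2)) ⩓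
  .allQs 2 (.le (.var 0) (.var 1) ⩔ .le (.var 1) (.var 0)) ⩓
  .allQs 3 (.le (.var 0) (.var 1) ⤇
    .le (.add (.var 0) (.var 2)) (.add (.var 1) (.var 2))) ⩓
  .exQ (
    .allQ (.eqQ (.add (.var 0) (.var 1)) (.var 0)) ⩓
    .allQ (.exQ (.eqQ (.add (.var 1) (.var 0)) (.var 2))) ⩓
    .exQ (∼(.eqQ (.var 0) (.var 1)) ⩓
      .allQ (.eqQ (.mul (.var 0) (.var 1)) (.var 0)) ⩓
      .allQ (∼(.eqQ (.var 0) (.var 2)) ⤇ .exQ (.eqQ (.mul (.var 1) (.var 0)) (.var 2)))) ⩓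
    .allQs 2 (.le (.var 2) (.var 0) ⩓ .le (.var 2) (.var 1) ⤇
      .le (.var 2) (.mul (.var 0) (.var 1))) ⩓
    .allQ (.le (.var 1) (.var 0) ⩓ ∼(.eqQ (.var 1) (.var 0)) ⤇
      .exQ (.eqQ (.mul (.var 0) (.var 0)) (.var 1))))

/-- All inertial observers coordinatize the same events. -/
def AxEv : Formula ε :=
  .allB (.allB (.iob 1 ⩓ .iob 0 ⤇ .allQs 4 (.exQs 4 (sameEv 1 0 4 0))))

/-- The worldline of an inertial observer is a straight line according to inertial observers. -/
def AxLine : Formula ε :=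
  .allB (.allB (.iob 1 ⩓ .iob 0 ⤇ .allQs 12 (wl 1 0 8 ⩓ wl 1 0 4 ⩓ wl 1 0 0 ⤇
    .exQ (
      eqPt (fun i => pt 1 i - pt 9 i) (fun i => .var 0 * (pt 5 i - pt 9 i)) ⩔
      eqPt (fun i => pt 5 i - pt 1 i) (fun i => .var 0 * (pt 1 i - pt 9 i))))))

/-- Any inertial observer is stationary in his own coordinate system. -/
def AxSelf : Formula ε :=
  .allB (.iob 0 ⤇ .allQs 4 (wl 0 0 0 ⬄
    eqP (pt 0 1) 0 ⩓ eqP (pt 0 2) 0 ⩓ eqP (pt 0 3) 0))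

/-- Inertial observers agree on the distance of events that are simultaneous for both. The points
`x, y, x', y'` are at `12, 8, 4, 0`. -/
def AxSymD : Formula ε :=
  .allB (.allB (.iob 1 ⩓ .iob 0 ⤇ .allQs 16 (
    eqP (time (pt 12) (pt 8)) 0 ⩓ eqP (time (pt 4) (pt 0)) 0 ⩓
    sameEv 1 0 12 4 ⩓ sameEv 1 0 8 0 ⤇
    eqP (space (pt 12) (pt 8)) (space (pt 4) (pt 0)))))

/-- Any trivial transformation of an inertial coordinate system is an inertial coordinate
system. -/
def AxTriv : Formula ε :=
  .allQs 20 (isTriv 0 ⤇ .allB (.iob 0 ⤇ .exB (.iob 0 ⩓ worldviewIs 1 0 0)))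

/-- All observers are inertial observers. -/
def AxNoAcc : Formula ε := .allB (isOb 0 ⤇ .iob 0)

/-- The time difference of two events is the same for all inertial observers. -/
def AxAbsTime : Formula ε :=
  .allB (.allB (.iob 1 ⩓ .iob 0 ⤇ .allQs 16 (
    sameEv 1 0 12 4 ⩓ sameEv 1 0 8 0 ⤇
    eqP (time (pt 12) (pt 8)) (time (pt 4) (pt 0)))))

/-- There is an ether observer. -/
def AxEther : Formula ε := .exB (ether 0)

/-- All inertial observers move slower than light with respect to the ether frame. -/
def AxNoFTL : Formula ε :=
  .allB (.iob 0 ⤇ .allB (ether 0 ⤇ slowerThanLight 0 1))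

/-- Inertial observers can move with any speed that is slower than light in the ether frame. -/
def AxThExpSTL : Formula ε :=
  .exB (.iob 0) ⩓
  .allB (ether 0 ⤇ .allQs 8 (
    .exQ (isEtherLightSpeed 0 ⩓ ltP (space (pt 5) (pt 1)) (.var 0 * time (pt 5) (pt 1))) ⤇
    .exB (.iob 0 ⩓ wl 1 0 4 ⩓ wl 1 0 0)))

/-- The speed of light is the same for all inertial observers, everywhere, in every direction. -/
def AxPhc : Formula ε := .exQ (isLightSpeed 0)

/-- Inertial observers can move along any straight line of any speed less than that of light. -/
def AxThExp : Formula ε :=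
  .exB (.iob 0) ⩓
  .allB (.iob 0 ⤇ .allQs 8 (
    .exQ (isLightSpeed 0 ⩓ ltP (space (pt 5) (pt 1)) (.var 0 * time (pt 5) (pt 1))) ⤇
    .exB (.iob 0 ⩓ wl 1 0 4 ⩓ wl 1 0 0)))

end Defined

/-- The additional relation symbol: the primitive ether. -/
inductive EtherSymbol where
  | E : EtherSymbol

/-- The primitive ether consists of the inertial observers whose worldview transformation from
some fixed inertial observer is a trivial transformation up to the direction of time. -/
def AxPrimitiveEther : Formula EtherSymbol :=
  .exB (.iob 0 ⩓ .allB (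
    (.iob 0 ⩓ .exQs 20 (isTrivUpToReversal 0 ⩓ worldviewIs 1 0 0)) ⬄ .ext .E 0))

/-! ## Theories -/

/-- The axioms common to all theories, in any of the languages. -/
def KinFull (ε : Type) : Set (Formula ε) :=
  {AxEField, AxEv, AxSelf, AxSymD, AxLine, AxTriv, AxNoAcc}

/-- Special relativity. -/
def SpecRelFull (ε : Type) : Set (Formula ε) := KinFull ε ∪ {AxPhc, AxThExp}

/-- Special relativity with a primitive ether. -/
def SpecRelEFull : Set (Formula EtherSymbol) := SpecRelFull EtherSymbol ∪ {AxPrimitiveEther}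

/-- Classical kinematics with slower-than-light inertial observers only. -/
def ClassicalKinSTLFull : Set (Formula Empty) :=
  KinFull Empty ∪ {AxAbsTime, AxEther, AxNoFTL, AxThExpSTL}

/-! ## Radarization and the translations -/

section Radarization

variable {ε : Type}

/-- A matrix applied to a point. -/
def applyMatrix (M : Matrix (Fin 4) (Fin 4) PTerm) (x : Point) : Point := fun i =>
  M i 0 * x 0 + M i 1 * x 1 + M i 2 * x 2 + M i 3 * x 3

/-- The length of the vector `(v, v + 1, v + 2)` (variables). -/
def vecNorm (v : ℕ) : PTerm :=
  .sqrt (.var v * .var v + .var (v + 1) * .var (v + 1) + .var (v + 2) * .var (v + 2))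

/-- The matrix of `R_v̄` if `v_y ≠ 0` or `v_z ≠ 0`. -/
def rotationMatrix (v : ℕ) : Matrix (Fin 4) (Fin 4) PTerm :=
  let vx : PTerm := .var v
  let vy : PTerm := .var (v + 1)
  let vz : PTerm := .var (v + 2)
  let n : PTerm := vecNorm v
  let d : PTerm := (n - vx) / (vy * vy + vz * vz)
  !![1, 0, 0, 0;
     0, (-vx) / n, (-vy) / n, (-vz) / n;
     0, vy / n, (-vx - vz * vz * d) / n, (vy * vz * d) / n;
     0, vz / n, (vy * vz * d) / n, (-vx - vy * vy * d) / n]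

/-- `R_v̄(x) = y` for `v̄ = (v, v + 1, v + 2)`. -/
def rotationIs (v : ℕ) (x y : Point) : Formula ε :=
  (∼(eqP (.var (v + 1)) 0 ⩓ eqP (.var (v + 2)) 0) ⩓ eqPt (applyMatrix (rotationMatrix v) x) y) ⩔
  ((eqP (.var (v + 1)) 0 ⩓ eqP (.var (v + 2)) 0) ⩓ ∼(ltP 0 (.var v)) ⩓ eqPt x y) ⩔
  ((eqP (.var (v + 1)) 0 ⩓ eqP (.var (v + 2)) 0) ⩓ ltP 0 (.var v) ⩓
    eqPt ![x 0, -x 1, -x 2, -x 3] y)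

/-- The Galilean boost `G_s`. -/
def galileanBoost (s : PTerm) : Matrix (Fin 4) (Fin 4) PTerm :=
  !![1, 0, 0, 0;
     s, 1, 0, 0;
     0, 0, 1, 0;
     0, 0, 0, 1]

/-- The scale factor `S_s = √(1 - s²/c²)`. -/
def scaleFactor (c s : PTerm) : PTerm := .sqrt (1 - (s * s) / (c * c))

/-- The synchronisation matrix `E_s`. -/
def synchronisation (c s : PTerm) : Matrix (Fin 4) (Fin 4) PTerm :=
  let q : PTerm := 1 - (s * s) / (c * c)
  !![1 / q, (-s / (c * c)) / q, 0, 0;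
     (-s) / q, 1 / q, 0, 0;
     0, 0, 1 / scaleFactor c s, 0;
     0, 0, 0, 1 / scaleFactor c s]

/-- `S_s ∘ E_s ∘ G_s`. -/
def coreMap (c s : PTerm) (x : Point) : Point := fun i =>
  scaleFactor c s * applyMatrix (synchronisation c s) (applyMatrix (galileanBoost s) x) i

/-- `Rad_v̄(x) = y` for `Rad_v̄ = R_v̄⁻¹ ∘ S_{|v̄|} ∘ E_{|v̄|} ∘ G_{|v̄|} ∘ R_v̄`, `|v̄| < 𝔠_e`. Inside,
`𝔠_e` is variable `8`, the point `R_v̄(x)` is at `4` and its image under the core map is at `0`. -/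
def radIs (v x y : ℕ) : Formula ε :=
  .exQ (isEtherLightSpeed 0 ⩓ ltP (vecNorm (v + 1)) (.var 0) ⩓
    .exQs 8 (rotationIs (v + 9) (pt (x + 9)) (pt 4) ⩓
      eqPt (coreMap (.var 8) (vecNorm (v + 9)) (pt 4)) (pt 0) ⩓
      rotationIs (v + 9) (pt (y + 9)) (pt 0)))

/-- `IOb(k) ∧ ∀ e ∈ Ether, speed_e(k) < 𝔠_e`, where `k` is body variable `0`. -/
def trIOb : Formula ε := .iob 0 ⩓ .allB (ether 0 ⤇ slowerThanLight 0 1)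

/-- `∀ e ∈ Ether, W(k, b, Rad⁻¹_{v̄_k(e)}(x))`, where `k, b` are body variables `0, 1` and `x` is the
point at `0`. Inside, `v̄_k(e)` is at `4` and the inverse image of `x` is at `0`. -/
def trW : Formula ε :=
  .allB (ether 0 ⤇ .exQs 7 (velocityIs 1 0 4 ⩓ radIs 4 0 7 ⩓ wl 1 2 0))

end Radarization

/-- The translation of special relativity into classical kinematics. -/
def Tr : Formula Empty → Formula Empty
  | .falsum => .falsum
  | .imp φ ψ => .imp (Tr φ) (Tr ψ)
  | .allB φ => .allB (Tr φ)
  | .allQ φ => .allQ (Tr φ)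
  | .eqB a b => .eqB a b
  | .eqQ s t => .eqQ s t
  | .le s t => .le s t
  | .iob k => trIOb.app1 k
  | .ph p => .ph p
  | .ext R _ => R.elim
  | .W k b x => trW.appW k b x

/-- The translation of special relativity with primitive ether into classical kinematics. -/
def TrPlus : Formula EtherSymbol → Formula Empty
  | .falsum => .falsum
  | .imp φ ψ => .imp (TrPlus φ) (TrPlus ψ)
  | .allB φ => .allB (TrPlus φ)
  | .allQ φ => .allQ (TrPlus φ)
  | .eqB a b => .eqB a b
  | .eqQ s t => .eqQ s t
  | .le s t => .le s t
  | .iob k => trIOb.app1 k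
  | .ph p => .ph p
  | .ext _ b => ether b
  | .W k b x => trW.appW k b x

end Kinematics

/-! No derivation of a translated axiom is ever built by hand. The language is countable and the
calculus is complete (`Provable.of_forall_sat`, a Henkin construction), so derivability in the
classical theory may be checked in its structures. There `AxEField` makes the quantities a Euclidean
field (`exists_isEuclideanField`), and a structure `I` of classical kinematics defines a structure
`I.radarized` on the same two domains for which `I` satisfies `TrPlus φ` exactly when `I.radarized`
satisfies `φ` (`Frame.sat_TrPlus`). By soundness it remains to verify the axioms of special
relativity with primitive ether in `I.radarized`.

The geometry rests on two facts. The first is that the worldview transformation from an ether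
observer to any observer `k` is Galilean (`exists_isGalilean`). Observers exist on all timelike
lines of the ether, and straight worldlines with absolute time force ratios on them to be preserved.
A map affine on all timelike lines is affine (`exists_linear_of_timelike`). Absolute time fixes its
time component up to sign, and AxSymD makes it isometric on simultaneous vectors. Ether observers
are mutually at rest, so `k` sees all of them move with one velocity `v`, and AxNoFTL gives `|v| <
c` (`exists_velocity`).

The second is that radarization straightens the tilted light cone which `k` sees: it turns the form
`|x - v t|² - c² t²` into the Minkowski form `|x|² - c² t²` (`minkowski_radMap`). Here the composite
of the rotation, the boost, the synchronisation, the scaling and the inverse rotation is replaced by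
a map `radMap` that stretches space along `v` and mixes time with the `v`-component; any rotation
with the right axis gives the same map (`IsRotation.core_eq_iff`).

Composing both, the radarized coordinates of every observer differ from those of the ether by a map
whose linear part preserves the Minkowski form (`exists_chart`). The axioms on light, on existence
of observers and on simultaneous distances follow from this invariance, AxLine from linearity, and
AxSelf because radarization maps the time axis to itself. AxTriv holds because radarization is
compatible with spatial isometries (`radMap_affineMap`). AxPrimitiveEther holds because a
transformation from an ether observer can be trivial up to the direction of time only if `v = 0`, in
which case radarization is the identity and the light cone of the ether is also that of `k`. -/

namespace Kinematics
set_option linter.unusedSectionVars false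

/-! ## Substitution -/

theorem QTerm.subst_subst (σ τ : ℕ → QTerm) (t : QTerm) :
    (t.subst σ).subst τ = t.subst (fun n => (σ n).subst τ) := by
  induction t with
  | var n => rfl
  | add s t hs ht => simp only [QTerm.subst, hs, ht]
  | mul s t hs ht => simp only [QTerm.subst, hs, ht]

@[simp] theorem QTerm.subst_var (t : QTerm) : t.subst .var = t := by
  induction t with
  | var n => rfl
  | add s t hs ht => simp only [QTerm.subst, hs, ht]
  | mul s t hs ht => simp only [QTerm.subst, hs, ht]

theorem upB_comp (ρ ρ' : ℕ → ℕ) : (fun n => upB ρ' (upB ρ n)) = upB (fun n => ρ' (ρ n)) := by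
  funext n; cases n <;> rfl

theorem upB_id : upB id = id := by
  funext n; cases n <;> rfl

theorem upQ_comp (σ τ : ℕ → QTerm) :
    (fun n => (upQ σ n).subst (upQ τ)) = upQ (fun n => (σ n).subst τ) := by
  funext n
  cases n with
  | zero => rfl
  | succ n => simp only [upQ, scons, QTerm.subst_subst]; rfl

theorem upQ_var : upQ .var = .var := by
  funext n; cases n <;> rfl

namespace Formula

variable {ε : Type}

theorem subst_subst (φ : Formula ε) (ρ ρ' : ℕ → ℕ) (σ σ' : ℕ → QTerm) :
    (φ.subst ρ σ).subst ρ' σ' = φ.subst (fun n => ρ' (ρ n)) (fun n => (σ n).subst σ') := by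
  induction φ generalizing ρ ρ' σ σ' with
  | imp φ ψ hφ hψ => simp only [subst, hφ, hψ]
  | allB φ ih => simp only [subst, ih, upB_comp]
  | allQ φ ih => simp only [subst, ih, upQ_comp]
  | _ => simp only [subst, QTerm.subst_subst]

@[simp] theorem subst_id (φ : Formula ε) : φ.subst id .var = φ := by
  induction φ with
  | imp φ ψ hφ hψ => simp only [subst, hφ, hψ]
  | allB φ ih => simp only [subst, ih, upB_id]
  | allQ φ ih => simp only [subst, ih, upQ_var]
  | _ => simp [subst]

theorem liftB_subst (φ : Formula ε) (ρ : ℕ → ℕ) (σ : ℕ → QTerm) :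
    (φ.subst ρ σ).liftB = φ.liftB.subst (upB ρ) σ := by
  simp only [liftB, subst_subst, QTerm.subst_var]; rfl

theorem liftQ_subst (φ : Formula ε) (ρ : ℕ → ℕ) (σ : ℕ → QTerm) :
    (φ.subst ρ σ).liftQ = φ.liftQ.subst ρ (upQ σ) := by
  simp only [liftQ, subst_subst]; rfl

theorem instB_subst (φ : Formula ε) (b : ℕ) (ρ : ℕ → ℕ) (σ : ℕ → QTerm) :
    (φ.instB b).subst ρ σ = (φ.subst (upB ρ) σ).instB (ρ b) := by
  simp only [instB, subst_subst, QTerm.subst_var]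
  congr 1
  funext n; cases n <;> rfl

theorem instQ_subst (φ : Formula ε) (t : QTerm) (ρ : ℕ → ℕ) (σ : ℕ → QTerm) :
    (φ.instQ t).subst ρ σ = (φ.subst ρ (upQ σ)).instQ (t.subst σ) := by
  simp only [instQ, subst_subst]
  congr 1
  funext n
  cases n with
  | zero => rfl
  | succ n =>
    simp only [upQ, scons, QTerm.subst_subst]
    exact (QTerm.subst_var _).symm

theorem instB_upB_subst (φ : Formula ε) (b : ℕ) (ρ : ℕ → ℕ) (σ : ℕ → QTerm) :
    (φ.subst (upB ρ) σ).instB b = φ.subst (scons b ρ) σ := by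
  simp only [instB, subst_subst, QTerm.subst_var]
  congr 1
  funext n; cases n <;> rfl

theorem instQ_upQ_subst (φ : Formula ε) (t : QTerm) (ρ : ℕ → ℕ) (σ : ℕ → QTerm) :
    (φ.subst ρ (upQ σ)).instQ t = φ.subst ρ (scons t σ) := by
  simp only [instQ, subst_subst]
  congr 1
  funext n
  cases n with
  | zero => rfl
  | succ n =>
    simp only [upQ, scons, QTerm.subst_subst]
    exact QTerm.subst_var _

end Formula

/-! ## Structural properties of derivability -/

section Derivability

variable {ε : Type}

theorem Provable.mono {Γ Δ : Set (Formula ε)} {φ : Formula ε} (h : Provable Γ φ) (hΓ : Γ ⊆ Δ) :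
    Provable Δ φ := by
  induction h generalizing Δ with
  | hyp h => exact .hyp (hΓ h)
  | impI _ ih => exact .impI (ih (Set.insert_subset_insert hΓ))
  | impE _ _ ih₁ ih₂ => exact .impE (ih₁ hΓ) (ih₂ hΓ)
  | raa _ ih => exact .raa (ih (Set.insert_subset_insert hΓ))
  | allBI _ ih => exact .allBI (ih (Set.image_mono hΓ))
  | allBE b _ ih => exact .allBE b (ih hΓ)
  | allQI _ ih => exact .allQI (ih (Set.image_mono hΓ))
  | allQE t _ ih => exact .allQE t (ih hΓ)
  | reflB b => exact .reflB b
  | reflQ t => exact .reflQ t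
  | substB _ _ ih₁ ih₂ => exact .substB (ih₁ hΓ) (ih₂ hΓ)
  | substQ _ _ ih₁ ih₂ => exact .substQ (ih₁ hΓ) (ih₂ hΓ)

/-- Renaming is needed twice for completeness: to turn a fresh free variable into index `0` before
generalizing, and to free infinitely many variables before the Henkin construction. -/
theorem Provable.subst {Γ : Set (Formula ε)} {φ : Formula ε} (h : Provable Γ φ) (ρ : ℕ → ℕ)
    (σ : ℕ → QTerm) : Provable (Formula.subst ρ σ '' Γ) (φ.subst ρ σ) := by
  induction h generalizing ρ σ with
  | hyp h => exact .hyp (Set.mem_image_of_mem _ h)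
  | impI _ ih =>
    refine .impI ?_
    have := ih ρ σ
    rwa [Set.image_insert_eq] at this
  | impE _ _ ih₁ ih₂ => exact .impE (ih₁ ρ σ) (ih₂ ρ σ)
  | raa _ ih =>
    refine .raa ?_
    have := ih ρ σ
    rwa [Set.image_insert_eq] at this
  | allBI _ ih =>
    refine .allBI ?_
    have := ih (upB ρ) σ
    simpa only [Set.image_image, Formula.liftB_subst] using this
  | allBE b _ ih =>
    rw [Formula.instB_subst]
    exact .allBE _ (ih ρ σ)
  | allQI _ ih =>
    refine .allQI ?_
    have := ih ρ (upQ σ)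
    simpa only [Set.image_image, Formula.liftQ_subst] using this
  | allQE t _ ih =>
    rw [Formula.instQ_subst]
    exact .allQE _ (ih ρ σ)
  | reflB b => exact .reflB _
  | reflQ t => exact .reflQ _
  | substB _ _ ih₁ ih₂ =>
    have h₂ := ih₂ ρ σ
    rw [Formula.instB_subst] at h₂ ⊢
    exact .substB (ih₁ ρ σ) h₂
  | substQ _ _ ih₁ ih₂ =>
    have h₂ := ih₂ ρ σ
    rw [Formula.instQ_subst] at h₂ ⊢
    exact .substQ (ih₁ ρ σ) h₂

theorem Provable.efq {Γ : Set (Formula ε)} {φ : Formula ε} (h : Provable Γ .falsum) :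
    Provable Γ φ :=
  .raa (h.mono (Set.subset_insert _ _))

end Derivability

/-! ## Semantics -/

/-- A structure with body domain `B` and quantity domain `Q`; the operations and the order on `Q`
are taken from type classes. -/
structure Frame (ε B Q : Type) where
  iob : B → Prop
  ph : B → Prop
  ext : ε → B → Prop
  W : B → B → (Fin 4 → Q) → Prop

section Semantics

variable {ε B Q : Type} [Add Q] [Mul Q]

def QTerm.eval (g : ℕ → Q) : QTerm → Q
  | .var n => g n
  | .add s t => s.eval g + t.eval g
  | .mul s t => s.eval g * t.eval g

theorem QTerm.eval_subst (g : ℕ → Q) (σ : ℕ → QTerm) (t : QTerm) :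
    (t.subst σ).eval g = t.eval (fun n => (σ n).eval g) := by
  induction t with
  | var n => rfl
  | add s t hs ht => simp only [QTerm.subst, QTerm.eval, hs, ht]
  | mul s t hs ht => simp only [QTerm.subst, QTerm.eval, hs, ht]

variable [LE Q]

/-- Satisfaction under the valuations `f` of the body and `g` of the quantity variables. -/
def Frame.Sat (I : Frame ε B Q) : (ℕ → B) → (ℕ → Q) → Formula ε → Prop
  | _, _, .falsum => False
  | f, g, .imp φ ψ => I.Sat f g φ → I.Sat f g ψ
  | f, g, .allB φ => ∀ b, I.Sat (scons b f) g φ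
  | f, g, .allQ φ => ∀ q, I.Sat f (scons q g) φ
  | f, _, .eqB a b => f a = f b
  | _, g, .eqQ s t => s.eval g = t.eval g
  | _, g, .le s t => s.eval g ≤ t.eval g
  | f, _, .iob k => I.iob (f k)
  | f, _, .ph p => I.ph (f p)
  | f, _, .ext R b => I.ext R (f b)
  | f, g, .W k b x => I.W (f k) (f b) (fun i => (x i).eval g)

theorem Frame.sat_subst (I : Frame ε B Q) (f : ℕ → B) (g : ℕ → Q) (ρ : ℕ → ℕ) (σ : ℕ → QTerm)
    (φ : Formula ε) :
    I.Sat f g (φ.subst ρ σ) ↔ I.Sat (fun n => f (ρ n)) (fun n => (σ n).eval g) φ := by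
  induction φ generalizing f g ρ σ with
  | imp φ ψ hφ hψ => simp only [Formula.subst, Frame.Sat, hφ, hψ]
  | allB φ ih =>
    simp only [Formula.subst, Frame.Sat, ih]
    refine forall_congr' fun b => ?_
    have : (fun n => scons b f (upB ρ n)) = scons b (fun n => f (ρ n)) := by
      funext n; cases n <;> rfl
    rw [this]
  | allQ φ ih =>
    simp only [Formula.subst, Frame.Sat, ih]
    refine forall_congr' fun b => ?_
    have : (fun n => (upQ σ n).eval (scons b g)) = scons b (fun n => (σ n).eval g) := by
      funext n
      cases n with
      | zero => rfl
      | succ n => exact QTerm.eval_subst _ _ _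
    rw [this]
  | _ => simp only [Formula.subst, Frame.Sat, QTerm.eval_subst]

theorem Frame.sat_instB (I : Frame ε B Q) (f : ℕ → B) (g : ℕ → Q) (φ : Formula ε) (b : ℕ) :
    I.Sat f g (φ.instB b) ↔ I.Sat (scons (f b) f) g φ := by
  rw [Formula.instB, Frame.sat_subst]
  have : (fun n => f (scons b id n)) = scons (f b) f := by funext n; cases n <;> rfl
  rw [this]; rfl

theorem Frame.sat_instQ (I : Frame ε B Q) (f : ℕ → B) (g : ℕ → Q) (φ : Formula ε) (t : QTerm) :
    I.Sat f g (φ.instQ t) ↔ I.Sat f (scons (t.eval g) g) φ := by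
  rw [Formula.instQ, Frame.sat_subst]
  have : (fun n => (scons t .var n : QTerm).eval g) = scons (t.eval g) g := by
    funext n; cases n <;> rfl
  rw [this]; rfl

/-- Soundness of the calculus. -/
theorem Provable.sound {Γ : Set (Formula ε)} {φ : Formula ε} (h : Provable Γ φ)
    (I : Frame ε B Q) (f : ℕ → B) (g : ℕ → Q) (hΓ : ∀ ψ ∈ Γ, I.Sat f g ψ) : I.Sat f g φ := by
  induction h generalizing f g with
  | hyp h => exact hΓ _ h
  | impI _ ih =>
    intro h
    exact ih f g (by rintro ψ (rfl | hψ); exacts [h, hΓ ψ hψ])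
  | impE _ _ ih₁ ih₂ => exact ih₁ f g hΓ (ih₂ f g hΓ)
  | raa _ ih =>
    by_contra h
    exact ih f g (by rintro ψ (rfl | hψ); exacts [h, hΓ ψ hψ])
  | allBI _ ih =>
    intro b
    refine ih _ _ ?_
    rintro _ ⟨ψ, hψ, rfl⟩
    exact (I.sat_subst _ _ _ _ _).2 (hΓ ψ hψ)
  | allBE b _ ih => exact (I.sat_instB _ _ _ _).2 (ih f g hΓ _)
  | allQI _ ih =>
    intro q
    refine ih _ _ ?_
    rintro _ ⟨ψ, hψ, rfl⟩
    exact (I.sat_subst _ _ _ _ _).2 (hΓ ψ hψ)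
  | allQE t _ ih => exact (I.sat_instQ _ _ _ _).2 (ih f g hΓ _)
  | reflB b => rfl
  | reflQ t => rfl
  | substB _ _ ih₁ ih₂ =>
    have h₁ : f _ = f _ := ih₁ f g hΓ
    rw [I.sat_instB, ← h₁, ← I.sat_instB]
    exact ih₂ f g hΓ
  | substQ _ _ ih₁ ih₂ =>
    have h₁ : QTerm.eval g _ = QTerm.eval g _ := ih₁ f g hΓ
    rw [I.sat_instQ, ← h₁, ← I.sat_instQ]
    exact ih₂ f g hΓ

end Semantics

/-! ## Free variables -/

section Free

variable {ε : Type}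

theorem QTerm.VarsBelow.mono {m m' : ℕ} (h : m ≤ m') {t : QTerm} (ht : t.VarsBelow m) :
    t.VarsBelow m' := by
  induction t with
  | var n => exact lt_of_lt_of_le ht h
  | add s t hs ih => exact ⟨hs ht.1, ih ht.2⟩
  | mul s t hs ih => exact ⟨hs ht.1, ih ht.2⟩

theorem QTerm.exists_varsBelow (t : QTerm) : ∃ m, t.VarsBelow m := by
  induction t with
  | var n => exact ⟨n + 1, Nat.lt_succ_self n⟩
  | add s t hs ht =>
    obtain ⟨⟨a, ha⟩, b, hb⟩ := hs, ht
    exact ⟨max a b, ha.mono (le_max_left a b), hb.mono (le_max_right a b)⟩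
  | mul s t hs ht =>
    obtain ⟨⟨a, ha⟩, b, hb⟩ := hs, ht
    exact ⟨max a b, ha.mono (le_max_left a b), hb.mono (le_max_right a b)⟩

theorem QTerm.VarsBelow.subst_congr {m : ℕ} {t : QTerm} (ht : t.VarsBelow m) {σ σ' : ℕ → QTerm}
    (h : ∀ n < m, σ n = σ' n) : t.subst σ = t.subst σ' := by
  induction t with
  | var n => exact h n ht
  | add s t hs ih => simp only [QTerm.subst, hs ht.1, ih ht.2]
  | mul s t hs ih => simp only [QTerm.subst, hs ht.1, ih ht.2]

theorem Formula.FreeBelow.mono {n n' m m' : ℕ} (hn : n ≤ n') (hm : m ≤ m') {φ : Formula ε}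
    (h : φ.FreeBelow n m) : φ.FreeBelow n' m' := by
  induction φ generalizing n n' m m' with
  | falsum => trivial
  | imp φ ψ hφ hψ => exact ⟨hφ hn hm h.1, hψ hn hm h.2⟩
  | allB φ ih => exact ih (Nat.succ_le_succ hn) hm h
  | allQ φ ih => exact ih hn (Nat.succ_le_succ hm) h
  | eqB a b => exact ⟨h.1.trans_le hn, h.2.trans_le hn⟩
  | eqQ s t => exact ⟨h.1.mono hm, h.2.mono hm⟩
  | le s t => exact ⟨h.1.mono hm, h.2.mono hm⟩
  | iob k => exact lt_of_lt_of_le h hn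
  | ph k => exact lt_of_lt_of_le h hn
  | ext R k => exact lt_of_lt_of_le h hn
  | W k b x => exact ⟨h.1.trans_le hn, h.2.1.trans_le hn, fun i => (h.2.2 i).mono hm⟩

theorem Formula.exists_freeBelow (φ : Formula ε) : ∃ n, φ.FreeBelow n n := by
  induction φ with
  | falsum => exact ⟨0, trivial⟩
  | imp φ ψ hφ hψ =>
    obtain ⟨⟨a, ha⟩, b, hb⟩ := hφ, hψ
    exact ⟨max a b, ha.mono (le_max_left a b) (le_max_left a b),
      hb.mono (le_max_right a b) (le_max_right a b)⟩
  | allB φ ih =>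
    obtain ⟨a, ha⟩ := ih
    exact ⟨a, Formula.FreeBelow.mono (Nat.le_succ a) le_rfl ha⟩
  | allQ φ ih =>
    obtain ⟨a, ha⟩ := ih
    exact ⟨a, Formula.FreeBelow.mono le_rfl (Nat.le_succ a) ha⟩
  | eqB a b => exact ⟨max a b + 1, by simp only [FreeBelow]; omega⟩
  | eqQ s t =>
    obtain ⟨⟨a, ha⟩, b, hb⟩ := s.exists_varsBelow, t.exists_varsBelow
    exact ⟨max a b, ha.mono (le_max_left a b), hb.mono (le_max_right a b)⟩
  | le s t =>
    obtain ⟨⟨a, ha⟩, b, hb⟩ := s.exists_varsBelow, t.exists_varsBelow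
    exact ⟨max a b, ha.mono (le_max_left a b), hb.mono (le_max_right a b)⟩
  | iob k => exact ⟨k + 1, Nat.lt_succ_self k⟩
  | ph k => exact ⟨k + 1, Nat.lt_succ_self k⟩
  | ext R k => exact ⟨k + 1, Nat.lt_succ_self k⟩
  | W k b x =>
    choose m hm using fun i => (x i).exists_varsBelow
    refine ⟨max (max k b + 1) (Finset.univ.sup m), by omega, by omega, fun i => (hm i).mono ?_⟩
    exact (Finset.le_sup (Finset.mem_univ i)).trans (le_max_right _ _)

theorem Formula.FreeBelow.subst_congr {n m : ℕ} {φ : Formula ε} (h : φ.FreeBelow n m)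
    {ρ ρ' : ℕ → ℕ} {σ σ' : ℕ → QTerm} (hρ : ∀ i < n, ρ i = ρ' i) (hσ : ∀ i < m, σ i = σ' i) :
    φ.subst ρ σ = φ.subst ρ' σ' := by
  induction φ generalizing n m ρ ρ' σ σ' with
  | falsum => rfl
  | imp φ ψ hφ hψ => simp only [Formula.subst, hφ h.1 hρ hσ, hψ h.2 hρ hσ]
  | allB φ ih =>
    simp only [Formula.subst]
    rw [ih h (ρ := upB ρ) (ρ' := upB ρ') _ hσ]
    rintro (_ | i) hi
    · rfl
    · simp only [upB, scons, hρ i (Nat.lt_of_succ_lt_succ hi)]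
  | allQ φ ih =>
    simp only [Formula.subst]
    rw [ih h (σ := upQ σ) (σ' := upQ σ') hρ _]
    rintro (_ | i) hi
    · rfl
    · simp only [upQ, scons, hσ i (Nat.lt_of_succ_lt_succ hi)]
  | eqB a b => simp only [Formula.subst, hρ _ h.1, hρ _ h.2]
  | eqQ s t => simp only [Formula.subst, h.1.subst_congr hσ, h.2.subst_congr hσ]
  | le s t => simp only [Formula.subst, h.1.subst_congr hσ, h.2.subst_congr hσ]
  | iob k => simp only [Formula.subst, hρ _ h]
  | ph k => simp only [Formula.subst, hρ _ h]
  | ext R k => simp only [Formula.subst, hρ _ h]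
  | W k b x =>
    simp only [Formula.subst, hρ _ h.1, hρ _ h.2.1, fun i => (h.2.2 i).subst_congr hσ]

/-- The variables with index `b`, of either sort, are not free in `φ`. -/
def Formula.Fresh (b : ℕ) (φ : Formula ε) : Prop :=
  ∀ (ρ ρ' : ℕ → ℕ) (σ σ' : ℕ → QTerm), (∀ n ≠ b, ρ n = ρ' n) → (∀ n ≠ b, σ n = σ' n) →
    φ.subst ρ σ = φ.subst ρ' σ'

theorem Formula.exists_fresh (φ : Formula ε) : ∃ N, ∀ b ≥ N, φ.Fresh b := by
  obtain ⟨N, hN⟩ := φ.exists_freeBelow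
  exact ⟨N, fun b hb ρ ρ' σ σ' hρ hσ =>
    hN.subst_congr (fun i hi => hρ i (by omega)) (fun i hi => hσ i (by omega))⟩

end Free

/-! ## Countability of the language -/

section Countable

def QTerm.code : QTerm → ℕ
  | .var n => Nat.pair 0 n
  | .add s t => Nat.pair 1 (Nat.pair s.code t.code)
  | .mul s t => Nat.pair 2 (Nat.pair s.code t.code)

theorem QTerm.code_injective : Function.Injective QTerm.code := by
  intro s
  induction s with
  | var n => intro t h; cases t <;> simp_all [QTerm.code, Nat.pair_eq_pair]
  | add a b ha hb =>
    intro t h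
    cases t <;> simp only [QTerm.code, Nat.pair_eq_pair] at h
    · omega
    · rw [ha h.2.1, hb h.2.2]
    · omega
  | mul a b ha hb =>
    intro t h
    cases t <;> simp only [QTerm.code, Nat.pair_eq_pair] at h
    · omega
    · omega
    · rw [ha h.2.1, hb h.2.2]

variable {ε : Type}

def Formula.code (e : ε → ℕ) : Formula ε → ℕ
  | .falsum => Nat.pair 0 0
  | .imp φ ψ => Nat.pair 1 (Nat.pair (φ.code e) (ψ.code e))
  | .allB φ => Nat.pair 2 (φ.code e)
  | .allQ φ => Nat.pair 3 (φ.code e)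
  | .eqB a b => Nat.pair 4 (Nat.pair a b)
  | .eqQ s t => Nat.pair 5 (Nat.pair s.code t.code)
  | .le s t => Nat.pair 6 (Nat.pair s.code t.code)
  | .iob k => Nat.pair 7 k
  | .ph k => Nat.pair 8 k
  | .ext R b => Nat.pair 9 (Nat.pair (e R) b)
  | .W k b x => Nat.pair 10 (Nat.pair (Nat.pair k b)
      (Nat.pair (Nat.pair (x 0).code (x 1).code) (Nat.pair (x 2).code (x 3).code)))

theorem Formula.code_injective {e : ε → ℕ} (he : Function.Injective e) :
    Function.Injective (Formula.code e) := by
  intro φ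
  induction φ with
  | falsum => intro ψ h; cases ψ <;> simp_all [Formula.code, Nat.pair_eq_pair]
  | imp a b ha hb =>
    intro ψ h
    cases ψ <;> simp [Formula.code, Nat.pair_eq_pair] at h
    rw [ha h.1, hb h.2]
  | allB a ha =>
    intro ψ h
    cases ψ <;> simp [Formula.code, Nat.pair_eq_pair] at h
    rw [ha h]
  | allQ a ha =>
    intro ψ h
    cases ψ <;> simp [Formula.code, Nat.pair_eq_pair] at h
    rw [ha h]
  | ext R b =>
    intro ψ h
    cases ψ <;> simp [Formula.code, Nat.pair_eq_pair] at h
    rw [he h.1, h.2]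
  | W k b x =>
    intro ψ h
    cases ψ <;> simp [Formula.code, Nat.pair_eq_pair] at h
    obtain ⟨⟨rfl, rfl⟩, ⟨h0, h1⟩, h2, h3⟩ := h
    congr 1
    funext i
    fin_cases i
    exacts [QTerm.code_injective h0, QTerm.code_injective h1, QTerm.code_injective h2,
      QTerm.code_injective h3]
  | _ =>
    intro ψ h
    cases ψ <;> simp [Formula.code, Nat.pair_eq_pair, QTerm.code_injective.eq_iff] at h
    simp [h]

instance [Countable ε] : Countable (Formula ε) := by
  obtain ⟨e, he⟩ := exists_injective_nat ε
  exact (Formula.code_injective he).countable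

end Countable

/-! ## Completeness of the calculus -/

section Completeness

variable {ε : Type}

def Consistent (Δ : Set (Formula ε)) : Prop := ¬ Provable Δ .falsum

theorem Consistent.insert_or {Δ : Set (Formula ε)} (h : Consistent Δ) (φ : Formula ε) :
    Consistent (insert φ Δ) ∨ Consistent (insert (∼φ) Δ) := by
  by_contra! hc
  obtain ⟨h₁, h₂⟩ := hc
  exact h (.impE (.impI (not_not.1 h₁)) (.raa (not_not.1 h₂)))

/-- Generalization on a fresh body variable. -/
theorem Provable.allB_of_fresh {Δ : Set (Formula ε)} {χ : Formula ε} {b : ℕ}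
    (hΔ : ∀ ψ ∈ Δ, ψ.Fresh b) (hχ : χ.allB.Fresh b) (h : Provable Δ (χ.instB b)) :
    Provable Δ χ.allB := by
  refine .allBI ?_
  -- This renaming sends the fresh `b` to `0` and agrees with the lift elsewhere. So it acts on `Δ`
  -- as the lift, and it turns the instance of `χ` at `b` back into `χ`.
  have h' := h.subst (fun n => if n = b then 0 else n + 1) .var
  have e₁ : Formula.subst (fun n => if n = b then 0 else n + 1) .var '' Δ
      = Formula.liftB '' Δ := by
    refine Set.image_congr fun ψ hψ => hΔ ψ hψ _ _ _ _ (fun n hn => ?_) (fun _ _ => rfl)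
    simp [hn]
  have e₂ : (χ.instB b).subst (fun n => if n = b then 0 else n + 1) .var = χ := by
    have := hχ (fun n => if n = b then 0 else n + 1) (fun n => n + 1) .var .var
      (fun n hn => by simp [hn]) (fun _ _ => rfl)
    simp only [Formula.subst, Formula.allB.injEq] at this
    rw [Formula.instB_subst, this, if_pos rfl, Formula.instB_upB_subst]
    conv_rhs => rw [← χ.subst_id]
    congr 1
    funext n; cases n <;> rfl
  rwa [e₁, e₂] at h'

/-- Generalization on a fresh quantity variable. -/
theorem Provable.allQ_of_fresh {Δ : Set (Formula ε)} {χ : Formula ε} {b : ℕ}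
    (hΔ : ∀ ψ ∈ Δ, ψ.Fresh b) (hχ : χ.allQ.Fresh b) (h : Provable Δ (χ.instQ (.var b))) :
    Provable Δ χ.allQ := by
  refine .allQI ?_
  have h' := h.subst id (fun n => .var (if n = b then 0 else n + 1))
  have e₁ : Formula.subst id (fun n => .var (if n = b then 0 else n + 1)) '' Δ
      = Formula.liftQ '' Δ := by
    refine Set.image_congr fun ψ hψ => hΔ ψ hψ _ _ _ _ (fun _ _ => rfl) (fun n hn => ?_)
    simp [hn]
  have e₂ : (χ.instQ (.var b)).subst id (fun n => .var (if n = b then 0 else n + 1)) = χ := by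
    have := hχ id id (fun n => .var (if n = b then 0 else n + 1)) (fun n => .var (n + 1))
      (fun _ _ => rfl) (fun n hn => by simp [hn])
    simp only [Formula.subst, Formula.allQ.injEq] at this
    rw [Formula.instQ_subst, this, Formula.instQ_upQ_subst]
    conv_rhs => rw [← χ.subst_id]
    congr 1
    funext n; cases n <;> simp [scons, QTerm.subst]
  rwa [e₁, e₂] at h'

/-- Consistent sets leaving infinitely many variables of each sort unused. -/
def Extendable (Δ : Set (Formula ε)) : Prop :=
  Consistent Δ ∧ {b | ∀ ψ ∈ Δ, Formula.Fresh b ψ}.Infinite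

theorem Extendable.insert {Δ : Set (Formula ε)} (h : Extendable Δ) {φ : Formula ε}
    (hc : Consistent (insert φ Δ)) : Extendable (insert φ Δ) := by
  refine ⟨hc, ?_⟩
  obtain ⟨N, hN⟩ := φ.exists_fresh
  refine (h.2.sdiff (Set.finite_lt_nat N)).mono ?_
  rintro b ⟨hb, hbN⟩ ψ (rfl | hψ)
  · exact hN b (by simpa using hbN)
  · exact hb ψ hψ

theorem Extendable.exists_fresh {Δ : Set (Formula ε)} (h : Extendable Δ) :
    ∃ b, ∀ ψ ∈ Δ, Formula.Fresh b ψ := h.2.nonempty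

theorem Formula.Fresh.of_neg {b : ℕ} {φ : Formula ε} (h : (∼φ).Fresh b) : φ.Fresh b := by
  intro ρ ρ' σ σ' hρ hσ
  have := h ρ ρ' σ σ' hρ hσ
  simp only [Formula.neg, Formula.subst, Formula.imp.injEq] at this
  exact this.1

/-- `Δ` decides `φ`, with a counterexample if `φ` is a refuted universal formula. -/
def Decides (Δ : Set (Formula ε)) (φ : Formula ε) : Prop :=
  φ ∈ Δ ∨ (∼φ ∈ Δ ∧ (∀ χ, φ = .allB χ → ∃ b, ∼(χ.instB b) ∈ Δ) ∧
    ∀ χ, φ = .allQ χ → ∃ t, ∼(χ.instQ t) ∈ Δ)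

/-- One step of the Henkin construction. When `φ` cannot be added consistently, its negation can; a
refuted universal formula also gets a refuted instance at a fresh variable. -/
theorem Extendable.exists_decides {Δ : Set (Formula ε)} (h : Extendable Δ) (φ : Formula ε) :
    ∃ Δ', Δ ⊆ Δ' ∧ Extendable Δ' ∧ Decides Δ' φ := by
  rcases h.1.insert_or φ with hc | hc
  · exact ⟨_, Set.subset_insert _ _, h.insert hc, .inl (Set.mem_insert _ _)⟩
  have h' := h.insert hc
  obtain ⟨b, hb⟩ := h'.exists_fresh
  have hφ : φ.Fresh b := (hb _ (Set.mem_insert _ _)).of_neg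
  -- If the counterexample were inconsistent with the rest, the instance `θ` would be derivable, and
  -- by generalization `φ` itself, next to its negation.
  have key : ∀ θ : Formula ε, (Provable (Insert.insert (∼φ) Δ) θ → Provable (Insert.insert (∼φ) Δ) φ) →
      Consistent (Insert.insert (∼θ) (Insert.insert (∼φ) Δ)) := fun θ hθ hp =>
    hc (.impE (.hyp (Set.mem_insert _ _)) (hθ (.raa hp)))
  cases φ with
  | allB χ =>
    refine ⟨_, (Set.subset_insert _ _).trans (Set.subset_insert _ _),
      h'.insert (key (χ.instB b) (Provable.allB_of_fresh hb hφ)),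
      .inr ⟨Set.mem_insert_of_mem _ (Set.mem_insert _ _), ?_, ?_⟩⟩
    · rintro _ ⟨rfl⟩; exact ⟨b, Set.mem_insert _ _⟩
    · rintro _ ⟨⟩
  | allQ χ =>
    refine ⟨_, (Set.subset_insert _ _).trans (Set.subset_insert _ _),
      h'.insert (key (χ.instQ (.var b)) (Provable.allQ_of_fresh hb hφ)),
      .inr ⟨Set.mem_insert_of_mem _ (Set.mem_insert _ _), ?_, ?_⟩⟩
    · rintro _ ⟨⟩
    · rintro _ ⟨rfl⟩; exact ⟨.var b, Set.mem_insert _ _⟩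
  | _ =>
    refine ⟨_, Set.subset_insert _ _, h', .inr ⟨Set.mem_insert _ _, ?_, ?_⟩⟩ <;> rintro _ ⟨⟩

/-- Henkin sets: complete consistent sets of formulas with counterexamples. -/
structure IsHenkin (G : Set (Formula ε)) : Prop where
  falsum : Formula.falsum ∉ G
  -- Two premises are enough for every rule used on the term model; fewer premises are covered by
  -- repetition.
  closed : ∀ {φ ψ θ : Formula ε}, φ ∈ G → ψ ∈ G → Provable {φ, ψ} θ → θ ∈ G
  decides : ∀ φ, Decides G φ

/-- All formulas are enumerated and decided one after another, and the union of the stages is taken.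
Finiteness of derivations is not used: a formula derived from two members but refuted would already
make a single stage inconsistent. -/
theorem Extendable.exists_isHenkin [Countable ε] {Δ : Set (Formula ε)} (h : Extendable Δ) :
    ∃ G, Δ ⊆ G ∧ IsHenkin G := by
  have : Nonempty (Formula ε) := ⟨.falsum⟩
  obtain ⟨enum, henum⟩ := exists_surjective_nat (Formula ε)
  choose F hF using fun (D : {Δ : Set (Formula ε) // Extendable Δ}) (φ : Formula ε) =>
    D.2.exists_decides φ
  let D : ℕ → {Δ : Set (Formula ε) // Extendable Δ} := fun n =>
    Nat.rec ⟨Δ, h⟩ (fun n D => ⟨F D (enum n), (hF D (enum n)).2.1⟩) n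
  have hD : ∀ n, (D n).1 ⊆ (D (n + 1)).1 ∧ Decides (D (n + 1)).1 (enum n) := fun n =>
    ⟨(hF (D n) (enum n)).1, (hF (D n) (enum n)).2.2⟩
  have hmono : Monotone fun n => (D n).1 := monotone_nat_of_le_succ fun n => (hD n).1
  have hsub : ∀ n, (D n).1 ⊆ ⋃ n, (D n).1 := fun n => Set.subset_iUnion (fun n => (D n).1) n
  refine ⟨⋃ n, (D n).1, hsub 0, ?_, ?_, ?_⟩
  · rw [Set.mem_iUnion]
    rintro ⟨n, hn⟩
    exact (D n).2.1 (.hyp hn)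
  · intro φ ψ θ hφ hψ hp
    obtain ⟨i, hi⟩ := Set.mem_iUnion.1 hφ
    obtain ⟨j, hj⟩ := Set.mem_iUnion.1 hψ
    obtain ⟨n, rfl⟩ := henum θ
    rcases (hD n).2 with hθ | ⟨hθ, -⟩
    · exact hsub (n + 1) hθ
    · exfalso
      set m := max (max i j) (n + 1)
      have hi' := hmono (show i ≤ m by omega) hi
      have hj' := hmono (show j ≤ m by omega) hj
      have hθ' := hmono (show n + 1 ≤ m by omega) hθ
      refine (D m).2.1 (.impE (.hyp hθ') (hp.mono ?_))
      rintro _ (rfl | rfl)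
      exacts [hi', hj']
  · intro φ
    obtain ⟨n, rfl⟩ := henum φ
    rcases (hD n).2 with hθ | ⟨hθ, hB, hQ⟩
    · exact .inl (hsub (n + 1) hθ)
    · refine .inr ⟨hsub (n + 1) hθ, fun χ hχ => ?_, fun χ hχ => ?_⟩
      · obtain ⟨b, hb⟩ := hB χ hχ
        exact ⟨b, hsub (n + 1) hb⟩
      · obtain ⟨b, hb⟩ := hQ χ hχ
        exact ⟨b, hsub (n + 1) hb⟩

namespace IsHenkin

variable {G : Set (Formula ε)} (hG : IsHenkin G)
include hG

theorem closed₁ {φ θ : Formula ε} (hφ : φ ∈ G) (h : Provable {φ} θ) : θ ∈ G :=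
  hG.closed hφ hφ (by rwa [Set.pair_eq_singleton])

theorem neg_mem {φ : Formula ε} : ∼φ ∈ G ↔ φ ∉ G := by
  constructor
  · intro h₁ h₂
    exact hG.falsum (hG.closed h₁ h₂ (.impE (.hyp (.inl rfl)) (.hyp (.inr rfl))))
  · intro h
    exact ((hG.decides φ).resolve_left h).1

theorem imp_mem {φ ψ : Formula ε} : (φ ⤇ ψ) ∈ G ↔ (φ ∈ G → ψ ∈ G) := by
  constructor
  · intro h₁ h₂
    exact hG.closed h₁ h₂ (.impE (.hyp (.inl rfl)) (.hyp (.inr rfl)))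
  · intro h
    by_cases hφ : φ ∈ G
    · exact hG.closed₁ (h hφ) (.impI (.hyp (.inr rfl)))
    · refine hG.closed₁ (hG.neg_mem.2 hφ) (.impI (Provable.efq (.impE (φ := φ) ?_ ?_)))
      · exact .hyp (.inr rfl)
      · exact .hyp (.inl rfl)

theorem allB_mem {φ : Formula ε} : φ.allB ∈ G ↔ ∀ b, φ.instB b ∈ G := by
  constructor
  · intro h b
    exact hG.closed₁ h (.allBE b (.hyp rfl))
  · intro h
    by_contra hn
    obtain ⟨b, hb⟩ := ((hG.decides _).resolve_left hn).2.1 φ rfl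
    exact hG.neg_mem.1 hb (h b)

theorem allQ_mem {φ : Formula ε} : φ.allQ ∈ G ↔ ∀ t, φ.instQ t ∈ G := by
  constructor
  · intro h b
    exact hG.closed₁ h (.allQE b (.hyp rfl))
  · intro h
    by_contra hn
    obtain ⟨b, hb⟩ := ((hG.decides _).resolve_left hn).2.2 φ rfl
    exact hG.neg_mem.1 hb (h b)

theorem mem_of_eqB {φ : Formula ε} {a b : ℕ} (hab : .eqB a b ∈ G) (h : φ.instB a ∈ G) :
    φ.instB b ∈ G :=
  hG.closed hab h (.substB (.hyp (.inl rfl)) (.hyp (.inr rfl)))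

theorem mem_of_eqQ {φ : Formula ε} {s t : QTerm} (hst : .eqQ s t ∈ G) (h : φ.instQ s ∈ G) :
    φ.instQ t ∈ G :=
  hG.closed hst h (.substQ (.hyp (.inl rfl)) (.hyp (.inr rfl)))

theorem valid_mem {φ : Formula ε} (h : Provable ∅ φ) : φ ∈ G := by
  by_contra hn
  exact hn (hG.closed₁ (hG.neg_mem.2 hn) (h.mono (Set.empty_subset _)))

end IsHenkin

/-! ### The term model -/

namespace IsHenkin

variable {G : Set (Formula ε)} (hG : IsHenkin G)
include hG

theorem eqB_symm {a b : ℕ} (h : .eqB a b ∈ G) : .eqB b a ∈ G :=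
  hG.mem_of_eqB (φ := .eqB 0 (a + 1)) h (hG.valid_mem (.reflB a))

theorem eqB_trans {a b c : ℕ} (h : .eqB a b ∈ G) (h' : .eqB b c ∈ G) : .eqB a c ∈ G :=
  hG.mem_of_eqB (φ := .eqB (a + 1) 0) h' h

end IsHenkin

def QTerm.lift (t : QTerm) : QTerm := t.subst fun m => .var (m + 1)

@[simp] theorem QTerm.lift_subst_scons (s t : QTerm) : s.lift.subst (scons t .var) = s := by
  rw [QTerm.lift, QTerm.subst_subst]
  exact s.subst_var

namespace IsHenkin

variable {G : Set (Formula ε)} (hG : IsHenkin G)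
include hG

theorem eqQ_congr {s t u w : QTerm} (h : .eqQ s t ∈ G) (hu : u.subst (scons s .var) = w)
    : .eqQ w (u.subst (scons t .var)) ∈ G := by
  have := hG.mem_of_eqQ (φ := .eqQ w.lift u) h
    (by simpa [Formula.instQ, Formula.subst, hu] using hG.valid_mem (.reflQ w))
  simpa [Formula.instQ, Formula.subst] using this

theorem eqQ_symm {a b : QTerm} (h : .eqQ a b ∈ G) : .eqQ b a ∈ G := by
  have := hG.mem_of_eqQ (φ := .eqQ (.var 0) a.lift) h
    (by simpa [Formula.instQ, Formula.subst, QTerm.subst, scons] using hG.valid_mem (.reflQ a))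
  simpa [Formula.instQ, Formula.subst, QTerm.subst, scons] using this

theorem eqQ_trans {a b c : QTerm} (h : .eqQ a b ∈ G) (h' : .eqQ b c ∈ G) : .eqQ a c ∈ G := by
  have := hG.mem_of_eqQ (φ := .eqQ a.lift (.var 0)) h'
    (by simpa [Formula.instQ, Formula.subst, QTerm.subst, scons] using h)
  simpa [Formula.instQ, Formula.subst, QTerm.subst, scons] using this

theorem eqQ_add {a b c d : QTerm} (h : .eqQ a b ∈ G) (h' : .eqQ c d ∈ G) :
    .eqQ (a.add c) (b.add d) ∈ G := by
  have h₁ := hG.eqQ_congr (u := .add (.var 0) c.lift) h rfl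
  have h₂ := hG.eqQ_congr (u := .add b.lift (.var 0)) h' rfl
  simp only [QTerm.subst, QTerm.lift_subst_scons, scons] at h₁ h₂
  exact hG.eqQ_trans h₁ h₂

theorem eqQ_mul {a b c d : QTerm} (h : .eqQ a b ∈ G) (h' : .eqQ c d ∈ G) :
    .eqQ (a.mul c) (b.mul d) ∈ G := by
  have h₁ := hG.eqQ_congr (u := .mul (.var 0) c.lift) h rfl
  have h₂ := hG.eqQ_congr (u := .mul b.lift (.var 0)) h' rfl
  simp only [QTerm.subst, QTerm.lift_subst_scons, scons] at h₁ h₂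
  exact hG.eqQ_trans h₁ h₂

theorem le_congr {a b c d : QTerm} (h : .eqQ a b ∈ G) (h' : .eqQ c d ∈ G) (hac : .le a c ∈ G) :
    .le b d ∈ G := by
  have h₁ := hG.mem_of_eqQ (φ := .le (.var 0) c.lift) h
    (by simpa [Formula.instQ, Formula.subst, QTerm.subst, scons] using hac)
  have h₂ := hG.mem_of_eqQ (φ := .le b.lift (.var 0)) h'
    (by simpa [Formula.instQ, Formula.subst, QTerm.subst, scons] using h₁)
  simpa [Formula.instQ, Formula.subst, QTerm.subst, scons] using h₂

/-- The equality rule substitutes for one variable, so the coordinates of a point have to be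
exchanged one by one. -/
theorem W_update {k b : ℕ} {x : Fin 4 → QTerm} {i : Fin 4} {t : QTerm} (h : .eqQ (x i) t ∈ G)
    (hx : .W k b x ∈ G) : .W k b (Function.update x i t) ∈ G := by
  have key : ∀ u : QTerm, (Formula.W (ε := ε) k b
      (Function.update (fun j => (x j).lift) i (.var 0))).instQ u =
      .W k b (Function.update x i u) := by
    intro u
    simp only [Formula.instQ, Formula.subst, id]
    congr 1
    funext j
    by_cases hj : j = i
    · subst hj; simp [QTerm.subst, scons]
    · simp [hj]
  have := hG.mem_of_eqQ (φ := .W k b (Function.update (fun j => (x j).lift) i (.var 0))) h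
    (by rwa [key, Function.update_eq_self])
  rwa [key] at this

theorem W_congr {k k' b b' : ℕ} {x y : Fin 4 → QTerm} (hk : .eqB k k' ∈ G) (hb : .eqB b b' ∈ G)
    (hxy : ∀ i, .eqQ (x i) (y i) ∈ G) (h : .W k b x ∈ G) : .W k' b' y ∈ G := by
  have hk' : .W k' b x ∈ G := by
    have := hG.mem_of_eqB (φ := .W 0 (b + 1) x) hk (by simpa [Formula.instB, Formula.subst, scons])
    simpa [Formula.instB, Formula.subst, scons] using this
  have hb' : .W k' b' x ∈ G := by
    have := hG.mem_of_eqB (φ := .W (k' + 1) 0 x) hb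
      (by simpa [Formula.instB, Formula.subst, scons])
    simpa [Formula.instB, Formula.subst, scons] using this
  have key : ∀ s : Finset (Fin 4), .W k' b' (s.piecewise y x) ∈ G := by
    intro s
    induction s using Finset.induction with
    | empty => simpa using hb'
    | insert i s hi ih =>
      rw [Finset.piecewise_insert]
      refine hG.W_update ?_ ih
      rw [Finset.piecewise_eq_of_notMem _ _ _ hi]
      exact hxy i
  simpa using key Finset.univ

def setoidB : Setoid ℕ where
  r a b := .eqB a b ∈ G
  iseqv := ⟨fun a => hG.valid_mem (.reflB a), hG.eqB_symm, hG.eqB_trans⟩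

def setoidQ : Setoid QTerm where
  r a b := .eqQ a b ∈ G
  iseqv := ⟨fun a => hG.valid_mem (.reflQ a), hG.eqQ_symm, hG.eqQ_trans⟩

/-- The term model of a Henkin set satisfies exactly its elements. -/
theorem exists_model : ∃ (B Q : Type) (_ : Add Q) (_ : Mul Q) (_ : LE Q) (I : Frame ε B Q)
    (f : ℕ → B) (g : ℕ → Q), ∀ φ, I.Sat f g φ ↔ φ ∈ G := by
  let B := Quotient hG.setoidB
  let Q := Quotient hG.setoidQ
  let mkB : ℕ → B := Quotient.mk hG.setoidB
  let mkQ : QTerm → Q := Quotient.mk hG.setoidQ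
  let iA : Add Q := ⟨Quotient.map₂ QTerm.add fun _ _ h _ _ h' => hG.eqQ_add h h'⟩
  let iM : Mul Q := ⟨Quotient.map₂ QTerm.mul fun _ _ h _ _ h' => hG.eqQ_mul h h'⟩
  let iL : LE Q := ⟨fun s t => .le s.out t.out ∈ G⟩
  -- Relations are read off chosen representatives; the congruence lemmas make the choice
  -- irrelevant.
  let I : Frame ε B Q :=
    { iob := fun b => .iob b.out ∈ G
      ph := fun b => .ph b.out ∈ G
      ext := fun R b => .ext R b.out ∈ G
      W := fun k b x => .W k.out b.out (fun i => (x i).out) ∈ G }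
  have outB : ∀ b, .eqB (mkB b).out b ∈ G := fun b => Quotient.mk_out (s := hG.setoidB) b
  have outQ : ∀ t, .eqQ (mkQ t).out t ∈ G := fun t => Quotient.mk_out (s := hG.setoidQ) t
  have eval : ∀ (σ : ℕ → QTerm) (t : QTerm), t.eval (fun n => mkQ (σ n)) = mkQ (t.subst σ) := by
    intro σ t
    induction t with
    | var n => rfl
    | add s t hs ht => simp only [QTerm.eval, hs, ht, QTerm.subst]; rfl
    | mul s t hs ht => simp only [QTerm.eval, hs, ht, QTerm.subst]; rfl
  have unary : ∀ (φ : Formula ε) (b : ℕ), φ.instB (mkB b).out ∈ G ↔ φ.instB b ∈ G :=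
    fun φ b => ⟨hG.mem_of_eqB (outB b), hG.mem_of_eqB (hG.eqB_symm (outB b))⟩
  -- Arbitrary substitutions are carried along because a quantifier extends the valuation by the
  -- class of an arbitrary variable or term.
  have key : ∀ (φ : Formula ε) (ρ : ℕ → ℕ) (σ : ℕ → QTerm),
      I.Sat (fun n => mkB (ρ n)) (fun n => mkQ (σ n)) φ ↔ φ.subst ρ σ ∈ G := by
    intro φ
    induction φ with
    | falsum => exact fun ρ σ => ⟨False.elim, hG.falsum⟩
    | imp φ ψ hφ hψ =>
      intro ρ σ
      rw [Formula.subst, hG.imp_mem, ← hφ, ← hψ]; rfl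
    | allB φ ih =>
      intro ρ σ
      rw [Formula.subst, hG.allB_mem]
      simp only [Frame.Sat]
      refine Quotient.forall.trans (forall_congr' fun b => ?_)
      rw [Formula.instB_upB_subst, ← ih]
      have : scons (mkB b) (fun n => mkB (ρ n)) = fun n => mkB (scons b ρ n) := by
        funext n; cases n <;> rfl
      rw [← this]
    | allQ φ ih =>
      intro ρ σ
      rw [Formula.subst, hG.allQ_mem]
      simp only [Frame.Sat]
      refine Quotient.forall.trans (forall_congr' fun t => ?_)
      rw [Formula.instQ_upQ_subst, ← ih]
      have : scons (mkQ t) (fun n => mkQ (σ n)) = fun n => mkQ (scons t σ n) := by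
        funext n; cases n <;> rfl
      rw [← this]
    | eqB a b => exact fun ρ σ => Quotient.eq (r := hG.setoidB)
    | eqQ s t =>
      intro ρ σ
      simp only [Frame.Sat, eval]
      exact Quotient.eq (r := hG.setoidQ)
    | le s t =>
      intro ρ σ
      simp only [Frame.Sat, eval]
      exact ⟨hG.le_congr (outQ _) (outQ _),
        hG.le_congr (hG.eqQ_symm (outQ _)) (hG.eqQ_symm (outQ _))⟩
    | iob k => exact fun ρ σ => unary (.iob 0) _
    | ph k => exact fun ρ σ => unary (.ph 0) _
    | ext R k => exact fun ρ σ => unary (.ext R 0) _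
    | W k b x =>
      intro ρ σ
      simp only [Frame.Sat, eval]
      exact ⟨hG.W_congr (outB _) (outB _) fun _ => outQ _,
        hG.W_congr (hG.eqB_symm (outB _)) (hG.eqB_symm (outB _)) fun _ => hG.eqQ_symm (outQ _)⟩
  refine ⟨B, Q, iA, iM, iL, I, mkB, fun n => mkQ (.var n), fun φ => ?_⟩
  have := key φ id .var
  rwa [Formula.subst_id] at this

end IsHenkin

/-- Completeness of the calculus. -/
theorem Provable.of_forall_sat [Countable ε] {Γ : Set (Formula ε)} {φ : Formula ε}
    (h : ∀ (B Q : Type) [Add Q] [Mul Q] [LE Q] (I : Frame ε B Q) (f : ℕ → B) (g : ℕ → Q),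
      (∀ ψ ∈ Γ, I.Sat f g ψ) → I.Sat f g φ) : Provable Γ φ := by
  by_contra hφ
  -- Doubling all indices leaves every odd variable unused, even if `Γ` is infinite and uses all
  -- variables. Halving undoes it, so consistency is kept.
  let ρ : ℕ → ℕ := fun n => 2 * n
  let σ : ℕ → QTerm := fun n => .var (2 * n)
  have hE : Extendable (Formula.subst ρ σ '' insert (∼φ) Γ) := by
    constructor
    · intro hp
      refine hφ (.raa ?_)
      have hp' := hp.subst (fun n => n / 2) (fun n => .var (n / 2))
      rw [Set.image_image] at hp'
      have key : ∀ ψ : Formula ε,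
          (ψ.subst ρ σ).subst (fun n => n / 2) (fun n => .var (n / 2)) = ψ := by
        intro ψ
        rw [Formula.subst_subst]
        conv_rhs => rw [← ψ.subst_id]
        congr 1
        · funext n; simp [ρ]
        · funext n; simp [σ, QTerm.subst]
      simp only [key, Set.image_id'] at hp'
      exact hp'
    · refine (Set.infinite_range_of_injective (f := fun n : ℕ => 2 * n + 1)
        (fun a b hab => by simpa using hab)).mono ?_
      rintro _ ⟨n, rfl⟩ _ ⟨ψ, -, rfl⟩ ρ₁ ρ₂ σ₁ σ₂ hρ hσ
      simp only [Formula.subst_subst]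
      congr 1
      · funext i; exact hρ _ (by simp only [ρ]; omega)
      · funext i; exact hσ _ (show 2 * i ≠ 2 * n + 1 by omega)
  obtain ⟨G, hsub, hG⟩ := hE.exists_isHenkin
  obtain ⟨B, Q, _, _, _, I, f, g, hI⟩ := hG.exists_model
  have key : ∀ ψ ∈ insert (∼φ) Γ, I.Sat (fun n => f (ρ n)) (fun n => (σ n).eval g) ψ :=
    fun ψ hψ => (I.sat_subst _ _ _ _ _).1 ((hI _).2 (hsub (Set.mem_image_of_mem _ hψ)))
  exact key (∼φ) (Set.mem_insert _ _)
    (h B Q I _ _ fun ψ hψ => key ψ (Set.mem_insert_of_mem _ hψ))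

end Completeness

/-! ## Satisfaction of the abbreviations -/

section Connectives

variable {ε B Q : Type} [Add Q] [Mul Q] [LE Q] (I : Frame ε B Q) (f : ℕ → B) (g : ℕ → Q)

@[simp] theorem scons_zero {α : Type} (a : α) (h : ℕ → α) : scons a h 0 = a := rfl
@[simp] theorem scons_succ {α : Type} (a : α) (h : ℕ → α) (n : ℕ) : scons a h (n + 1) = h n := rfl
@[simp] theorem scons_one {α : Type} (a : α) (h : ℕ → α) : scons a h 1 = h 0 := rfl
@[simp] theorem scons_two {α : Type} (a : α) (h : ℕ → α) : scons a h 2 = h 1 := rfl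
@[simp] theorem scons_add_two {α : Type} (a : α) (h : ℕ → α) (n : ℕ) :
    scons a h (n + 2) = h (n + 1) := rfl
namespace Frame

@[simp] theorem sat_imp (φ ψ : Formula ε) : I.Sat f g (φ ⤇ ψ) ↔ (I.Sat f g φ → I.Sat f g ψ) :=
  Iff.rfl

@[simp] theorem sat_allB (φ : Formula ε) : I.Sat f g φ.allB ↔ ∀ b, I.Sat (scons b f) g φ := Iff.rfl

@[simp] theorem sat_allQ (φ : Formula ε) : I.Sat f g φ.allQ ↔ ∀ q, I.Sat f (scons q g) φ := Iff.rfl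

@[simp] theorem sat_eqQ (s t : QTerm) : I.Sat f g (.eqQ s t) ↔ s.eval g = t.eval g := Iff.rfl

@[simp] theorem sat_le (s t : QTerm) : I.Sat f g (.le s t) ↔ s.eval g ≤ t.eval g := Iff.rfl

@[simp] theorem sat_iob (k : ℕ) : I.Sat f g (.iob k) ↔ I.iob (f k) := Iff.rfl

@[simp] theorem sat_ph (k : ℕ) : I.Sat f g (.ph k) ↔ I.ph (f k) := Iff.rfl

@[simp] theorem sat_ext (R : ε) (k : ℕ) : I.Sat f g (.ext R k) ↔ I.ext R (f k) := Iff.rfl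

@[simp] theorem sat_neg (φ : Formula ε) : I.Sat f g (∼φ) ↔ ¬ I.Sat f g φ := Iff.rfl

@[simp] theorem sat_and (φ ψ : Formula ε) : I.Sat f g (φ ⩓ ψ) ↔ I.Sat f g φ ∧ I.Sat f g ψ := by
  simp [Formula.and]

@[simp] theorem sat_or (φ ψ : Formula ε) : I.Sat f g (φ ⩔ ψ) ↔ I.Sat f g φ ∨ I.Sat f g ψ := by
  simp only [Formula.or, sat_imp, sat_neg]
  tauto

@[simp] theorem sat_iff (φ ψ : Formula ε) : I.Sat f g (φ ⬄ ψ) ↔ (I.Sat f g φ ↔ I.Sat f g ψ) := by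
  simp only [Formula.iff, sat_imp, sat_and]
  tauto

@[simp] theorem sat_exB (φ : Formula ε) : I.Sat f g φ.exB ↔ ∃ b, I.Sat (scons b f) g φ := by
  simp [Formula.exB]

@[simp] theorem sat_exQ (φ : Formula ε) : I.Sat f g φ.exQ ↔ ∃ q, I.Sat f (scons q g) φ := by
  simp [Formula.exQ]

theorem sat_exQs_succ (n : ℕ) (φ : Formula ε) :
    I.Sat f g (.exQs (n + 1) φ) ↔ ∃ q, I.Sat f (scons q g) (.exQs n φ) := by
  simp [Formula.exQs]

end Frame

end Connectives

section Evaluation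

variable {Q : Type} [Add Q] [Mul Q] (g : ℕ → Q)

@[simp] theorem QTerm.eval_var (n : ℕ) : (QTerm.var n).eval g = g n := rfl
@[simp] theorem QTerm.eval_add (s t : QTerm) : (s.add t).eval g = s.eval g + t.eval g := rfl
@[simp] theorem QTerm.eval_mul (s t : QTerm) : (s.mul t).eval g = s.eval g * t.eval g := rfl

end Evaluation

section Blocks

variable {ε B Q : Type} [Add Q] [Mul Q] [LE Q] (I : Frame ε B Q) (f : ℕ → B) (g : ℕ → Q)

namespace Frame

@[simp] theorem sat_moveTo (i m : ℕ) (φ : Formula ε) :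
    I.Sat f g (moveTo i m φ) ↔ I.Sat f (scons (g i) fun n => g (n + m)) φ := by
  rw [moveTo, sat_subst]
  have : (fun n => (scons (.var i) (fun n => .var (n + m)) n : QTerm).eval g)
      = scons (g i) fun n => g (n + m) := by
    funext n; cases n <;> rfl
  rw [this]; rfl

@[simp] theorem sat_exQs_zero (φ : Formula ε) : I.Sat f g (.exQs 0 φ) ↔ I.Sat f g φ := Iff.rfl

end Frame

end Blocks

/-! ## Euclidean fields -/

/-- Ordered fields in which positive elements have square roots. -/
class IsEuclideanField (Q : Type) [Field Q] [LinearOrder Q] : Prop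
    extends IsStrictOrderedRing Q where
  exists_sqrt : ∀ x : Q, 0 < x → ∃ y, y * y = x

/-- The structure offers only `+`, `·` and `≤`. The remaining field data are chosen from the axiom,
while the given operations stay literally the same, so that satisfaction is not affected. -/
theorem exists_isEuclideanField {ε B Q : Type} [iA : Add Q] [iM : Mul Q] [iL : LE Q]
    (I : Frame ε B Q) (f : ℕ → B) (g : ℕ → Q) (h : I.Sat f g AxEField) :
    ∃ (_ : Field Q) (_ : LinearOrder Q) (_ : IsEuclideanField Q),
      iA = Distrib.toAdd ∧ iM = Distrib.toMul ∧ iL = Preorder.toLE := by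
  classical
  simp only [AxEField, Formula.allQs, Frame.sat_and, Frame.sat_or, Frame.sat_imp, Frame.sat_exQ,
    Frame.sat_allQ, Frame.sat_neg, Frame.sat_eqQ, Frame.sat_le, QTerm.eval_add, QTerm.eval_mul,
    QTerm.eval_var, scons_zero, scons_one, scons_two] at h
  obtain ⟨add_assoc, add_comm, mul_assoc, mul_comm, mul_add, le_refl, le_antisymm, le_trans,
    le_total, add_le, z, add_zero, neg, ⟨o, ho, mul_one, inv⟩, mul_nonneg, sqrt⟩ := h
  choose n hn using neg
  choose i hi using inv
  let _ : Zero Q := ⟨z⟩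
  let _ : One Q := ⟨o⟩
  let _ : Neg Q := ⟨n⟩
  let _ : Inv Q := ⟨fun x => if h : x = z then z else i x h⟩
  -- The outermost quantifier of a block binds the highest index, hence the reversed arguments
  -- below.
  let F : Field Q := Field.ofMinimalAxioms Q
    (fun a b c => add_assoc c b a)
    (fun a => (add_comm a z).trans (add_zero a))
    (fun a => (add_comm a _).trans (hn a))
    (fun a b c => mul_assoc c b a)
    (fun a b => mul_comm b a)
    (fun a => (mul_comm a o).trans (mul_one a))
    (fun a ha => by
      show a * (if h : a = z then z else i a h) = o
      rw [dif_neg (show ¬ a = z from ha)]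
      exact hi a ha)
    (dif_pos rfl)
    (fun a b c => mul_add c b a)
    ⟨o, z, ho⟩
  let L : LinearOrder Q :=
    { le := fun a b => a ≤ b
      le_refl := le_refl
      le_trans := fun a b c h h' => le_trans c b a ⟨h, h'⟩
      le_antisymm := fun a b h h' => le_antisymm b a ⟨h, h'⟩
      le_total := fun a b => le_total b a
      toDecidableLE := fun _ _ => Classical.propDecidable _ }
  have hA : IsOrderedAddMonoid Q :=
    { add_le_add_left := fun a b h c => add_le c b a h }
  have hO : ZeroLEOneClass Q := by
    refine ⟨(le_total (1 : Q) 0).resolve_right fun h => ?_⟩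
    have h₁ : (0 : Q) ≤ -1 := neg_nonneg.2 h
    have h₂ : (0 : Q) ≤ -1 * -1 := mul_nonneg _ _ ⟨h₁, h₁⟩
    rw [neg_one_mul, neg_neg] at h₂
    exact ho (_root_.le_antisymm h h₂)
  have hR : IsOrderedRing Q := .of_mul_nonneg fun a b ha hb => mul_nonneg b a ⟨ha, hb⟩
  exact ⟨F, L, { exists_sqrt := fun x hx => sqrt x ⟨hx.le, hx.ne⟩ }, rfl, rfl, rfl⟩

noncomputable section

section Field

variable {Q : Type} [Field Q] [LinearOrder Q] [IsEuclideanField Q]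

theorem exists_nonneg_sqrt {x : Q} (hx : 0 ≤ x) : ∃ y, 0 ≤ y ∧ y * y = x := by
  rcases hx.eq_or_lt with rfl | hx
  · exact ⟨0, le_rfl, mul_zero 0⟩
  · obtain ⟨y, hy⟩ := IsEuclideanField.exists_sqrt x hx
    exact ⟨|y|, abs_nonneg y, by rw [abs_mul_abs_self, hy]⟩

open Classical in
/-- The nonnegative square root, and `0` for negative arguments. -/
def sqrt (x : Q) : Q := if h : 0 ≤ x then (exists_nonneg_sqrt h).choose else 0

theorem sqrt_nonneg (x : Q) : 0 ≤ sqrt x := by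
  unfold sqrt
  split_ifs with h
  exacts [(exists_nonneg_sqrt h).choose_spec.1, le_rfl]

theorem sqrt_mul_self {x : Q} (hx : 0 ≤ x) : sqrt x * sqrt x = x := by
  rw [sqrt, dif_pos hx]
  exact (exists_nonneg_sqrt hx).choose_spec.2

theorem eq_sqrt_iff {x y : Q} (hx : 0 ≤ x) : y = sqrt x ↔ 0 ≤ y ∧ y * y = x := by
  constructor
  · rintro rfl; exact ⟨sqrt_nonneg x, sqrt_mul_self hx⟩
  · rintro ⟨h₁, h₂⟩
    exact (mul_self_inj h₁ (sqrt_nonneg x)).1 (by rw [h₂, sqrt_mul_self hx])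

theorem sqrt_pos {x : Q} (hx : 0 < x) : 0 < sqrt x := by
  refine (sqrt_nonneg x).lt_of_ne fun h => ?_
  have := sqrt_mul_self hx.le
  rw [← h, mul_zero] at this
  exact hx.ne this

theorem sqrt_eq_iff {x y : Q} (hx : 0 ≤ x) (hy : 0 ≤ y) : sqrt x = y ↔ x = y * y := by
  rw [eq_comm, eq_sqrt_iff hx]
  exact ⟨fun h => h.2.symm, fun h => ⟨hy, h.symm⟩⟩

theorem sqrt_lt_iff {x y : Q} (hx : 0 ≤ x) (hy : 0 ≤ y) : sqrt x < y ↔ x < y * y := by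
  conv_rhs => rw [← sqrt_mul_self hx]
  exact (mul_self_lt_mul_self_iff (sqrt_nonneg x) hy)

theorem sqrt_inj {x y : Q} (hx : 0 ≤ x) (hy : 0 ≤ y) : sqrt x = sqrt y ↔ x = y := by
  rw [sqrt_eq_iff hx (sqrt_nonneg y), sqrt_mul_self hy]

end Field

/-! ## Values of terms with defined operations -/

namespace PTerm

variable {Q : Type} [Field Q] [LinearOrder Q] [IsEuclideanField Q]

/-- Total, with default values for division by zero and for roots of negative elements; it is the
intended value only where `Def` holds. -/
def val (g : ℕ → Q) : PTerm → Q
  | var n => g n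
  | zero => 0
  | one => 1
  | add a b => a.val g + b.val g
  | sub a b => a.val g - b.val g
  | mul a b => a.val g * b.val g
  | div a b => a.val g / b.val g
  | sqrt a => Kinematics.sqrt (a.val g)
  | abs a => |a.val g|

/-- The value of the term is defined. -/
def Def (g : ℕ → Q) : PTerm → Prop
  | var _ => True
  | zero => True
  | one => True
  | add a b => a.Def g ∧ b.Def g
  | sub a b => a.Def g ∧ b.Def g
  | mul a b => a.Def g ∧ b.Def g
  | div a b => a.Def g ∧ b.Def g ∧ b.val g ≠ 0
  | sqrt a => a.Def g ∧ 0 ≤ a.val g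
  | abs a => a.Def g

variable (g : ℕ → Q) (a b : PTerm) (n : ℕ)

@[simp] theorem val_var : (var n).val g = g n := rfl
@[simp] theorem val_zero : (0 : PTerm).val g = 0 := rfl
@[simp] theorem val_one : (1 : PTerm).val g = 1 := rfl
@[simp] theorem val_add : (a + b).val g = a.val g + b.val g := rfl
@[simp] theorem val_sub : (a - b).val g = a.val g - b.val g := rfl
@[simp] theorem val_neg : (-a).val g = -a.val g := zero_sub _
@[simp] theorem val_mul : (a * b).val g = a.val g * b.val g := rfl
@[simp] theorem val_div : (a / b).val g = a.val g / b.val g := rfl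
@[simp] theorem val_sqrt : (sqrt a).val g = Kinematics.sqrt (a.val g) := rfl
@[simp] theorem val_abs : (abs a).val g = |a.val g| := rfl

@[simp] theorem def_var : (var n).Def g := trivial
@[simp] theorem def_zero : (0 : PTerm).Def g := trivial
@[simp] theorem def_one : (1 : PTerm).Def g := trivial
@[simp] theorem def_add : (a + b).Def g ↔ a.Def g ∧ b.Def g := Iff.rfl
@[simp] theorem def_sub : (a - b).Def g ↔ a.Def g ∧ b.Def g := Iff.rfl
@[simp] theorem def_neg : (-a).Def g ↔ a.Def g := ⟨And.right, fun h => ⟨trivial, h⟩⟩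
@[simp] theorem def_mul : (a * b).Def g ↔ a.Def g ∧ b.Def g := Iff.rfl
@[simp] theorem def_div : (a / b).Def g ↔ a.Def g ∧ b.Def g ∧ b.val g ≠ 0 := Iff.rfl
@[simp] theorem def_sqrt : (sqrt a).Def g ↔ a.Def g ∧ 0 ≤ a.val g := Iff.rfl
@[simp] theorem def_abs : (abs a).Def g ↔ a.Def g := Iff.rfl

end PTerm

section Terms

variable {ε B Q : Type} [Field Q] [LinearOrder Q] [IsEuclideanField Q]
  (I : Frame ε B Q) (f : ℕ → B) (g : ℕ → Q)

namespace Frame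

@[simp] theorem sat_isZero (t : QTerm) : I.Sat f g (isZero t) ↔ t.eval g = 0 := by
  simp [isZero]

@[simp] theorem sat_isOne (t : QTerm) : I.Sat f g (isOne t) ↔ t.eval g = 1 := by
  simp only [isOne, sat_and, sat_eqQ, QTerm.eval_mul, sat_neg, sat_isZero]
  constructor
  · rintro ⟨h₁, h₂⟩
    exact mul_left_cancel₀ h₂ (by rw [h₁, mul_one])
  · intro h
    simp [h]

@[simp] theorem sat_isNonneg (x : ℕ) : I.Sat f g (isNonneg x) ↔ 0 ≤ g x := by
  simp [isNonneg]

/-- The bridge from the relational reading of partial terms to field arithmetic: from here on only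
`Def` and `val` matter. -/
theorem sat_graph (t : PTerm) :
    ∀ g : ℕ → Q, I.Sat f g t.graph ↔
      t.Def (fun n => g (n + 1)) ∧ g 0 = t.val fun n => g (n + 1) := by
  induction t with
  | var n => intro g; simp [PTerm.graph, PTerm.Def, PTerm.val]
  | zero => intro g; simp [PTerm.graph, PTerm.Def, PTerm.val]
  | one => intro g; simp [PTerm.graph, PTerm.Def, PTerm.val]
  | add a b ha hb =>
    intro g
    simp [sat_exQs_succ, PTerm.graph, PTerm.Def, PTerm.val, ha, hb]
    tauto
  | sub a b ha hb =>
    intro g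
    simp [sat_exQs_succ, PTerm.graph, PTerm.Def, PTerm.val, ha, hb, eq_sub_iff_add_eq]
    tauto
  | mul a b ha hb =>
    intro g
    simp [sat_exQs_succ, PTerm.graph, PTerm.Def, PTerm.val, ha, hb]
    tauto
  | div a b ha hb =>
    intro g
    simp [sat_exQs_succ, PTerm.graph, PTerm.Def, PTerm.val, ha, hb]
    constructor
    · rintro ⟨h₁, h₂, h₃, h₄⟩
      exact ⟨⟨h₁, h₂, h₃⟩, (eq_div_iff h₃).2 h₄⟩
    · rintro ⟨⟨h₁, h₂, h₃⟩, h₄⟩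
      exact ⟨h₁, h₂, h₃, (eq_div_iff h₃).1 h₄⟩
  | sqrt a ha =>
    intro g
    simp [PTerm.graph, PTerm.Def, PTerm.val, ha]
    constructor
    · rintro ⟨⟨h₁, h₂⟩, h₃⟩
      have h₄ := h₂ ▸ mul_self_nonneg (g 0)
      exact ⟨⟨h₁, h₄⟩, (eq_sqrt_iff h₄).2 ⟨h₃, h₂⟩⟩
    · rintro ⟨⟨h₁, h₂⟩, h₃⟩
      obtain ⟨h₄, h₅⟩ := (eq_sqrt_iff h₂).1 h₃
      exact ⟨⟨h₁, h₅⟩, h₄⟩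
  | abs a ha =>
    intro g
    simp [PTerm.graph, PTerm.Def, PTerm.val, ha]
    intro _
    rw [add_eq_zero_iff_eq_neg, eq_comm (b := |_|)]
    constructor
    · rintro ⟨h, h' | h'⟩
      · rw [← h', abs_of_nonneg h]
      · rw [← abs_neg, ← h', abs_of_nonneg h]
    · intro h
      exact ⟨h ▸ abs_nonneg _, h ▸ abs_choice _⟩

@[simp] theorem sat_eqP (s t : PTerm) :
    I.Sat f g (eqP s t) ↔ s.Def g ∧ t.Def g ∧ s.val g = t.val g := by
  simp only [eqP, sat_exQ, sat_and, sat_graph, scons_zero, scons_succ]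
  constructor
  · rintro ⟨q, ⟨h₁, h₂⟩, h₃, h₄⟩
    exact ⟨h₁, h₃, h₂.symm.trans h₄⟩
  · rintro ⟨h₁, h₂, h₃⟩
    exact ⟨_, ⟨h₁, rfl⟩, h₂, h₃⟩

@[simp] theorem sat_ltP (s t : PTerm) :
    I.Sat f g (ltP s t) ↔ s.Def g ∧ t.Def g ∧ s.val g < t.val g := by
  simp only [ltP, sat_exQs_succ, sat_exQs_zero, sat_and, sat_moveTo, sat_graph, scons_zero,
    scons_succ, sat_le, sat_neg, sat_eqQ, QTerm.eval_var]
  constructor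
  · rintro ⟨q, p, ⟨h₁, rfl⟩, ⟨h₂, rfl⟩, h₃, h₄⟩
    exact ⟨h₁, h₂, h₃.lt_of_ne h₄⟩
  · rintro ⟨h₁, h₂, h₃⟩
    exact ⟨_, _, ⟨h₁, rfl⟩, ⟨h₂, rfl⟩, h₃.le, h₃.ne⟩

end Frame
end Terms
end

noncomputable section

/-! ## Blocks of variables -/

/-- Put the point `x` in front of the sequence `g`. -/
def cons4 {Q : Type} (x : Fin 4 → Q) (g : ℕ → Q) : ℕ → Q :=
  scons (x 0) (scons (x 1) (scons (x 2) (scons (x 3) g)))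

/-- The point at position `o` of the sequence `g`. -/
def blk {Q : Type} (g : ℕ → Q) (o : ℕ) : Fin 4 → Q := fun i => g (o + i)

section

variable {Q : Type} (x : Fin 4 → Q) (g : ℕ → Q) (n : ℕ)

@[simp] theorem cons4_add_four : cons4 x g (n + 4) = g n := rfl
@[simp] theorem cons4_add_eight : cons4 x g (n + 8) = g (n + 4) := rfl
@[simp] theorem cons4_add_nine : cons4 x g (n + 9) = g (n + 5) := rfl
@[simp] theorem cons4_add_ten : cons4 x g (n + 10) = g (n + 6) := rfl
@[simp] theorem cons4_add_five : cons4 x g (n + 5) = g (n + 1) := rfl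
@[simp] theorem cons4_add_six : cons4 x g (n + 6) = g (n + 2) := rfl

@[simp] theorem blk_cons4_zero : blk (cons4 x g) 0 = x := by
  funext i; fin_cases i <;> rfl

theorem blk_cons4_add : blk (cons4 x g) (n + 4) = blk g n := by
  funext i; simp only [blk, show n + 4 + (i : ℕ) = n + i + 4 by omega, cons4_add_four]

@[simp] theorem blk_cons4_four : blk (cons4 x g) 4 = blk g 0 := blk_cons4_add x g 0
@[simp] theorem blk_cons4_five : blk (cons4 x g) 5 = blk g 1 := blk_cons4_add x g 1
@[simp] theorem blk_cons4_eight : blk (cons4 x g) 8 = blk g 4 := blk_cons4_add x g 4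
@[simp] theorem blk_cons4_nine : blk (cons4 x g) 9 = blk g 5 := blk_cons4_add x g 5
@[simp] theorem blk_cons4_twelve : blk (cons4 x g) 12 = blk g 8 := blk_cons4_add x g 8

theorem blk_scons_add (q : Q) : blk (scons q g) (n + 1) = blk g n := by
  funext i; simp only [blk, show n + 1 + (i : ℕ) = n + i + 1 by omega, scons_succ]

@[simp] theorem blk_scons_one (q : Q) : blk (scons q g) 1 = blk g 0 := blk_scons_add g 0 q
@[simp] theorem blk_scons_five (q : Q) : blk (scons q g) 5 = blk g 4 := blk_scons_add g 4 q
@[simp] theorem blk_scons_nine (q : Q) : blk (scons q g) 9 = blk g 8 := blk_scons_add g 8 q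

/-- The outermost of four quantifiers binds the last coordinate, so a point collects the four values
in reverse order. -/
theorem forall_cons4 {p : (ℕ → Q) → Prop} : (∀ a b c d, p (scons d (scons c (scons b (scons a g)))))
    ↔ ∀ x, p (cons4 x g) :=
  ⟨fun h _ => h _ _ _ _, fun h a b c d => h ![d, c, b, a]⟩

theorem exists_cons4 {p : (ℕ → Q) → Prop} : (∃ a b c d, p (scons d (scons c (scons b (scons a g)))))
    ↔ ∃ x, p (cons4 x g) :=
  ⟨fun ⟨a, b, c, d, h⟩ => ⟨![d, c, b, a], h⟩, fun ⟨x, h⟩ => ⟨x 3, x 2, x 1, x 0, h⟩⟩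

end

namespace Frame

def SameEv {ε B Q : Type} (I : Frame ε B Q) (k h : B) (x y : Fin 4 → Q) : Prop :=
  ∀ b, I.W k b x ↔ I.W h b y

section

variable {ε B Q : Type} [Add Q] [Mul Q] [LE Q] (I : Frame ε B Q) (f : ℕ → B) (g : ℕ → Q)
  (φ : Formula ε) (n : ℕ)

theorem sat_allQs_add_four :
    I.Sat f g (.allQs (n + 4) φ) ↔ ∀ x, I.Sat f (cons4 x g) (.allQs n φ) :=
  forall_cons4 (p := fun g => I.Sat f g (.allQs n φ)) g

theorem sat_exQs_add_four :
    I.Sat f g (.exQs (n + 4) φ) ↔ ∃ x, I.Sat f (cons4 x g) (.exQs n φ) := by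
  simp only [sat_exQs_succ]
  exact exists_cons4 (p := fun g => I.Sat f g (.exQs n φ)) g

theorem sat_allQs_four : I.Sat f g (.allQs 4 φ) ↔ ∀ x, I.Sat f (cons4 x g) φ :=
  I.sat_allQs_add_four f g φ 0

theorem sat_exQs_four : I.Sat f g (.exQs 4 φ) ↔ ∃ x, I.Sat f (cons4 x g) φ :=
  I.sat_exQs_add_four f g φ 0

theorem sat_allQs_eight :
    I.Sat f g (.allQs 8 φ) ↔ ∀ x y, I.Sat f (cons4 y (cons4 x g)) φ :=
  (I.sat_allQs_add_four f g φ 4).trans (forall_congr' fun _ => I.sat_allQs_four _ _ _)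

theorem sat_exQs_eight :
    I.Sat f g (.exQs 8 φ) ↔ ∃ x y, I.Sat f (cons4 y (cons4 x g)) φ :=
  (I.sat_exQs_add_four f g φ 4).trans (exists_congr fun _ => I.sat_exQs_four _ _ _)

theorem sat_allQs_twelve :
    I.Sat f g (.allQs 12 φ) ↔ ∀ x y z, I.Sat f (cons4 z (cons4 y (cons4 x g))) φ :=
  (I.sat_allQs_add_four f g φ 8).trans (forall_congr' fun _ => I.sat_allQs_eight _ _ _)

theorem sat_allQs_sixteen :
    I.Sat f g (.allQs 16 φ) ↔ ∀ x y z w, I.Sat f (cons4 w (cons4 z (cons4 y (cons4 x g)))) φ :=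
  (I.sat_allQs_add_four f g φ 12).trans (forall_congr' fun _ => I.sat_allQs_twelve _ _ _)

/-- The matrix with rows `r` and the vector `b` in front of the sequence `g`. -/
def _root_.Kinematics.consAffine (r : Fin 4 → Fin 4 → Q) (b : Fin 4 → Q) (g : ℕ → Q) : ℕ → Q :=
  cons4 (r 0) (cons4 (r 1) (cons4 (r 2) (cons4 (r 3) (cons4 b g))))

theorem sat_allQs_twenty :
    I.Sat f g (.allQs 20 φ) ↔ ∀ r b, I.Sat f (consAffine r b g) φ := by
  rw [show (20 : ℕ) = 16 + 4 from rfl, sat_allQs_add_four]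
  simp only [sat_allQs_sixteen]
  exact ⟨fun h r b => h b (r 3) (r 2) (r 1) (r 0), fun h b x y z w => h ![w, z, y, x] b⟩

theorem sat_exQs_twenty :
    I.Sat f g (.exQs 20 φ) ↔ ∃ r b, I.Sat f (consAffine r b g) φ := by
  rw [show (20 : ℕ) = 4 + 4 + 4 + 4 + 4 from rfl]
  simp only [sat_exQs_add_four]
  exact ⟨fun ⟨b, x, y, z, w, h⟩ => ⟨![w, z, y, x], b, h⟩,
    fun ⟨r, b, h⟩ => ⟨b, r 3, r 2, r 1, r 0, h⟩⟩

@[simp] theorem sat_wl (k b x : ℕ) : I.Sat f g (wl k b x) ↔ I.W (f k) (f b) (blk g x) := Iff.rfl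

@[simp] theorem sat_sameEv (k h x y : ℕ) :
    I.Sat f g (sameEv k h x y) ↔ I.SameEv (f k) (f h) (blk g x) (blk g y) := by
  simp [sameEv, SameEv]

@[simp] theorem sat_isOb (k : ℕ) : I.Sat f g (isOb k) ↔ ∃ b x, I.W (f k) b x := by
  simp [isOb, sat_exQs_four]

end

end Frame

/-! ## The defined relations in a structure -/

section

variable {Q : Type} [Field Q] [LinearOrder Q]

/-- Squared spatial distance. -/
def sdist2 (x y : Fin 4 → Q) : Q :=
  (x 1 - y 1) * (x 1 - y 1) + (x 2 - y 2) * (x 2 - y 2) + (x 3 - y 3) * (x 3 - y 3)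

variable [IsEuclideanField Q]

/-- Spatial distance. -/
def sdist (x y : Fin 4 → Q) : Q := sqrt (sdist2 x y)

/-- The affine map with matrix `r` and translation vector `b`. -/
def affineMap (r : Fin 4 → Fin 4 → Q) (b x : Fin 4 → Q) : Fin 4 → Q := fun i =>
  r i 0 * x 0 + r i 1 * x 1 + r i 2 * x 2 + r i 3 * x 3 + b i

theorem add_mul_self_nonneg (a b c : Q) : 0 ≤ a * a + b * b + c * c :=
  add_nonneg (add_nonneg (mul_self_nonneg a) (mul_self_nonneg b)) (mul_self_nonneg c)

end

namespace Frame

variable {ε B Q : Type}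

variable [Field Q] [LinearOrder Q] [IsEuclideanField Q]

def Speed (I : Frame ε B Q) (k b : B) (v : Q) : Prop :=
  (∃ x y, I.W k b x ∧ I.W k b y ∧ x ≠ y) ∧
    ∀ x y, I.W k b x → I.W k b y → sdist x y = v * |x 0 - y 0|

def Velocity (I : Frame ε B Q) (k b : B) (v : Fin 3 → Q) : Prop :=
  (∃ x y, I.W k b x ∧ I.W k b y ∧ x ≠ y) ∧
    ∀ x y, I.W k b x → I.W k b y → y 1 - x 1 = v 0 * (y 0 - x 0) ∧ y 2 - x 2 = v 1 * (y 0 - x 0) ∧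
      y 3 - x 3 = v 2 * (y 0 - x 0)

def LightSpeedIs (I : Frame ε B Q) (k : B) (c : Q) : Prop :=
  ∀ x y, (∃ p, I.ph p ∧ I.W k p x ∧ I.W k p y) ↔ sdist x y = c * |x 0 - y 0|

def Ether (I : Frame ε B Q) (e : B) : Prop := I.iob e ∧ ∃ c, 0 < c ∧ I.LightSpeedIs e c

def EtherLightSpeed (I : Frame ε B Q) (c : Q) : Prop :=
  ∀ e, I.Ether e → ∀ p, I.ph p → I.Speed e p c

def Slower (I : Frame ε B Q) (e k : B) : Prop :=
  ∃ v c, I.Speed e k v ∧ I.EtherLightSpeed c ∧ v < c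

def IsLightSpeed (I : Frame ε B Q) (c : Q) : Prop := 0 < c ∧ ∀ k, I.iob k → I.LightSpeedIs k c

end Frame

namespace Frame

variable {ε B Q : Type} [Field Q] [LinearOrder Q] [IsEuclideanField Q]
  (I : Frame ε B Q) (f : ℕ → B) (g : ℕ → Q)

@[simp] theorem _root_.Kinematics.val_pt (o : ℕ) (i : Fin 4) : (pt o i).val g = blk g o i := rfl
@[simp] theorem _root_.Kinematics.def_pt (o : ℕ) (i : Fin 4) : (pt o i).Def g := trivial

theorem sat_eqPt (x y : Point) : I.Sat f g (eqPt x y) ↔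
    (∀ i, (x i).Def g) ∧ (∀ i, (y i).Def g) ∧ (fun i => (x i).val g) = fun i => (y i).val g := by
  simp only [eqPt, sat_and, sat_eqP, funext_iff, Fin.forall_fin_succ, IsEmpty.forall_iff]
  simp
  tauto

@[simp] theorem sat_eqPt_pt (a b : ℕ) : I.Sat f g (eqPt (pt a) (pt b)) ↔ blk g a = blk g b := by
  simp [sat_eqPt]

@[simp] theorem def_space (x y : Point) : (space x y).Def g ↔
    ((x 1).Def g ∧ (y 1).Def g) ∧ ((x 2).Def g ∧ (y 2).Def g) ∧ ((x 3).Def g ∧ (y 3).Def g) := by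
  simp [space, add_mul_self_nonneg]
  tauto

theorem val_space (x y : Point) :
    (space x y).val g = sdist (fun i => (x i).val g) (fun i => (y i).val g) := rfl

@[simp] theorem val_space_pt (a b : ℕ) :
    (space (pt a) (pt b)).val g = sdist (blk g a) (blk g b) := rfl

@[simp] theorem def_time (x y : Point) :
    (time x y).Def g ↔ (x 0).Def g ∧ (y 0).Def g := Iff.rfl

@[simp] theorem val_time (x y : Point) : (time x y).val g = |(x 0).val g - (y 0).val g| := rfl

@[simp] theorem sat_speedIs (k b v : ℕ) :
    I.Sat f g (speedIs k b v) ↔ I.Speed (f k) (f b) (g v) := by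
  simp [speedIs, Speed, sat_exQs_eight, sat_allQs_eight]

theorem sat_velocityIs (k b v : ℕ) : I.Sat f g (velocityIs k b v) ↔
    I.Velocity (f k) (f b) (fun i => g (v + i)) := by
  simp [velocityIs, Velocity, sat_exQs_eight, sat_allQs_eight]

@[simp] theorem sat_lightSpeedIs (k c : ℕ) :
    I.Sat f g (lightSpeedIs k c) ↔ I.LightSpeedIs (f k) (g c) := by
  simp [lightSpeedIs, LightSpeedIs, sat_allQs_eight]

@[simp] theorem sat_ether (e : ℕ) : I.Sat f g (ether e) ↔ I.Ether (f e) := by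
  simp [ether, Ether]

@[simp] theorem sat_isEtherLightSpeed (c : ℕ) :
    I.Sat f g (isEtherLightSpeed c) ↔ I.EtherLightSpeed (g c) := by
  simp [isEtherLightSpeed, EtherLightSpeed]

@[simp] theorem sat_slowerThanLight (e k : ℕ) :
    I.Sat f g (slowerThanLight e k) ↔ I.Slower (f e) (f k) := by
  simp only [slowerThanLight, sat_exQs_succ, sat_exQs_zero, sat_and, sat_speedIs,
    sat_isEtherLightSpeed, sat_ltP, PTerm.def_var, PTerm.val_var, scons_zero, scons_one, Slower,
    true_and]
  exact exists_comm

@[simp] theorem sat_isLightSpeed (c : ℕ) : I.Sat f g (isLightSpeed c) ↔ I.IsLightSpeed (g c) := by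
  simp [isLightSpeed, IsLightSpeed]

/-! ## The axioms in a structure -/

theorem sat_AxEv : I.Sat f g AxEv ↔
    ∀ k h, I.iob k → I.iob h → ∀ x, ∃ y, I.SameEv k h x y := by
  simp [AxEv, sat_exQs_four, sat_allQs_four]

theorem sat_AxSelf : I.Sat f g AxSelf ↔
    ∀ k, I.iob k → ∀ x, I.W k k x ↔ x 1 = 0 ∧ x 2 = 0 ∧ x 3 = 0 := by
  simp [AxSelf, sat_allQs_four]

theorem sat_AxSymD : I.Sat f g AxSymD ↔ ∀ k h, I.iob k → I.iob h → ∀ x y x' y',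
    x 0 = y 0 → x' 0 = y' 0 → I.SameEv k h x x' → I.SameEv k h y y' → sdist x y = sdist x' y' := by
  simp [AxSymD, sat_allQs_sixteen, sub_eq_zero]

theorem sat_AxLine : I.Sat f g AxLine ↔ ∀ k h, I.iob k → I.iob h → ∀ x y z,
    I.W k h x → I.W k h y → I.W k h z →
      ∃ a : Q, (∀ i, z i - x i = a * (y i - x i)) ∨ ∀ i, y i - z i = a * (z i - x i) := by
  simp [AxLine, sat_allQs_twelve, sat_eqPt, funext_iff]

theorem sat_AxNoAcc : I.Sat f g AxNoAcc ↔ ∀ k b x, I.W k b x → I.iob k := by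
  simp [AxNoAcc]

theorem sat_AxAbsTime : I.Sat f g AxAbsTime ↔ ∀ k h, I.iob k → I.iob h → ∀ x y x' y',
    I.SameEv k h x x' → I.SameEv k h y y' → |x 0 - y 0| = |x' 0 - y' 0| := by
  simp [AxAbsTime, sat_allQs_sixteen]

theorem sat_AxEther : I.Sat f g AxEther ↔ ∃ e, I.Ether e := by
  simp [AxEther]

theorem sat_AxNoFTL : I.Sat f g AxNoFTL ↔ ∀ k, I.iob k → ∀ e, I.Ether e → I.Slower e k := by
  simp [AxNoFTL]

theorem sat_AxThExpSTL : I.Sat f g AxThExpSTL ↔ (∃ k, I.iob k) ∧ ∀ e, I.Ether e → ∀ x y,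
    (∃ c, I.EtherLightSpeed c ∧ sdist x y < c * |x 0 - y 0|) →
      ∃ k, I.iob k ∧ I.W e k x ∧ I.W e k y := by
  simp [AxThExpSTL, sat_allQs_eight]

theorem sat_AxPhc : I.Sat f g AxPhc ↔ ∃ c, I.IsLightSpeed c := by
  simp [AxPhc]

theorem sat_AxThExp : I.Sat f g AxThExp ↔ (∃ k, I.iob k) ∧ ∀ e, I.iob e → ∀ x y,
    (∃ c, I.IsLightSpeed c ∧ sdist x y < c * |x 0 - y 0|) →
      ∃ k, I.iob k ∧ I.W e k x ∧ I.W e k y := by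
  simp [AxThExp, sat_allQs_eight]

end Frame
end

noncomputable section

/-! ## Trivial transformations in a structure -/

section

variable {Q : Type} [Field Q] [LinearOrder Q] [IsEuclideanField Q]

def IsTriv (r : Fin 4 → Fin 4 → Q) (b : Fin 4 → Q) : Prop := ∀ x y,
  affineMap r b x 0 - affineMap r b y 0 = x 0 - y 0 ∧
    sdist (affineMap r b x) (affineMap r b y) = sdist x y

def IsTrivUpToReversal (r : Fin 4 → Fin 4 → Q) (b : Fin 4 → Q) : Prop := ∀ x y,
  |affineMap r b x 0 - affineMap r b y 0| = |x 0 - y 0| ∧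
    sdist (affineMap r b x) (affineMap r b y) = sdist x y

variable (g : ℕ → Q) (r : Fin 4 → Fin 4 → Q) (b x y : Fin 4 → Q) (i : Fin 4)

@[simp] theorem def_affine (m o : ℕ) : (affine m (pt o) i).Def g := by simp [affine]

@[simp] theorem val_affine_four :
    (affine 8 (pt 4) i).val (cons4 y (cons4 x (consAffine r b g))) = affineMap r b x i := by
  fin_cases i <;> rfl

@[simp] theorem val_affine_zero :
    (affine 8 (pt 0) i).val (cons4 y (cons4 x (consAffine r b g))) = affineMap r b y i := by
  fin_cases i <;> rfl

namespace Frame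

variable {ε B : Type} (I : Frame ε B Q) (f : ℕ → B)

theorem sat_isTriv : I.Sat f (consAffine r b g) (isTriv 0) ↔ IsTriv r b := by
  simp [isTriv, IsTriv, sat_allQs_eight, val_space]

theorem sat_isTrivUpToReversal :
    I.Sat f (consAffine r b g) (isTrivUpToReversal 0) ↔ IsTrivUpToReversal r b := by
  simp [isTrivUpToReversal, IsTrivUpToReversal, sat_allQs_eight, val_space]

theorem sat_worldviewIs (k h : ℕ) : I.Sat f (consAffine r b g) (worldviewIs k h 0) ↔
    ∀ x y, I.SameEv (f k) (f h) x y ↔ affineMap r b x = y := by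
  simp [worldviewIs, sat_allQs_eight, sat_eqPt]

theorem sat_AxTriv : I.Sat f g AxTriv ↔ ∀ r b, IsTriv r b → ∀ k, I.iob k → ∃ k', I.iob k' ∧
    ∀ x y, I.SameEv k k' x y ↔ affineMap r b x = y := by
  simp [AxTriv, sat_allQs_twenty, sat_isTriv, sat_worldviewIs]

theorem sat_AxPrimitiveEther (I : Frame EtherSymbol B Q) :
    I.Sat f g AxPrimitiveEther ↔ ∃ e, I.iob e ∧ ∀ k,
      (I.iob k ∧ ∃ r b, IsTrivUpToReversal r b ∧ ∀ x y, I.SameEv e k x y ↔ affineMap r b x = y) ↔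
        I.ext .E k := by
  simp [AxPrimitiveEther, sat_exQs_twenty, sat_isTrivUpToReversal, sat_worldviewIs]

end Frame

end

/-! ## Radarization in a structure -/

section

variable {Q : Type} [Field Q] [LinearOrder Q] [IsEuclideanField Q]

/-- The inner product of `v` with the spatial part of `x`. -/
def sprod (v : Fin 3 → Q) (x : Fin 4 → Q) : Q := v 0 * x 1 + v 1 * x 2 + v 2 * x 3

/-- Squared length of a velocity. -/
def norm2 (v : Fin 3 → Q) : Q := v 0 * v 0 + v 1 * v 1 + v 2 * v 2

theorem norm2_nonneg (v : Fin 3 → Q) : 0 ≤ norm2 v := add_mul_self_nonneg _ _ _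

/-- The linear map with matrix `r` is a spatial isometry taking `v` to `(-n, 0, 0)`. -/
structure IsRotation (v : Fin 3 → Q) (n : Q) (r : Fin 4 → Fin 4 → Q) : Prop where
  time : ∀ x, affineMap r 0 x 0 = x 0
  isom : ∀ x, affineMap r 0 x 1 * affineMap r 0 x 1 + affineMap r 0 x 2 * affineMap r 0 x 2 +
    affineMap r 0 x 3 * affineMap r 0 x 3 = x 1 * x 1 + x 2 * x 2 + x 3 * x 3
  axis : affineMap r 0 ![0, v 0, v 1, v 2] = ![0, -n, 0, 0]
  -- This is the polarization of `isom` at the vector of `axis`; each of the three rotations gives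
  -- it directly.
  first : ∀ x, n * affineMap r 0 x 1 = -sprod v x

theorem ext_four {α : Type} {x y : Fin 4 → α} (h₀ : x 0 = y 0) (h₁ : x 1 = y 1) (h₂ : x 2 = y 2)
    (h₃ : x 3 = y 3) : x = y := by
  funext i; fin_cases i
  exacts [h₀, h₁, h₂, h₃]

theorem forall_four {p : Fin 4 → Prop} (h₀ : p 0) (h₁ : p 1) (h₂ : p 2) (h₃ : p 3) : ∀ i, p i := by
  intro i; fin_cases i
  exacts [h₀, h₁, h₂, h₃]

theorem affineMap_zero_add_smul (r : Fin 4 → Fin 4 → Q) (x y : Fin 4 → Q) (t : Q) :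
    affineMap r 0 (x + t • y) = affineMap r 0 x + t • affineMap r 0 y := by
  funext i
  simp only [affineMap, Pi.add_apply, Pi.smul_apply, Pi.zero_apply, smul_eq_mul]
  ring

theorem eq_zero_of_add_mul_self {a b c : Q} (h : a * a + b * b + c * c = 0) :
    a = 0 ∧ b = 0 ∧ c = 0 := by
  have ha := mul_self_nonneg a
  have hb := mul_self_nonneg b
  have hc := mul_self_nonneg c
  exact ⟨mul_self_eq_zero.1 (by linarith), mul_self_eq_zero.1 (by linarith),
    mul_self_eq_zero.1 (by linarith)⟩

theorem IsRotation.injective {v : Fin 3 → Q} {n : Q} {r : Fin 4 → Fin 4 → Q}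
    (h : IsRotation v n r) {x y : Fin 4 → Q} (hxy : affineMap r 0 x = affineMap r 0 y) : x = y := by
  have h₀ : affineMap r 0 (x + (-1 : Q) • y) = 0 := by
    rw [affineMap_zero_add_smul, hxy]; simp
  have h₁ := h.isom (x + (-1 : Q) • y)
  have h₂ := h.time (x + (-1 : Q) • y)
  simp only [h₀, Pi.zero_apply, mul_zero, add_zero] at h₁ h₂
  obtain ⟨e₁, e₂, e₃⟩ := eq_zero_of_add_mul_self h₁.symm
  simp only [Pi.add_apply, Pi.smul_apply, smul_eq_mul] at h₂ e₁ e₂ e₃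
  apply ext_four
  · linear_combination -h₂
  · linear_combination e₁
  · linear_combination e₂
  · linear_combination e₃

theorem IsRotation.map_time {v : Fin 3 → Q} {n : Q} {r : Fin 4 → Fin 4 → Q}
    (h : IsRotation v n r) : affineMap r 0 ![1, 0, 0, 0] = ![1, 0, 0, 0] := by
  have h₁ := h.isom ![1, 0, 0, 0]
  have h₂ := h.time ![1, 0, 0, 0]
  have h₃ : affineMap r 0 ![1, 0, 0, 0] 1 * affineMap r 0 ![1, 0, 0, 0] 1 +
      affineMap r 0 ![1, 0, 0, 0] 2 * affineMap r 0 ![1, 0, 0, 0] 2 +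
      affineMap r 0 ![1, 0, 0, 0] 3 * affineMap r 0 ![1, 0, 0, 0] 3 = 0 := by
    rw [h₁]; simp
  obtain ⟨e₁, e₂, e₃⟩ := eq_zero_of_add_mul_self h₃
  exact ext_four h₂ e₁ e₂ e₃

/-- The map `S_s ∘ E_s ∘ G_s`. -/
def core (c s : Q) (a : Fin 4 → Q) : Fin 4 → Q :=
  ![sqrt (1 - s * s / (c * c)) * a 0 - s / (c * c) / sqrt (1 - s * s / (c * c)) * a 1,
    a 1 / sqrt (1 - s * s / (c * c)), a 2, a 3]

/-- Radarization, free of coordinates. -/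
def radMap (c : Q) (v : Fin 3 → Q) (x : Fin 4 → Q) : Fin 4 → Q :=
  -- Space is stretched by `1/k` along `v`. The coefficient `(1/k - 1)/|v|²` is written as `1/(c²k(1
  -- + k))`, using `|v|² = (1 - k²)c²`, and so makes sense for `v = 0` too.
  let k := sqrt (1 - norm2 v / (c * c))
  ![k * x 0 + sprod v x / (c * c) / k, x 1 + sprod v x / (c * c * k * (1 + k)) * v 0,
    x 2 + sprod v x / (c * c * k * (1 + k)) * v 1, x 3 + sprod v x / (c * c * k * (1 + k)) * v 2]

theorem radMap_factor_pos {c m : Q} (hc : 0 < c) (hm : m < c * c) : 0 < 1 - m / (c * c) := by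
  rw [sub_pos, div_lt_one (mul_pos hc hc)]
  exact hm

/-- Conjugating the core map by a rotation that takes `v` to the negative first axis gives the same
map for every such rotation. In fact `radMap c v x` is `x` plus a multiple of `v` plus a multiple of
the time unit, and the rotation is known on both vectors. -/
theorem IsRotation.core_eq_iff {v : Fin 3 → Q} {n c : Q} {r : Fin 4 → Fin 4 → Q}
    (h : IsRotation v n r) (hn : n * n = norm2 v) (hc : 0 < c) (hv : norm2 v < c * c)
    (x y : Fin 4 → Q) : core c n (affineMap r 0 x) = affineMap r 0 y ↔ radMap c v x = y := by
  have key : core c n (affineMap r 0 x) = affineMap r 0 (radMap c v x) := by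
    have hk₀ := radMap_factor_pos hc hv
    have hk := sqrt_pos hk₀
    have hkk := sqrt_mul_self hk₀.le
    have hx : radMap c v x = (x + (sprod v x / (c * c * sqrt (1 - norm2 v / (c * c)) *
        (1 + sqrt (1 - norm2 v / (c * c))))) • ![0, v 0, v 1, v 2]) +
          (sqrt (1 - norm2 v / (c * c)) * x 0 +
            sprod v x / (c * c) / sqrt (1 - norm2 v / (c * c)) - x 0) • ![1, 0, 0, 0] := by
      apply ext_four <;>
        simp only [radMap, Pi.add_apply, Pi.smul_apply, smul_eq_mul, Matrix.cons_val] <;> ring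
    rw [hx, affineMap_zero_add_smul, affineMap_zero_add_smul, h.axis, h.map_time]
    have h₀ := h.time x
    have h₁ := h.first x
    have hp : sprod v x = -(n * affineMap r 0 x 1) := by rw [h₁, neg_neg]
    unfold core
    rw [hn]
    set k := sqrt (1 - norm2 v / (c * c)) with hkdef
    have hm : n * n = (1 - k * k) * (c * c) := by
      rw [hkk, hn]; field_simp; ring
    have hk' : (1 + k) ≠ 0 := by positivity
    rw [hp]
    apply ext_four <;>
      simp only [Pi.add_apply, Pi.smul_apply, smul_eq_mul, Matrix.cons_val, h₀]
    · field_simp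
      ring
    · field_simp
      linear_combination -affineMap r 0 x 1 * hm
    · ring
    · ring
  rw [key]
  exact ⟨h.injective, fun h => by rw [h]⟩

theorem norm2_eq_zero {v : Fin 3 → Q} (h : norm2 v = 0) : v 0 = 0 ∧ v 1 = 0 ∧ v 2 = 0 :=
  eq_zero_of_add_mul_self h

theorem isRotation_one {v : Fin 3 → Q} {n : Q} (h₀ : v 0 = -n) (h₁ : v 1 = 0) (h₂ : v 2 = 0) :
    IsRotation v n (1 : Matrix (Fin 4) (Fin 4) Q) := by
  have key : ∀ x : Fin 4 → Q, affineMap (1 : Matrix (Fin 4) (Fin 4) Q) 0 x = x := by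
    intro x
    apply ext_four <;> simp [affineMap]
  refine ⟨fun x => by rw [key], fun x => by rw [key], ?_, fun x => ?_⟩
  · rw [key, h₀, h₁, h₂]
  · rw [key, sprod, h₀, h₁, h₂]; ring

/-- The inversion of space. -/
def spaceInversion : Fin 4 → Fin 4 → Q :=
  !![1, 0, 0, 0; 0, -1, 0, 0; 0, 0, -1, 0; 0, 0, 0, -1]

theorem affineMap_spaceInversion (x : Fin 4 → Q) :
    affineMap spaceInversion 0 x = ![x 0, -x 1, -x 2, -x 3] := by
  apply ext_four <;> simp [affineMap, spaceInversion]

theorem isRotation_spaceInversion {v : Fin 3 → Q} {n : Q} (h₀ : v 0 = n) (h₁ : v 1 = 0)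
    (h₂ : v 2 = 0) : IsRotation v n spaceInversion := by
  refine ⟨fun x => ?_, fun x => ?_, ?_, fun x => ?_⟩
  · rw [affineMap_spaceInversion]; rfl
  · rw [affineMap_spaceInversion]
    simp only [Matrix.cons_val]
    ring
  · rw [affineMap_spaceInversion, h₀, h₁, h₂]
    simp
  · rw [affineMap_spaceInversion, sprod, h₀, h₁, h₂]
    simp only [Matrix.cons_val]
    ring

/-- The matrix of the rotation for a velocity `v` of length `n` off the first axis. -/
def generalRotation (v : Fin 3 → Q) (n : Q) : Fin 4 → Fin 4 → Q :=
  !![1, 0, 0, 0;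
     0, (-v 0) / n, (-v 1) / n, (-v 2) / n;
     0, v 1 / n, (-v 0 - v 2 * v 2 * ((n - v 0) / (v 1 * v 1 + v 2 * v 2))) / n,
        (v 1 * v 2 * ((n - v 0) / (v 1 * v 1 + v 2 * v 2))) / n;
     0, v 2 / n, (v 1 * v 2 * ((n - v 0) / (v 1 * v 1 + v 2 * v 2))) / n,
        (-v 0 - v 1 * v 1 * ((n - v 0) / (v 1 * v 1 + v 2 * v 2))) / n]

/-- Orthogonality of the matrix comes down to two relations for `d`: `d(v_y² + v_z²) = n - v_x` by
definition, and then `d(n + v_x) = 1`, because `n² - v_x² = v_y² + v_z²`. -/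
theorem isRotation_generalRotation {v : Fin 3 → Q} {n : Q} (hn : n * n = norm2 v)
    (hv : ¬ (v 1 = 0 ∧ v 2 = 0)) : IsRotation v n (generalRotation v n) := by
  have hw : 0 < v 1 * v 1 + v 2 * v 2 := by
    refine lt_of_le_of_ne (add_nonneg (mul_self_nonneg _) (mul_self_nonneg _)) fun h => hv ?_
    have := eq_zero_of_add_mul_self (a := 0) (b := v 1) (c := v 2) (by linear_combination -h)
    exact this.2
  unfold norm2 at hn
  have hn₀ : n ≠ 0 := by
    rintro rfl
    nlinarith [mul_self_nonneg (v 0)]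
  have hnv : n - v 0 ≠ 0 := fun h => by
    rw [sub_eq_zero] at h
    rw [h] at hn
    linarith
  set d := (n - v 0) / (v 1 * v 1 + v 2 * v 2) with hd
  have e₁ : d * (v 1 * v 1 + v 2 * v 2) = n - v 0 := div_mul_cancel₀ _ hw.ne'
  have e₂ : d * (n + v 0) = 1 := by
    refine mul_right_cancel₀ hnv ?_
    linear_combination e₁ + d * hn
  have c₀ : ∀ x, affineMap (generalRotation v n) 0 x 0 = x 0 := fun x => by
    simp [affineMap, generalRotation]
  have c₁ : ∀ x, n * affineMap (generalRotation v n) 0 x 1 =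
      -(v 0 * x 1 + v 1 * x 2 + v 2 * x 3) := fun x => by
    simp only [affineMap, generalRotation, Matrix.of_apply, Matrix.cons_val, Pi.zero_apply]
    field_simp
    ring
  have c₂ : ∀ x, n * affineMap (generalRotation v n) 0 x 2 =
      v 1 * x 1 + (-v 0 - v 2 * v 2 * d) * x 2 + v 1 * v 2 * d * x 3 := fun x => by
    simp only [affineMap, generalRotation, Matrix.of_apply, Matrix.cons_val, Pi.zero_apply, ← hd]
    field_simp
    ring
  have c₃ : ∀ x, n * affineMap (generalRotation v n) 0 x 3 =
      v 2 * x 1 + v 1 * v 2 * d * x 2 + (-v 0 - v 1 * v 1 * d) * x 3 := fun x => by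
    simp only [affineMap, generalRotation, Matrix.of_apply, Matrix.cons_val, Pi.zero_apply, ← hd]
    field_simp
    ring
  refine ⟨c₀, fun x => ?_, ?_, c₁⟩
  · refine mul_left_cancel₀ (mul_ne_zero hn₀ hn₀) ?_
    set a := affineMap (generalRotation v n) 0 x
    have : n * n * (a 1 * a 1 + a 2 * a 2 + a 3 * a 3) =
        (n * a 1) * (n * a 1) + (n * a 2) * (n * a 2) + (n * a 3) * (n * a 3) := by ring
    rw [this, c₁, c₂, c₃]
    -- The two relations combine to `d²(v_y² + v_z²) + 2 d v_x = 1`, which is what the coefficient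
    -- of `(v_z y - v_y z)²` needs.
    linear_combination (v 2 * x 2 - v 1 * x 3) ^ 2 * (d * e₁ + e₂) -
      (x 1 * x 1 + x 2 * x 2 + x 3 * x 3) * hn
  · apply ext_four
    · rw [c₀]; rfl
    · refine mul_left_cancel₀ hn₀ ?_
      rw [c₁]
      simp only [Matrix.cons_val]
      linear_combination hn
    · refine mul_left_cancel₀ hn₀ ?_
      rw [c₂]
      simp only [Matrix.cons_val]
      ring
    · refine mul_left_cancel₀ hn₀ ?_
      rw [c₃]
      simp only [Matrix.cons_val]
      ring

end

namespace Frame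

variable {ε B Q : Type} [Field Q] [LinearOrder Q] [IsEuclideanField Q]
  (I : Frame ε B Q) (f : ℕ → B) (g : ℕ → Q)

theorem def_vecNorm (v : ℕ) : (vecNorm v).Def g := by
  simp [vecNorm, add_mul_self_nonneg]

theorem val_vecNorm (v : ℕ) : (vecNorm v).val g = sqrt (norm2 fun i => g (v + i)) := by
  simp [vecNorm, norm2]

/-- The matrix is chosen from `w` alone, so that one `r` serves both occurrences of `rotationIs` in
`radIs`. The three clauses of that formula exclude each other and match the general rotation, the
identity and the inversion. -/
theorem exists_isRotation (w : Fin 3 → Q) : ∃ r, IsRotation w (sqrt (norm2 w)) r ∧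
    ∀ (g : ℕ → Q) (v : ℕ), (fun i : Fin 3 => g (v + i)) = w → ∀ o p : ℕ,
      I.Sat f g (rotationIs v (pt o) (pt p)) ↔ affineMap r 0 (blk g o) = blk g p := by
  have hn := sqrt_mul_self (norm2_nonneg w)
  by_cases h : w 1 = 0 ∧ w 2 = 0
  · have hnw : norm2 w = w 0 * w 0 := by rw [norm2, h.1, h.2]; ring
    by_cases hpos : 0 < w 0
    · refine ⟨spaceInversion, isRotation_spaceInversion ?_ h.1 h.2, fun g v hw o p => ?_⟩
      · exact ((sqrt_eq_iff (norm2_nonneg w) hpos.le).2 hnw).symm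
      · have h₀ : g v = w 0 := congrFun hw 0
        have h₁ : g (v + 1) = w 1 := congrFun hw 1
        have h₂ : g (v + 2) = w 2 := congrFun hw 2
        rw [affineMap_spaceInversion]
        simp [rotationIs, sat_eqPt, h₀, h₁, h₂, h, hpos]
        have hD : ∀ i, PTerm.Def g (![pt o 0, -pt o 1, -pt o 2, -pt o 3] i) := by
          apply forall_four <;> simp
        have hV : (fun i => PTerm.val g (![pt o 0, -pt o 1, -pt o 2, -pt o 3] i)) =
            ![blk g o 0, -blk g o 1, -blk g o 2, -blk g o 3] := by
          apply ext_four <;> simp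
        rw [hV]
        exact and_iff_right hD
    · refine ⟨(1 : Matrix (Fin 4) (Fin 4) Q), isRotation_one ?_ h.1 h.2, fun g v hw o p => ?_⟩
      · rw [(sqrt_eq_iff (norm2_nonneg w) (neg_nonneg.2 (not_lt.1 hpos))).2 (by rw [hnw]; ring),
          neg_neg]
      · have h₀ : g v = w 0 := congrFun hw 0
        have h₁ : g (v + 1) = w 1 := congrFun hw 1
        have h₂ : g (v + 2) = w 2 := congrFun hw 2
        simp [rotationIs, sat_eqPt, h₀, h₁, h₂, h, hpos]
        have : affineMap (1 : Matrix (Fin 4) (Fin 4) Q) 0 (blk g o) = blk g o := by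
          apply ext_four <;> simp [affineMap]
        rw [this]
  · refine ⟨generalRotation w _, isRotation_generalRotation hn h, fun g v hw o p => ?_⟩
    have h₀ : g v = w 0 := congrFun hw 0
    have h₁ : g (v + 1) = w 1 := congrFun hw 1
    have h₂ : g (v + 2) = w 2 := congrFun hw 2
    simp [rotationIs, sat_eqPt, h₀, h₁, h₂, h]
    have hw' : w 1 * w 1 + w 2 * w 2 ≠ 0 := fun h' => h (eq_zero_of_add_mul_self (a := 0) (by
      linear_combination h')).2
    have hn' : sqrt (norm2 w) ≠ 0 := fun h' => h (norm2_eq_zero (by rw [← hn, h', mul_zero])).2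
    have hD : ∀ i, PTerm.Def g (applyMatrix (rotationMatrix v) (pt o) i) := by
      apply forall_four <;>
        simp [applyMatrix, rotationMatrix, def_vecNorm, val_vecNorm, h₁, h₂, hw', hw, hn']
    have hV : (fun i => PTerm.val g (applyMatrix (rotationMatrix v) (pt o) i)) =
        affineMap (generalRotation w (sqrt (norm2 w))) 0 (blk g o) := by
      apply ext_four <;>
        simp [applyMatrix, rotationMatrix, val_vecNorm, affineMap, generalRotation, h₀, h₁,
          h₂, hw]
    rw [hV]
    exact and_iff_right hD

theorem sat_core {c s : PTerm} {o p : ℕ} (hc : c.Def g) (hs : s.Def g) (hc₀ : 0 < c.val g)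
    (hcs : s.val g * s.val g < c.val g * c.val g) :
    I.Sat f g (eqPt (coreMap c s (pt o)) (pt p)) ↔
      core (c.val g) (s.val g) (blk g o) = blk g p := by
  have hk₀ := radMap_factor_pos hc₀ hcs
  have hk := sqrt_pos hk₀
  have hkk := sqrt_mul_self hk₀.le
  have hD : ∀ i, PTerm.Def g (coreMap c s (pt o) i) := by
    apply forall_four <;>
      simp [coreMap, applyMatrix, galileanBoost, synchronisation, scaleFactor, hc, hs, hc₀.ne',
        hk₀.le, hk.ne', hk₀.ne']
  have hV : (fun i => PTerm.val g (coreMap c s (pt o) i)) =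
      core (c.val g) (s.val g) (blk g o) := by
    -- Expressing `s²` through the root `k` as `(1 - k²)c²` allows `k` to be treated as an
    -- independent variable below.
    have hq : s.val g * s.val g = (1 - sqrt (1 - s.val g * s.val g / (c.val g * c.val g)) *
        sqrt (1 - s.val g * s.val g / (c.val g * c.val g))) * (c.val g * c.val g) := by
      rw [hkk]; field_simp; ring
    apply ext_four <;>
      simp only [coreMap, applyMatrix, galileanBoost, synchronisation, scaleFactor, core,
        PTerm.val_mul, PTerm.val_add, PTerm.val_div, PTerm.val_one, PTerm.val_zero, PTerm.val_neg,
        PTerm.val_sub, PTerm.val_sqrt, Matrix.of_apply, Matrix.cons_val, val_pt]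
    all_goals
      generalize sqrt (1 - s.val g * s.val g / (c.val g * c.val g)) = k at *
      generalize s.val g = S at *
      generalize c.val g = C at *
      try simp only [← hkk]
      field_simp
    · linear_combination -blk g o 0 * hq
    · ring
    · ring
    · ring
  rw [sat_eqPt, hV]
  simp [hD]

/-- The formula reaches `R_v(y)` from `R_v(x)` by the core map; eliminating these two auxiliary
points leaves the coordinate-free map. The shift by `9` accounts for `c` and the two points. -/
theorem sat_radIs (v x y : ℕ) : I.Sat f g (radIs v x y) ↔ ∃ c, I.EtherLightSpeed c ∧
    sqrt (norm2 fun i => g (v + i)) < c ∧ radMap c (fun i => g (v + i)) (blk g x) = blk g y := by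
  set w : Fin 3 → Q := fun i => g (v + i) with hw
  simp only [radIs, sat_exQ, sat_and, sat_isEtherLightSpeed, sat_ltP, sat_exQs_eight,
    PTerm.def_var, def_vecNorm, val_vecNorm, PTerm.val_var, scons_zero, true_and]
  refine exists_congr fun c => and_congr_right fun _ => ?_
  have e₀ : (fun i : Fin 3 => scons c g (v + 1 + i)) = w := by
    funext i
    rw [show v + 1 + (i : ℕ) = v + i + 1 by omega]; rfl
  rw [e₀]
  refine and_congr_right fun hc => ?_
  have hc₀ : 0 < c := (sqrt_nonneg _).trans_lt hc
  have hwc : norm2 w < c * c := (sqrt_lt_iff (norm2_nonneg w) hc₀.le).1 hc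
  have hn := sqrt_mul_self (norm2_nonneg w)
  have e : ∀ a b : Fin 4 → Q,
      (fun i : Fin 3 => cons4 b (cons4 a (scons c g)) (v + 9 + i)) = w := by
    intro a b
    funext i
    rw [show v + 9 + (i : ℕ) = v + i + 9 by omega]; rfl
  have eb : ∀ (a b : Fin 4 → Q) (o : ℕ), blk (cons4 b (cons4 a (scons c g))) (o + 9) = blk g o :=
    fun a b o => by
      rw [show o + 9 = o + 1 + 4 + 4 by omega, blk_cons4_add, blk_cons4_add, blk_scons_add]
  obtain ⟨r, hr, hsat⟩ := exists_isRotation I f w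
  have key : ∀ a b : Fin 4 → Q,
      (I.Sat f (cons4 b (cons4 a (scons c g))) (rotationIs (v + 9) (pt (x + 9)) (pt 4)) ∧
        I.Sat f (cons4 b (cons4 a (scons c g)))
          (eqPt (coreMap (.var 8) (vecNorm (v + 9)) (pt 4)) (pt 0)) ∧
        I.Sat f (cons4 b (cons4 a (scons c g))) (rotationIs (v + 9) (pt (y + 9)) (pt 0))) ↔
      affineMap r 0 (blk g x) = a ∧ core c (sqrt (norm2 w)) a = b ∧
        affineMap r 0 (blk g y) = b := by
    intro a b
    have hv8 : (PTerm.var 8).val (cons4 b (cons4 a (scons c g))) = c := rfl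
    rw [hsat _ _ (e a b), hsat _ _ (e a b), eb, eb, sat_core _ _ _ (PTerm.def_var _ _) (def_vecNorm _ _),
      hv8, val_vecNorm, e, blk_cons4_zero, blk_cons4_four, blk_cons4_zero]
    · exact hc₀
    · rw [val_vecNorm, e, hn]; exact hwc
  simp only [key]
  rw [← hr.core_eq_iff hn hc₀ hwc]
  constructor
  · rintro ⟨_, _, rfl, rfl, h⟩
    exact h.symm
  · intro h
    exact ⟨_, _, rfl, rfl, h.symm⟩

/-- The structure for the language of special relativity with primitive ether that the translation
defines in a structure for classical kinematics. -/
def radarized (I : Frame Empty B Q) : Frame EtherSymbol B Q where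
  iob k := I.iob k ∧ ∀ e, I.Ether e → I.Slower e k
  ph := I.ph
  ext _ e := I.Ether e
  W k b y := ∀ e, I.Ether e → ∃ v x, I.Velocity k e v ∧
    (∃ c, I.EtherLightSpeed c ∧ sqrt (norm2 v) < c ∧ radMap c v x = y) ∧ I.W k b x

theorem sat_trIOb : I.Sat f g trIOb ↔ I.iob (f 0) ∧ ∀ e, I.Ether e → I.Slower e (f 0) := by
  simp [trIOb]

theorem sat_trW : I.Sat f g trW ↔ ∀ e, I.Ether e → ∃ v x, I.Velocity (f 0) e v ∧
    (∃ c, I.EtherLightSpeed c ∧ sqrt (norm2 v) < c ∧ radMap c v x = blk g 0) ∧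
      I.W (f 0) (f 1) x := by
  simp only [trW, sat_allB, sat_imp, sat_ether, scons_zero]
  refine forall_congr' fun e => imp_congr_right fun _ => ?_
  have hv : ∀ (a b c : Q) (x : Fin 4 → Q),
      (fun i : Fin 3 => cons4 x (scons c (scons b (scons a g))) (4 + i)) = ![c, b, a] := by
    intro a b c x
    funext i; fin_cases i <;> rfl
  have hb : ∀ (a b c : Q) (x : Fin 4 → Q),
      blk (cons4 x (scons c (scons b (scons a g)))) 7 = blk g 0 := by
    intro a b c x
    rw [blk_cons4_add x _ 3, blk_scons_add _ 2, blk_scons_add _ 1, blk_scons_add _ 0]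
  simp only [sat_exQs_succ _ _ _ 6, sat_exQs_succ _ _ _ 5, sat_exQs_succ _ _ _ 4, sat_exQs_four,
    sat_and, sat_velocityIs, sat_radIs, sat_wl, hv, hb, blk_cons4_zero, scons_zero, scons_one,
    scons_two]
  exact ⟨fun ⟨a, b, c, h⟩ => ⟨![c, b, a], h⟩, fun ⟨v, h⟩ => ⟨v 2, v 1, v 0, by
    rwa [show ![v 0, v 1, v 2] = v by funext i; fin_cases i <;> rfl]⟩⟩

/-- Quantifiers and equality are preserved by the translation, so both domains are kept and only the
atomic relations need comparison. -/
theorem sat_TrPlus (I : Frame Empty B Q) (φ : Formula EtherSymbol) :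
    I.Sat f g (TrPlus φ) ↔ I.radarized.Sat f g φ := by
  induction φ generalizing f g with
  | imp φ ψ hφ hψ => exact imp_congr (hφ f g) (hψ f g)
  | allB φ ih => exact forall_congr' fun b => ih _ _
  | allQ φ ih => exact forall_congr' fun b => ih _ _
  | iob k => exact (I.sat_subst _ _ _ _ _).trans (sat_trIOb _ _ _)
  | ext R b => exact sat_ether _ _ _ _
  | W k b x =>
    refine (I.sat_subst _ _ _ _ _).trans ((sat_trW _ _ _).trans ?_)
    have : blk (fun n => (scons (x 0) (scons (x 1) (scons (x 2) fun _ => x 3)) n).eval g) 0 =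
        fun i => (x i).eval g := by
      apply ext_four <;> rfl
    rw [this]
    rfl
  | _ => exact Iff.rfl

end Frame
end

noncomputable section

/-! ## Maps that are affine on timelike lines -/

section Affine

variable {Q : Type} [Field Q] [LinearOrder Q] [IsEuclideanField Q]

/-- The time axis. -/
def timeUnit : Fin 4 → Q := ![1, 0, 0, 0]

@[simp] theorem timeUnit_zero : (timeUnit : Fin 4 → Q) 0 = 1 := rfl
@[simp] theorem timeUnit_one : (timeUnit : Fin 4 → Q) 1 = 0 := rfl
@[simp] theorem timeUnit_two : (timeUnit : Fin 4 → Q) 2 = 0 := rfl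
@[simp] theorem timeUnit_three : (timeUnit : Fin 4 → Q) 3 = 0 := rfl

/-- Squared length of the spatial part. -/
def snorm (d : Fin 4 → Q) : Q := d 1 * d 1 + d 2 * d 2 + d 3 * d 3

/-- The Minkowski form. -/
def minkowski (c : Q) (d : Fin 4 → Q) : Q := snorm d - c * c * (d 0 * d 0)

theorem sdist2_eq (x y : Fin 4 → Q) : sdist2 x y = snorm (y - x) := by
  simp only [sdist2, snorm, Pi.sub_apply]; ring

theorem sdist2_nonneg (x y : Fin 4 → Q) : 0 ≤ sdist2 x y := add_mul_self_nonneg _ _ _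

theorem sdist_eq_iff {c : Q} (hc : 0 < c) (x y : Fin 4 → Q) :
    sdist x y = c * |x 0 - y 0| ↔ minkowski c (y - x) = 0 := by
  rw [sdist, sqrt_eq_iff (sdist2_nonneg x y) (mul_nonneg hc.le (abs_nonneg _)), sdist2_eq,
    minkowski, sub_eq_zero, mul_mul_mul_comm, abs_mul_abs_self, Pi.sub_apply]
  ring_nf

theorem sdist_lt_iff {c : Q} (hc : 0 < c) (x y : Fin 4 → Q) :
    sdist x y < c * |x 0 - y 0| ↔ minkowski c (y - x) < 0 := by
  rw [sdist, sqrt_lt_iff (sdist2_nonneg x y) (mul_nonneg hc.le (abs_nonneg _)), sdist2_eq,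
    minkowski, sub_neg, mul_mul_mul_comm, abs_mul_abs_self, Pi.sub_apply]
  ring_nf

theorem exists_timelike {c : Q} (hc : 0 < c) (b : Fin 4 → Q) :
    ∃ N₀ : Q, ∀ N ≥ N₀, minkowski c (N • timeUnit + b) < 0 := by
  -- Chosen so that `c(N + b₀)` exceeds the sum of the absolute spatial coordinates, which bounds
  -- the spatial length.
  refine ⟨|b 0| + (|b 1| + |b 2| + |b 3|) / c + 1, fun N hN => ?_⟩
  have h₀ : |b 1| + |b 2| + |b 3| < c * (N + b 0) := by
    have : (|b 1| + |b 2| + |b 3|) / c < N + b 0 := by linarith [neg_abs_le (b 0)]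
    rwa [div_lt_iff₀ hc, mul_comm] at this
  have h₁ := abs_nonneg (b 1)
  have h₂ := abs_nonneg (b 2)
  have h₃ := abs_nonneg (b 3)
  have h₄ := mul_self_lt_mul_self (by positivity) h₀
  have e₁ := abs_mul_abs_self (b 1)
  have e₂ := abs_mul_abs_self (b 2)
  have e₃ := abs_mul_abs_self (b 3)
  simp only [minkowski, snorm, Pi.add_apply, Pi.smul_apply, smul_eq_mul, timeUnit_zero,
    timeUnit_one, timeUnit_two, timeUnit_three]
  nlinarith [mul_nonneg h₁ h₂, mul_nonneg h₁ h₃, mul_nonneg h₂ h₃]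

/-- A single large time component makes all the vectors timelike that serve as diagonals or summands
in `exists_linear_of_timelike`. -/
theorem exists_timelike_five {c : Q} (hc : 0 < c) (a b : Fin 4 → Q) : ∃ N : Q,
    minkowski c (N • timeUnit) < 0 ∧
    minkowski c (N • timeUnit + b) < 0 ∧ minkowski c (N • timeUnit - b) < 0 ∧
    minkowski c (N • timeUnit + a + b) < 0 ∧ minkowski c (N • timeUnit + a - b) < 0 := by
  obtain ⟨N₁, h₁⟩ := exists_timelike hc (0 : Fin 4 → Q)
  obtain ⟨N₂, h₂⟩ := exists_timelike hc b
  obtain ⟨N₃, h₃⟩ := exists_timelike hc (-b)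
  obtain ⟨N₄, h₄⟩ := exists_timelike hc (a + b)
  obtain ⟨N₅, h₅⟩ := exists_timelike hc (a - b)
  let N := max N₁ (max N₂ (max N₃ (max N₄ N₅)))
  refine ⟨N, ?_, h₂ N (by simp [N]), ?_, ?_, ?_⟩
  · simpa using h₁ N (by simp [N])
  · simpa [sub_eq_add_neg] using h₃ N (by simp [N])
  · simpa [add_assoc] using h₄ N (by simp [N])
  · simpa [add_sub_assoc] using h₅ N (by simp [N])

/-- A map that is affine on timelike lines is affine. -/
theorem exists_linear_of_timelike {c : Q} (hc : 0 < c) {g : (Fin 4 → Q) → Fin 4 → Q}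
    (hg : ∀ (x d : Fin 4 → Q) (t : Q), minkowski c d < 0 → g (x + t • d) = g x + t • (g (x + d) - g x)) :
    ∃ L : (Fin 4 → Q) →ₗ[Q] Fin 4 → Q, ∀ x d, g (x + d) = g x + L d := by
  -- Both diagonals of the parallelogram are timelike and have the same midpoint, whose image is the
  -- midpoint of the images of either pair of ends.
  have para : ∀ x a b, minkowski c (a + b) < 0 → minkowski c (a - b) < 0 →
      g (x + a + b) + g x = g (x + a) + g (x + b) := by
    intro x a b h₁ h₂
    have e₁ := hg x (a + b) 2⁻¹ h₁
    have e₂ := hg (x + b) (a - b) 2⁻¹ h₂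
    have hm : x + b + (2⁻¹ : Q) • (a - b) = x + (2⁻¹ : Q) • (a + b) := by module
    rw [hm, e₁, show x + b + (a - b) = x + a by abel, ← add_assoc] at e₂
    have := congrArg (fun z => (2 : Q) • z) e₂
    simp only [smul_add, smul_sub, smul_smul] at this
    norm_num at this
    rw [two_smul, two_smul] at this
    funext i
    have hi := congrFun this i
    simp only [Pi.add_apply, Pi.sub_apply] at hi ⊢
    linear_combination hi
  -- The increments along `b` at `x` and at `x + a` are both compared with the one at `x + a + N •
  -- timeUnit`, which lies so far in time that the diagonals of both parallelograms are timelike.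
  have add : ∀ x a b, g (x + a + b) - g (x + a) = g (x + b) - g x := by
    intro x a b
    obtain ⟨N, -, h₁, h₂, h₃, h₄⟩ := exists_timelike_five hc a b
    have e₁ := para (x + a) _ b h₁ h₂
    have e₂ := para x _ b h₃ h₄
    rw [show x + (N • timeUnit + a) = x + a + N • timeUnit by abel] at e₂
    funext i
    have hi₁ := congrFun e₁ i
    have hi₂ := congrFun e₂ i
    simp only [Pi.add_apply, Pi.sub_apply] at hi₁ hi₂ ⊢
    linear_combination hi₂ - hi₁
  have hadd : ∀ a b, g (a + b) - g 0 = (g a - g 0) + (g b - g 0) := by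
    intro a b
    have := add 0 a b
    rw [zero_add, zero_add] at this
    rw [← this]; abel
  have htl : ∀ (t : Q) d, minkowski c d < 0 → g (t • d) - g 0 = t • (g d - g 0) := by
    intro t d hd
    have := hg 0 d t hd
    rw [zero_add, zero_add] at this
    rw [this]; abel
  refine ⟨{ toFun := fun d => g d - g 0, map_add' := hadd, map_smul' := ?_ }, fun x d => ?_⟩
  · intro t d
    -- Homogeneity passes from timelike vectors to `d`, which is the difference of the timelike
    -- vectors `N • timeUnit + d` and `N • timeUnit`.
    obtain ⟨N, h₀, h₁, -⟩ := exists_timelike_five hc 0 d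
    have e₁ := htl t _ h₀
    have e₂ := htl t _ h₁
    rw [smul_add, hadd, e₁, hadd, smul_add] at e₂
    exact add_left_cancel e₂
  · have := add 0 x d
    rw [zero_add, zero_add] at this
    simp only [LinearMap.coe_mk, AddHom.coe_mk]
    rw [← this]; abel

end Affine

/-! ## Classical kinematics -/

section Classical

variable {B Q : Type} [Field Q] [LinearOrder Q] [IsEuclideanField Q]

/-- The axioms of classical kinematics with observers slower than light. -/
structure Frame.IsClassicalKin (I : Frame Empty B Q) : Prop where
  ev : ∀ k h, I.iob k → I.iob h → ∀ x, ∃ y, I.SameEv k h x y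
  self : ∀ k, I.iob k → ∀ x, I.W k k x ↔ x 1 = 0 ∧ x 2 = 0 ∧ x 3 = 0
  symD : ∀ k h, I.iob k → I.iob h → ∀ x y x' y', x 0 = y 0 → x' 0 = y' 0 →
    I.SameEv k h x x' → I.SameEv k h y y' → sdist x y = sdist x' y'
  line : ∀ k h, I.iob k → I.iob h → ∀ x y z, I.W k h x → I.W k h y → I.W k h z →
    ∃ a : Q, (∀ i, z i - x i = a * (y i - x i)) ∨ ∀ i, y i - z i = a * (z i - x i)
  triv : ∀ r b, IsTriv r b → ∀ k, I.iob k → ∃ k', I.iob k' ∧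
    ∀ x y, I.SameEv k k' x y ↔ affineMap r b x = y
  noAcc : ∀ k b x, I.W k b x → I.iob k
  absTime : ∀ k h, I.iob k → I.iob h → ∀ x y x' y', I.SameEv k h x x' → I.SameEv k h y y' →
    |x 0 - y 0| = |x' 0 - y' 0|
  ether : ∃ e, I.Ether e
  noFTL : ∀ k, I.iob k → ∀ e, I.Ether e → I.Slower e k
  thExp : ∀ e, I.Ether e → ∀ x y, (∃ c, I.EtherLightSpeed c ∧ sdist x y < c * |x 0 - y 0|) →
    ∃ k, I.iob k ∧ I.W e k x ∧ I.W e k y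

/-- `c` is the speed of light in all ether frames. -/
structure Frame.IsSpeedOfLight (I : Frame Empty B Q) (c : Q) : Prop where
  pos : 0 < c
  light : ∀ e, I.Ether e → I.LightSpeedIs e c
  iff : ∀ c', I.EtherLightSpeed c' ↔ c' = c

variable {I : Frame Empty B Q}

namespace Frame.SameEv

theorem refl (k : B) (x : Fin 4 → Q) : I.SameEv k k x x := fun _ => Iff.rfl

theorem symm {k h : B} {x y : Fin 4 → Q} (H : I.SameEv k h x y) : I.SameEv h k y x :=
  fun b => (H b).symm

theorem trans {k h o : B} {x y z : Fin 4 → Q} (H : I.SameEv k h x y) (H' : I.SameEv h o y z) :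
    I.SameEv k o x z := fun b => (H b).trans (H' b)

end Frame.SameEv

namespace Frame.IsClassicalKin

variable (hI : I.IsClassicalKin)
include hI

/-- AxAbsTime and then AxSymD are applied to `k` and itself, comparing the pair `x, x` with the pair
`x, y`. -/
theorem eq_of_sameEv {k : B} (hk : I.iob k) {x y : Fin 4 → Q} (h : I.SameEv k k x y) : x = y := by
  have h₀ : x 0 = y 0 := by
    have := hI.absTime k k hk hk x x x y (.refl k x) h
    rw [sub_self, abs_zero, eq_comm, abs_eq_zero, sub_eq_zero] at this
    exact this
  have h₁ := hI.symD k k hk hk x x x y rfl h₀ (.refl k x) h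
  rw [sdist, sdist, sqrt_inj (sdist2_nonneg _ _) (sdist2_nonneg _ _)] at h₁
  have h₂ : sdist2 x x = 0 := by simp [sdist2]
  obtain ⟨e₁, e₂, e₃⟩ := eq_zero_of_add_mul_self (h₁.symm.trans h₂)
  exact ext_four h₀ (sub_eq_zero.1 e₁) (sub_eq_zero.1 e₂) (sub_eq_zero.1 e₃)

theorem absTime_sq {k h : B} (hk : I.iob k) (hh : I.iob h) {x y x' y' : Fin 4 → Q}
    (hx : I.SameEv k h x x') (hy : I.SameEv k h y y') :
    (y' 0 - x' 0) * (y' 0 - x' 0) = (y 0 - x 0) * (y 0 - x 0) := by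
  have := hI.absTime k h hk hh y x y' x' hy hx
  rw [← abs_mul_abs_self (y' 0 - x' 0), ← this, abs_mul_abs_self]

/-- Worldview transformations preserve ratios on worldlines. -/
theorem sameEv_line {k h o : B} (hk : I.iob k) (hh : I.iob h) (ho : I.iob o)
    {x y x' y' z' : Fin 4 → Q} {t : Q} (hx : I.W k o x) (hy : I.W k o y)
    (hz : I.W k o (x + t • (y - x))) (hxy : x 0 ≠ y 0) (ex : I.SameEv k h x x')
    (ey : I.SameEv k h y y') (ez : I.SameEv k h (x + t • (y - x)) z') :
    z' = x' + t • (y' - x') := by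
  have hT : y 0 - x 0 ≠ 0 := sub_ne_zero.2 hxy.symm
  have t₁ := hI.absTime_sq hk hh ex ey
  have t₂ := hI.absTime_sq hk hh ex ez
  have t₃ := hI.absTime_sq hk hh ez ey
  simp only [Pi.add_apply, Pi.smul_apply, Pi.sub_apply, smul_eq_mul] at t₂ t₃
  have hT' : y' 0 - x' 0 ≠ 0 := by
    intro h
    rw [h, mul_zero, eq_comm, mul_self_eq_zero] at t₁
    exact hT t₁
  have hTT := mul_ne_zero hT hT
  -- Absolute time determines `a²` and `(1 - a)²`; the difference of these two equations is linear
  -- in `a` and gives `a = t`, with no ambiguity of sign.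
  have key : ∀ a : Q, (∀ i, z' i - x' i = a * (y' i - x' i)) → z' = x' + t • (y' - x') := by
    intro a ha
    have e₁ : a * a = t * t := by
      refine mul_right_cancel₀ hTT ?_
      rw [ha 0] at t₂
      linear_combination t₂ - a * a * t₁
    have e₂ : (1 - a) * (1 - a) = (1 - t) * (1 - t) := by
      refine mul_right_cancel₀ hTT ?_
      have : y' 0 - z' 0 = (1 - a) * (y' 0 - x' 0) := by linear_combination -ha 0
      rw [this] at t₃
      linear_combination t₃ - (1 - a) * (1 - a) * t₁
    have e₃ : a = t := by linear_combination (e₁ - e₂) / 2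
    subst e₃
    funext i
    simp only [Pi.add_apply, Pi.smul_apply, Pi.sub_apply, smul_eq_mul]
    linear_combination ha i
  obtain ⟨a, ha | ha⟩ := hI.line h o hh ho x' y' z' ((ex o).1 hx) ((ey o).1 hy) ((ez o).1 hz)
  · exact key a ha
  · have h₁ : ∀ i, y' i - x' i = (1 + a) * (z' i - x' i) := fun i => by linear_combination ha i
    have h₂ : 1 + a ≠ 0 := by
      intro h
      rw [h₁ 0, h, zero_mul] at hT'
      exact hT' rfl
    refine key (1 + a)⁻¹ fun i => ?_
    rw [h₁ i, inv_mul_cancel_left₀ h₂]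

/-- Worldlines of observers are full lines. -/
theorem W_line {k o : B} (hk : I.iob k) (ho : I.iob o) {x y : Fin 4 → Q} (t : Q)
    (hx : I.W k o x) (hy : I.W k o y) (hxy : x 0 ≠ y 0) : I.W k o (x + t • (y - x)) := by
  obtain ⟨x', ex⟩ := hI.ev k o hk ho x
  obtain ⟨y', ey⟩ := hI.ev k o hk ho y
  have hx' := (ex o).1 hx
  have hy' := (ey o).1 hy
  -- For `o` itself the worldline is the whole time axis. The point is found there and carried back
  -- to `k`, where `sameEv_line` locates it.
  have hz' : I.W o o (x' + t • (y' - x')) := by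
    obtain ⟨a₁, a₂, a₃⟩ := (hI.self o ho x').1 hx'
    obtain ⟨b₁, b₂, b₃⟩ := (hI.self o ho y').1 hy'
    rw [hI.self o ho]
    simp [a₁, a₂, a₃, b₁, b₂, b₃]
  obtain ⟨z, ez⟩ := hI.ev o k ho hk (x' + t • (y' - x'))
  have hxy' : x' 0 ≠ y' 0 := by
    intro h
    have := hI.absTime_sq hk ho ex ey
    rw [h, sub_self, mul_zero, eq_comm, mul_self_eq_zero, sub_eq_zero] at this
    exact hxy this.symm
  rw [← hI.sameEv_line ho hk ho hx' hy' hz' hxy' ex.symm ey.symm ez]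
  exact (ez o).1 hz'

/-- AxNoFTL, applied to an ether observer as seen by itself, supplies a common speed of all light
signals. It agrees with the constant of each light cone, since a signal has two distinct points on
its worldline. -/
theorem exists_isSpeedOfLight : ∃ c, I.IsSpeedOfLight c := by
  obtain ⟨e₀, he₀⟩ := hI.ether
  obtain ⟨-, c, -, hc, -⟩ := hI.noFTL e₀ he₀.1 e₀ he₀
  have key : ∀ e c₁ c', I.Ether e → I.LightSpeedIs e c₁ → I.EtherLightSpeed c' → c' = c₁ := by
    intro e c₁ c' he h₁ h'
    -- A signal exists because the condition for a light connection holds trivially for a point and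
    -- itself.
    obtain ⟨p, hp, -, -⟩ := (h₁ 0 0).2 (by
      rw [sub_self, abs_zero, mul_zero, sdist, sqrt_eq_iff (sdist2_nonneg _ _) le_rfl]
      simp [sdist2])
    obtain ⟨⟨x, y, hx, hy, hxy⟩, hs⟩ := h' e he p hp
    have e₁ := hs x y hx hy
    have e₂ := (h₁ x y).1 ⟨p, hp, hx, hy⟩
    have h0 : |x 0 - y 0| ≠ 0 := by
      intro h
      rw [h, mul_zero, sdist, sqrt_eq_iff (sdist2_nonneg _ _) le_rfl, mul_zero] at e₁
      obtain ⟨a₁, a₂, a₃⟩ := eq_zero_of_add_mul_self e₁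
      exact hxy (ext_four (sub_eq_zero.1 (abs_eq_zero.1 h)) (sub_eq_zero.1 a₁) (sub_eq_zero.1 a₂)
        (sub_eq_zero.1 a₃))
    exact mul_right_cancel₀ h0 (e₁.symm.trans e₂)
  obtain ⟨c₀, hc₀, hl₀⟩ := he₀.2
  refine ⟨c, ?_, ?_, ?_⟩
  · rwa [key e₀ c₀ c he₀ hl₀ hc]
  · rintro e ⟨he, c₁, hc₁, hl₁⟩
    rwa [key e c₁ c ⟨he, c₁, hc₁, hl₁⟩ hl₁ hc]
  · intro c'
    constructor
    · intro h'
      rw [key e₀ c₀ c he₀ hl₀ hc, key e₀ c₀ c' he₀ hl₀ h']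
    · rintro rfl
      exact hc

end Frame.IsClassicalKin

end Classical
end

noncomputable section

/-! ### Worldview transformations from the ether are Galilean -/

section Galilean

variable {B Q : Type} [Field Q] [LinearOrder Q] [IsEuclideanField Q]

/-- Squared length of the spatial part, relative to a frame moving with velocity `v`. -/
def driftNorm (v : Fin 3 → Q) (d : Fin 4 → Q) : Q :=
  (d 1 - v 0 * d 0) * (d 1 - v 0 * d 0) + (d 2 - v 1 * d 0) * (d 2 - v 1 * d 0) +
    (d 3 - v 2 * d 0) * (d 3 - v 2 * d 0)

theorem driftNorm_eq_zero {v : Fin 3 → Q} {d : Fin 4 → Q} (h : driftNorm v d = 0) :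
    d 1 = v 0 * d 0 ∧ d 2 = v 1 * d 0 ∧ d 3 = v 2 * d 0 := by
  obtain ⟨h₁, h₂, h₃⟩ := eq_zero_of_add_mul_self h
  exact ⟨sub_eq_zero.1 h₁, sub_eq_zero.1 h₂, sub_eq_zero.1 h₃⟩

theorem exists_affine_eq (L : (Fin 4 → Q) ≃ₗ[Q] Fin 4 → Q) (b y : Fin 4 → Q) :
    ∃ x, L x + b = y :=
  ⟨L.symm (y - b), by simp⟩

/-- The worldview transformation from `e` to `k` is the map with linear part `L` and translation
`b`, it is a Galilean transformation, and `v` is the velocity of `e` for `k`. -/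
structure Frame.IsGalilean (I : Frame Empty B Q) (e k : B) (L : (Fin 4 → Q) ≃ₗ[Q] Fin 4 → Q)
    (b : Fin 4 → Q) (v : Fin 3 → Q) : Prop where
  sameEv : ∀ x y, I.SameEv e k x y ↔ L x + b = y
  time : ∀ d, L d 0 * L d 0 = d 0 * d 0
  drift : ∀ d, driftNorm v (L d) = snorm d

variable {I : Frame Empty B Q}

/-- Every timelike line of `e` carries an observer, so the transformation is affine on it and hence
affine everywhere. AxAbsTime controls the time component, AxSymD the simultaneous vectors; a general
vector is a simultaneous one plus a multiple of the time unit. -/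
theorem Frame.IsClassicalKin.exists_isGalilean (hI : I.IsClassicalKin) {e k : B}
    (he : I.Ether e) (hk : I.iob k) : ∃ L b v, I.IsGalilean e k L b v := by
  obtain ⟨c, hc⟩ := hI.exists_isSpeedOfLight
  choose g hg using hI.ev e k he.1 hk
  have hgy : ∀ x y, I.SameEv e k x y ↔ g x = y := fun x y =>
    ⟨fun h => hI.eq_of_sameEv hk ((hg x).symm.trans h), by rintro rfl; exact hg x⟩
  have tl : ∀ (x d : Fin 4 → Q) (t : Q), minkowski c d < 0 →
      g (x + t • d) = g x + t • (g (x + d) - g x) := by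
    intro x d t hd
    have hd' : sdist x (x + d) < c * |x 0 - (x + d) 0| := by
      rw [sdist_lt_iff hc.pos, add_sub_cancel_left]; exact hd
    obtain ⟨o, ho, hox, hoy⟩ := hI.thExp e he x (x + d) ⟨c, (hc.iff c).2 rfl, hd'⟩
    have hxy : x 0 ≠ (x + d) 0 := by
      intro h
      rw [h, sub_self, abs_zero, mul_zero] at hd'
      exact (sqrt_nonneg _).not_gt hd'
    have hz := hI.W_line he.1 ho t hox hoy hxy
    have := hI.sameEv_line he.1 hk ho hox hoy hz hxy (hg _) (hg _) (hg _)
    rwa [add_sub_cancel_left] at this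
  obtain ⟨L, hL⟩ := exists_linear_of_timelike hc.pos tl
  have hL0 : ∀ x, g x = L x + g 0 := fun x => by
    have := hL 0 x
    rw [zero_add] at this
    rw [this, add_comm]
  have hinj : Function.Injective L := by
    intro x y hxy
    refine hI.eq_of_sameEv he.1 ((hg x).trans ?_)
    rw [hL0 x, hxy, ← hL0 y]
    exact (hg y).symm
  have hsurj : Function.Surjective L := by
    intro y
    obtain ⟨x, hx⟩ := hI.ev k e hk he.1 (y + g 0)
    have := (hgy _ _).1 hx.symm
    rw [hL0] at this
    exact ⟨x, add_right_cancel this⟩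
  have htime : ∀ d, L d 0 * L d 0 = d 0 * d 0 := by
    intro d
    have := hI.absTime_sq he.1 hk (hg 0) (hg d)
    rw [hL0 d] at this
    simpa using this
  have hspace : ∀ d : Fin 4 → Q, d 0 = 0 → snorm (L d) = snorm d := by
    intro d hd
    have h0 : (L d + g 0) 0 = g 0 0 := by
      have := htime d
      rw [hd, mul_zero, mul_self_eq_zero] at this
      rw [Pi.add_apply, this, zero_add]
    have h := hI.symD e k he.1 hk 0 d (g 0) (g d) hd.symm (by rw [hL0 d, h0]) (hg 0) (hg d)
    rw [sdist, sdist, sqrt_inj (sdist2_nonneg _ _) (sdist2_nonneg _ _), sdist2_eq, sdist2_eq,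
      hL0 d, sub_zero, add_sub_cancel_right] at h
    exact h.symm
  refine ⟨LinearEquiv.ofBijective L ⟨hinj, hsurj⟩, g 0,
    -- The velocity is the slope of the image of the time axis; the time component of that image is
    -- `1` or `-1`, so multiplying by it is the same as dividing.
    ![L timeUnit 0 * L timeUnit 1, L timeUnit 0 * L timeUnit 2, L timeUnit 0 * L timeUnit 3],
    fun x y => ?_, htime, fun d => ?_⟩
  · rw [hgy, hL0]; rfl
  · have h₁ : L timeUnit 0 * L timeUnit 0 = 1 := by
      rw [htime]; simp
    have h₂ := hspace (d - d 0 • timeUnit) (by simp)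
    have h₃ : L (d - d 0 • timeUnit) 0 = 0 := by
      have := htime (d - d 0 • timeUnit)
      rw [show (d - d 0 • timeUnit : Fin 4 → Q) 0 = 0 by simp, mul_zero, mul_self_eq_zero] at this
      exact this
    have h₄ : ∀ i, L d i = L (d - d 0 • timeUnit) i + d 0 * L timeUnit i := fun i => by
      rw [map_sub, map_smul]; simp
    have h₅ : snorm (d - d 0 • timeUnit) = snorm d := by simp [snorm]
    rw [← h₅, ← h₂]
    change driftNorm _ (L d) = _
    simp only [driftNorm, snorm, h₄, h₃, Matrix.cons_val]
    generalize L (d - d 0 • timeUnit) = m at *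
    generalize L timeUnit = u at *
    have e : ∀ i, m i + d 0 * u i - u 0 * u i * (0 + d 0 * u 0) = m i := fun i => by
      linear_combination -d 0 * u i * h₁
    rw [e, e, e]

namespace Frame.IsGalilean

variable {e k : B} {L : (Fin 4 → Q) ≃ₗ[Q] Fin 4 → Q} {b : Fin 4 → Q} {v : Fin 3 → Q}

theorem W_iff (h : I.IsGalilean e k L b v) (o : B) (x : Fin 4 → Q) :
    I.W k o (L x + b) ↔ I.W e o x := ((h.sameEv _ _).2 rfl o).symm

/-- The worldline of `e` is the image of the time axis, whose vectors have spatial length zero; by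
`drift` their images have slope `v`. -/
theorem velocity_iff (hI : I.IsClassicalKin) (he : I.iob e) (h : I.IsGalilean e k L b v)
    (v' : Fin 3 → Q) : I.Velocity k e v' ↔ v' = v := by
  have hW : ∀ x, I.W k e (L x + b) ↔ snorm x = 0 := by
    intro x
    rw [h.W_iff, hI.self e he]
    exact ⟨fun ⟨h₁, h₂, h₃⟩ => by simp [snorm, h₁, h₂, h₃], eq_zero_of_add_mul_self⟩
  have h0 : I.W k e b := by
    have := (hW 0).2 (by simp [snorm])
    rwa [map_zero, zero_add] at this
  have h1 : I.W k e (L timeUnit + b) := (hW _).2 (by simp [snorm])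
  have ht : L timeUnit 0 ≠ 0 := by
    intro h'
    have := h.time timeUnit
    simp [h'] at this
  have hd := driftNorm_eq_zero ((h.drift timeUnit).trans (by simp [snorm]))
  constructor
  · rintro ⟨-, hv⟩
    have := hv _ _ h0 h1
    simp only [Pi.add_apply, add_sub_cancel_right] at this
    obtain ⟨e₁, e₂, e₃⟩ := this
    obtain ⟨d₁, d₂, d₃⟩ := hd
    funext i
    fin_cases i
    · exact mul_right_cancel₀ ht (e₁.symm.trans d₁)
    · exact mul_right_cancel₀ ht (e₂.symm.trans d₂)
    · exact mul_right_cancel₀ ht (e₃.symm.trans d₃)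
  · rintro rfl
    refine ⟨⟨_, _, h0, h1, fun h' => ht ?_⟩, fun x y hx hy => ?_⟩
    · have := congrFun h' 0
      rwa [Pi.add_apply, eq_comm, add_eq_right] at this
    · obtain ⟨x, rfl⟩ := exists_affine_eq L b x
      obtain ⟨y, rfl⟩ := exists_affine_eq L b y
      obtain ⟨x₁, x₂, x₃⟩ := eq_zero_of_add_mul_self ((hW x).1 hx)
      obtain ⟨y₁, y₂, y₃⟩ := eq_zero_of_add_mul_self ((hW y).1 hy)
      have := driftNorm_eq_zero ((h.drift (y - x)).trans (by
        simp [snorm, x₁, x₂, x₃, y₁, y₂, y₃]))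
      simpa [map_sub] using this

/-- AxNoFTL bounds the speed of `k` for `e`, while `v` is the velocity of `e` for `k`. The two
speeds agree: a unit segment of the time axis of `k` is pulled back to `e`, and its spatial length
there is `|v|` by `drift`. -/
theorem norm2_lt (hI : I.IsClassicalKin) {c : Q} (hc : I.IsSpeedOfLight c) (he : I.Ether e)
    (hk : I.iob k) (h : I.IsGalilean e k L b v) : sqrt (norm2 v) < c := by
  obtain ⟨s, c', ⟨-, hs⟩, hc', hsc⟩ := hI.noFTL k hk e he
  rw [(hc.iff c').1 hc'] at hsc
  obtain ⟨x, hx⟩ := exists_affine_eq L b 0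
  obtain ⟨y, hy⟩ := exists_affine_eq L b timeUnit
  have hxk : I.W e k x := by
    rw [← h.W_iff, hx, hI.self k hk]; simp
  have hyk : I.W e k y := by
    rw [← h.W_iff, hy, hI.self k hk]; simp
  have hL : L (y - x) = timeUnit := by
    rw [map_sub, ← add_sub_add_right_eq_sub _ _ b, hx, hy, sub_zero]
  have h₁ := h.time (y - x)
  have h₂ := h.drift (y - x)
  have h₃ := hs x y hxk hyk
  rw [hL] at h₁ h₂
  have h₄ : |x 0 - y 0| = 1 := by
    rw [abs_sub_comm]
    have : |y 0 - x 0| * |y 0 - x 0| = 1 := by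
      rw [abs_mul_abs_self]; simpa using h₁.symm
    nlinarith [abs_nonneg (y 0 - x 0)]
  have h₅ : norm2 v = snorm (y - x) := by
    rw [← h₂]; simp [norm2, driftNorm]
  rw [h₅, ← sdist2_eq]
  change sdist x y < c
  rw [h₃, h₄, mul_one]
  exact hsc

/-- Ether observers are at rest relative to each other. -/
theorem eq_zero_of_ether {c : Q} (hc : I.IsSpeedOfLight c) (he : I.Ether e) (hk : I.Ether k)
    (h : I.IsGalilean e k L b v) : v = 0 := by
  -- The light cone of `e` appears to `k` as a cone tilted by `v`; since `k` is an ether observer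
  -- too, it must lie in the standard cone.
  have key : ∀ m : Fin 4 → Q, driftNorm v m = c * c * (m 0 * m 0) →
      snorm m = c * c * (m 0 * m 0) := by
    intro m hm
    obtain ⟨d, rfl⟩ := L.surjective m
    rw [h.drift, h.time] at hm
    have h₁ : sdist 0 d = c * |(0 : Fin 4 → Q) 0 - d 0| := by
      rw [sdist_eq_iff hc.pos, sub_zero, minkowski, hm, sub_self]
    obtain ⟨p, hp, h₂, h₃⟩ := (hc.light e he 0 d).2 h₁
    have h₄ := (hc.light k hk (L 0 + b) (L d + b)).1
      ⟨p, hp, (h.W_iff _ _).2 h₂, (h.W_iff _ _).2 h₃⟩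
    rw [sdist_eq_iff hc.pos, map_zero, add_sub_add_right_eq_sub, sub_zero, minkowski] at h₄
    exact sub_eq_zero.1 h₄
  -- Two opposite directions of the tilted cone, whose equations average to `|v|² + c² = c²`.
  have h₁ := key ![1, v 0 + c, v 1, v 2] (by
    simp only [driftNorm, Matrix.cons_val]; ring)
  have h₂ := key ![1, v 0 - c, v 1, v 2] (by
    simp only [driftNorm, Matrix.cons_val]; ring)
  simp only [snorm, Matrix.cons_val] at h₁ h₂
  obtain ⟨e₁, e₂, e₃⟩ := norm2_eq_zero (v := v) (by
    rw [norm2]; linear_combination (h₁ + h₂) / 2)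
  funext i
  fin_cases i
  exacts [e₁, e₂, e₃]

end Frame.IsGalilean

/-- All ether observers have the same velocity. -/
theorem Frame.IsClassicalKin.exists_velocity (hI : I.IsClassicalKin) {c : Q}
    (hc : I.IsSpeedOfLight c) {k : B} (hk : I.iob k) :
    ∃ v, sqrt (norm2 v) < c ∧ ∀ e, I.Ether e → ∃ L b, I.IsGalilean e k L b v := by
  obtain ⟨e, he⟩ := hI.ether
  obtain ⟨L, b, v, h⟩ := hI.exists_isGalilean he hk
  refine ⟨v, h.norm2_lt hI hc he hk, fun e' he' => ?_⟩
  obtain ⟨L', b', v', h'⟩ := hI.exists_isGalilean he' hk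
  obtain ⟨M, a, w, hM⟩ := hI.exists_isGalilean he he'.1
  obtain rfl := hM.eq_zero_of_ether hc he he'
  have hcomp : ∀ x, L x + b = L' (M x + a) + b' := by
    intro x
    rw [← h.sameEv]
    exact ((hM.sameEv _ _).2 rfl).trans ((h'.sameEv _ _).2 rfl)
  have hlin : L timeUnit = L' (M timeUnit) := by
    have h₀ := hcomp 0
    have h₁ := hcomp timeUnit
    simp only [map_zero, map_add, zero_add] at h₀ h₁
    rw [h₀] at h₁
    have : L timeUnit + (L' a + b') = L' (M timeUnit) + (L' a + b') := by rw [h₁]; abel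
    exact add_right_cancel this
  have ht : L timeUnit 0 ≠ 0 := by
    intro h'
    have := h.time timeUnit
    simp [h'] at this
  have d₁ := driftNorm_eq_zero ((h.drift timeUnit).trans (by simp [snorm]))
  -- As `e` and `e'` are at relative rest, the time axes of both are mapped by `k` to lines of the
  -- same direction.
  have d₂ := driftNorm_eq_zero (v := v') (d := L timeUnit) (by
    rw [hlin, h'.drift]
    have := hM.drift timeUnit
    simpa [driftNorm, snorm] using this)
  have : v' = v := by
    funext i
    fin_cases i
    · exact mul_right_cancel₀ ht (d₂.1.symm.trans d₁.1)
    · exact mul_right_cancel₀ ht (d₂.2.1.symm.trans d₁.2.1)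
    · exact mul_right_cancel₀ ht (d₂.2.2.symm.trans d₁.2.2)
  exact ⟨L', b', this ▸ h'⟩

end Galilean
end

noncomputable section

/-! ## Radarization as a linear map -/

section Radarization

variable {Q : Type} [Field Q] [LinearOrder Q] [IsEuclideanField Q]

/-- The vector of space-time with spatial part `v` and time `0`. -/
def spatial (v : Fin 3 → Q) : Fin 4 → Q := ![0, v 0, v 1, v 2]

theorem radMap_eq (c : Q) (v : Fin 3 → Q) (x : Fin 4 → Q) : radMap c v x =
    x + (sprod v x / (c * c * sqrt (1 - norm2 v / (c * c)) *
      (1 + sqrt (1 - norm2 v / (c * c))))) • spatial v +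
      (sqrt (1 - norm2 v / (c * c)) * x 0 +
        sprod v x / (c * c) / sqrt (1 - norm2 v / (c * c)) - x 0) • timeUnit := by
  apply ext_four <;>
    simp only [radMap, spatial, timeUnit, Pi.add_apply, Pi.smul_apply, smul_eq_mul,
      Matrix.cons_val] <;> ring

theorem sprod_zero (x : Fin 4 → Q) : sprod 0 x = 0 := by simp [sprod]

theorem radMap_zero (c : Q) (x : Fin 4 → Q) : radMap c 0 x = x := by
  have : sqrt (1 : Q) = 1 := (sqrt_eq_iff zero_le_one zero_le_one).2 (mul_one 1).symm
  apply ext_four <;> simp [radMap, sprod_zero, norm2, this]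

variable {c : Q} {v : Fin 3 → Q}

theorem norm2_lt_of_sqrt_lt (hv : sqrt (norm2 v) < c) : 0 < c ∧ norm2 v < c * c := by
  have hc : 0 < c := (sqrt_nonneg _).trans_lt hv
  exact ⟨hc, (sqrt_lt_iff (norm2_nonneg v) hc.le).1 hv⟩

theorem exists_factor (hv : sqrt (norm2 v) < c) : ∃ k, 0 < k ∧
    sqrt (1 - norm2 v / (c * c)) = k ∧ norm2 v = (1 - k * k) * (c * c) := by
  obtain ⟨hc, hv⟩ := norm2_lt_of_sqrt_lt hv
  have hk₀ := radMap_factor_pos hc hv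
  refine ⟨_, sqrt_pos hk₀, rfl, ?_⟩
  rw [sqrt_mul_self hk₀.le]
  field_simp; ring

/-- Radarization maps the light cone of the ether to the standard light cone. -/
theorem minkowski_radMap (hv : sqrt (norm2 v) < c) (x : Fin 4 → Q) :
    minkowski c (radMap c v x) = driftNorm v x - c * c * (x 0 * x 0) := by
  obtain ⟨k, hk, hk', hn⟩ := exists_factor hv
  have hc := (norm2_lt_of_sqrt_lt hv).1
  have hk₁ : (1 + k) ≠ 0 := by positivity
  unfold norm2 at hn
  simp only [minkowski, snorm, radMap, hk', Matrix.cons_val, driftNorm]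
  have hp : sprod v x = v 0 * x 1 + v 1 * x 2 + v 2 * x 3 := rfl
  -- The stretching of space contributes exactly `p²/(c²k²)`, which cancels against the same term
  -- from the square of the new time.
  have e : ∀ p : Q, p = v 0 * x 1 + v 1 * x 2 + v 2 * x 3 →
      (x 1 + p / (c * c * k * (1 + k)) * v 0) * (x 1 + p / (c * c * k * (1 + k)) * v 0) +
        (x 2 + p / (c * c * k * (1 + k)) * v 1) * (x 2 + p / (c * c * k * (1 + k)) * v 1) +
        (x 3 + p / (c * c * k * (1 + k)) * v 2) * (x 3 + p / (c * c * k * (1 + k)) * v 2) =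
      x 1 * x 1 + x 2 * x 2 + x 3 * x 3 + p * p / (c * c * (k * k)) := by
    intro p hp
    have : ∀ q : Q, (x 1 + q * v 0) * (x 1 + q * v 0) + (x 2 + q * v 1) * (x 2 + q * v 1) +
        (x 3 + q * v 2) * (x 3 + q * v 2) =
        x 1 * x 1 + x 2 * x 2 + x 3 * x 3 + 2 * q * p + q * q * ((1 - k * k) * (c * c)) := by
      intro q
      rw [hp, ← hn]; ring
    rw [this]
    field_simp
    ring
  rw [e _ hp]
  have e₂ : (k * x 0 + sprod v x / (c * c) / k) * (k * x 0 + sprod v x / (c * c) / k) * (c * c) =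
      k * k * (c * c) * (x 0 * x 0) + 2 * x 0 * sprod v x +
        sprod v x * sprod v x / (c * c * (k * k)) := by
    field_simp
    ring
  rw [hp] at e₂ ⊢
  linear_combination -e₂ - x 0 * x 0 * hn

/-- The `v`-component of the image is a positive multiple of that of `x`, so the kernel is trivial;
in finite dimension this gives bijectivity. -/
theorem exists_radEquiv (hv : sqrt (norm2 v) < c) :
    ∃ R : (Fin 4 → Q) ≃ₗ[Q] Fin 4 → Q, ∀ x, R x = radMap c v x := by
  obtain ⟨k, hk, hk', hn⟩ := exists_factor hv
  have hc := (norm2_lt_of_sqrt_lt hv).1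
  let R : (Fin 4 → Q) →ₗ[Q] Fin 4 → Q :=
    { toFun := radMap c v
      map_add' := fun x y => by
        apply ext_four <;>
          simp only [radMap, hk', Matrix.cons_val, sprod, Pi.add_apply] <;> ring
      map_smul' := fun t x => by
        apply ext_four <;>
          simp only [radMap, hk', Matrix.cons_val, sprod, Pi.smul_apply, smul_eq_mul,
            RingHom.id_apply] <;> ring }
  have hinj : Function.Injective R := by
    refine (injective_iff_map_eq_zero R).2 fun x hx => ?_
    have h₀ := congrFun hx 0
    have h₁ := congrFun hx 1
    have h₂ := congrFun hx 2
    have h₃ := congrFun hx 3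
    change radMap c v x 0 = 0 at h₀
    change radMap c v x 1 = 0 at h₁
    change radMap c v x 2 = 0 at h₂
    change radMap c v x 3 = 0 at h₃
    simp only [radMap, hk', Matrix.cons_val] at h₀ h₁ h₂ h₃
    have hκ : 0 < c * c * k * (1 + k) := by positivity
    have hp : sprod v x * (1 + norm2 v / (c * c * k * (1 + k))) = 0 := by
      have : sprod v x * (1 + norm2 v / (c * c * k * (1 + k))) =
          v 0 * (x 1 + sprod v x / (c * c * k * (1 + k)) * v 0) +
          v 1 * (x 2 + sprod v x / (c * c * k * (1 + k)) * v 1) +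
          v 2 * (x 3 + sprod v x / (c * c * k * (1 + k)) * v 2) := by
        simp only [sprod, norm2]; ring
      rw [this, h₁, h₂, h₃]; ring
    have hp' : sprod v x = 0 := by
      refine (mul_eq_zero.1 hp).resolve_right ?_
      have := norm2_nonneg v
      positivity
    rw [hp'] at h₀ h₁ h₂ h₃
    simp only [zero_div, zero_mul, add_zero, mul_eq_zero, hk.ne', false_or] at h₀ h₁ h₂ h₃
    exact ext_four h₀ h₁ h₂ h₃
  exact ⟨LinearEquiv.ofInjectiveEndo R hinj, fun x => rfl⟩

end Radarization

/-! ## The radarized structure -/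

section Radarized

variable {B Q : Type} [Field Q] [LinearOrder Q] [IsEuclideanField Q] {I : Frame Empty B Q} {c : Q}

/-- For the observer `k`, which sees the ether move with velocity `v`, radarization is the linear
map `R`. -/
structure Frame.IsRadarization (I : Frame Empty B Q) (c : Q) (k : B) (v : Fin 3 → Q)
    (R : (Fin 4 → Q) ≃ₗ[Q] Fin 4 → Q) : Prop where
  lt : sqrt (norm2 v) < c
  eq : ∀ x, R x = radMap c v x
  galilean : ∀ e, I.Ether e → ∃ L b, I.IsGalilean e k L b v
  W_iff : ∀ o x, I.radarized.W k o (R x) ↔ I.W k o x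

theorem Frame.radarized_sameEv {k h : B} {v w : Fin 3 → Q}
    {R S : (Fin 4 → Q) ≃ₗ[Q] Fin 4 → Q} (hR : I.IsRadarization c k v R)
    (hS : I.IsRadarization c h w S) (x y : Fin 4 → Q) :
    I.radarized.SameEv k h (R x) (S y) ↔ I.SameEv k h x y :=
  forall_congr' fun o => by rw [hR.W_iff, hS.W_iff]

namespace Frame.IsClassicalKin

variable (hI : I.IsClassicalKin) (hc : I.IsSpeedOfLight c)
include hI hc

/-- The definition of `radarized` quantifies over all ether observers; since the velocity and `c`
are the same for all of them, a single linear map describes it. -/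
theorem exists_isRadarization {k : B} (hk : I.iob k) :
    ∃ v R, I.IsRadarization c k v R := by
  obtain ⟨v, hv, hG⟩ := hI.exists_velocity hc hk
  obtain ⟨R, hR⟩ := exists_radEquiv hv
  refine ⟨v, R, hv, hR, hG, fun o x => ?_⟩
  constructor
  · intro h
    obtain ⟨e, he⟩ := hI.ether
    obtain ⟨L, b, hL⟩ := hG e he
    obtain ⟨v', x', hv', ⟨c', hc', -, hx'⟩, hW⟩ := h e he
    obtain rfl := (hL.velocity_iff hI he.1 v').1 hv'
    obtain rfl := (hc.iff c').1 hc'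
    rw [← hR] at hx'
    rwa [← R.injective hx']
  · intro h e he
    obtain ⟨L, b, hL⟩ := hG e he
    exact ⟨v, x, (hL.velocity_iff hI he.1 v).2 rfl, ⟨c, (hc.iff c).2 rfl, hv, (hR x).symm⟩, h⟩

theorem iob_radarized (k : B) : I.radarized.iob k ↔ I.iob k :=
  ⟨And.left, fun hk => ⟨hk, hI.noFTL k hk⟩⟩

/-- In the radarized structure, the coordinates of every observer are obtained from those of the
ether by a Poincaré transformation. -/
theorem exists_chart {e k : B} (he : I.Ether e) (hk : I.iob k) :
    ∃ (M : (Fin 4 → Q) ≃ₗ[Q] Fin 4 → Q) (b : Fin 4 → Q),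
      (∀ d, minkowski c (M d) = minkowski c d) ∧
        ∀ o x, I.radarized.W k o (M x + b) ↔ I.W e o x := by
  obtain ⟨v, R, hR⟩ := hI.exists_isRadarization hc hk
  obtain ⟨L, b, hL⟩ := hR.galilean e he
  refine ⟨L.trans R, R b, fun d => ?_, fun o x => ?_⟩
  · rw [LinearEquiv.trans_apply, hR.eq, minkowski_radMap hR.lt, hL.drift, hL.time, minkowski]
  · rw [LinearEquiv.trans_apply, ← map_add, hR.W_iff, hL.W_iff]

theorem radarized_ev (k h : B) (hk : I.radarized.iob k) (hh : I.radarized.iob h)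
    (x : Fin 4 → Q) : ∃ y, I.radarized.SameEv k h x y := by
  obtain ⟨e, he⟩ := hI.ether
  obtain ⟨M, b, -, hM⟩ := hI.exists_chart hc he hk.1
  obtain ⟨M', b', -, hM'⟩ := hI.exists_chart hc he hh.1
  obtain ⟨a, rfl⟩ := exists_affine_eq M b x
  exact ⟨M' a + b', fun o => (hM o a).trans (hM' o a).symm⟩

theorem radarized_self (k : B) (hk : I.radarized.iob k) (y : Fin 4 → Q) :
    I.radarized.W k k y ↔ y 1 = 0 ∧ y 2 = 0 ∧ y 3 = 0 := by
  obtain ⟨v, R, hR⟩ := hI.exists_isRadarization hc hk.1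
  obtain ⟨l, hl, hl', -⟩ := exists_factor hR.lt
  -- On the time axis radarization only rescales the clock, by the contraction factor `l`.
  have key : ∀ x : Fin 4 → Q, x 1 = 0 ∧ x 2 = 0 ∧ x 3 = 0 → R x = (l * x 0) • timeUnit := by
    rintro x ⟨h₁, h₂, h₃⟩
    rw [hR.eq]
    apply ext_four <;> simp [radMap, sprod, h₁, h₂, h₃, hl']
  constructor
  · intro h
    obtain ⟨x, rfl⟩ := R.surjective y
    rw [hR.W_iff, hI.self k hk.1] at h
    rw [key x h]
    simp
  · rintro ⟨h₁, h₂, h₃⟩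
    have : y = R ((y 0 / l) • timeUnit) := by
      rw [key _ (by simp)]
      apply ext_four <;> simp [h₁, h₂, h₃, mul_div_cancel₀ _ hl.ne']
    rw [this, hR.W_iff, hI.self k hk.1]
    simp

/-- An event has only one point in the coordinates of the ether, which therefore parametrizes the
coordinates of both observers. -/
theorem exists_of_sameEv {e k h : B} (he : I.Ether e) {M M' : (Fin 4 → Q) ≃ₗ[Q] Fin 4 → Q}
    {b b' x y : Fin 4 → Q} (hM : ∀ o x, I.radarized.W k o (M x + b) ↔ I.W e o x)
    (hM' : ∀ o x, I.radarized.W h o (M' x + b') ↔ I.W e o x)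
    (hxy : I.radarized.SameEv k h x y) : ∃ a, M a + b = x ∧ M' a + b' = y := by
  obtain ⟨a, rfl⟩ := exists_affine_eq M b x
  obtain ⟨a', rfl⟩ := exists_affine_eq M' b' y
  refine ⟨a, rfl, ?_⟩
  have : a' = a := hI.eq_of_sameEv he.1 fun o =>
    ((hM' o a').symm.trans (hxy o).symm).trans (hM o a)
  rw [this]

theorem radarized_symD (k h : B) (hk : I.radarized.iob k) (hh : I.radarized.iob h)
    (x y x' y' : Fin 4 → Q) (hxy : x 0 = y 0) (hxy' : x' 0 = y' 0)
    (hx : I.radarized.SameEv k h x x') (hy : I.radarized.SameEv k h y y') :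
    sdist x y = sdist x' y' := by
  obtain ⟨e, he⟩ := hI.ether
  obtain ⟨M, b, hη, hM⟩ := hI.exists_chart hc he hk.1
  obtain ⟨M', b', hη', hM'⟩ := hI.exists_chart hc he hh.1
  obtain ⟨p, rfl, rfl⟩ := hI.exists_of_sameEv hc he hM hM' hx
  obtain ⟨q, rfl, rfl⟩ := hI.exists_of_sameEv hc he hM hM' hy
  have e₁ := hη (q - p)
  have e₂ := hη' (q - p)
  have h₁ : (M (q - p)) 0 = 0 := by
    rw [map_sub, ← add_sub_add_right_eq_sub _ _ b, Pi.sub_apply, hxy, sub_self]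
  have h₂ : (M' (q - p)) 0 = 0 := by
    rw [map_sub, ← add_sub_add_right_eq_sub _ _ b', Pi.sub_apply, hxy', sub_self]
  -- For vectors without time component the invariant form is the squared spatial length.
  simp only [minkowski, h₁, h₂, mul_zero, sub_zero] at e₁ e₂
  rw [sdist, sdist, sdist2_eq, sdist2_eq, add_sub_add_right_eq_sub, add_sub_add_right_eq_sub,
    ← map_sub, ← map_sub, e₁, e₂]

theorem radarized_line (k h : B) (hk : I.radarized.iob k) (hh : I.radarized.iob h)
    (x y z : Fin 4 → Q) (hx : I.radarized.W k h x) (hy : I.radarized.W k h y)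
    (hz : I.radarized.W k h z) :
    ∃ a : Q, (∀ i, z i - x i = a * (y i - x i)) ∨ ∀ i, y i - z i = a * (z i - x i) := by
  obtain ⟨v, R, hR⟩ := hI.exists_isRadarization hc hk.1
  obtain ⟨x, rfl⟩ := R.surjective x
  obtain ⟨y, rfl⟩ := R.surjective y
  obtain ⟨z, rfl⟩ := R.surjective z
  rw [hR.W_iff] at hx hy hz
  have key : ∀ (a : Q) (p q r s : Fin 4 → Q), (∀ i, p i - q i = a * (r i - s i)) →
      ∀ i, R p i - R q i = a * (R r i - R s i) := by
    intro a p q r s h i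
    have : p - q = a • (r - s) := funext h
    have := congrFun (congrArg R this) i
    simpa [map_sub, map_smul] using this
  obtain ⟨a, ha | ha⟩ := hI.line k h hk.1 hh.1 x y z hx hy hz
  · exact ⟨a, .inl (key _ _ _ _ _ ha)⟩
  · exact ⟨a, .inr (key _ _ _ _ _ ha)⟩

theorem radarized_noAcc (k b : B) (x : Fin 4 → Q) (h : I.radarized.W k b x) :
    I.radarized.iob k := by
  obtain ⟨e, he⟩ := hI.ether
  obtain ⟨_, _, _, _, hW⟩ := h e he
  exact (hI.iob_radarized hc k).2 (hI.noAcc _ _ _ hW)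

theorem radarized_lightSpeedIs {k : B} (hk : I.iob k) : I.radarized.LightSpeedIs k c := by
  intro x y
  obtain ⟨e, he⟩ := hI.ether
  obtain ⟨M, b, hη, hM⟩ := hI.exists_chart hc he hk
  obtain ⟨p, rfl⟩ := exists_affine_eq M b x
  obtain ⟨q, rfl⟩ := exists_affine_eq M b y
  simp only [hM]
  refine (hc.light e he p q).trans ?_
  rw [sdist_eq_iff hc.pos, sdist_eq_iff hc.pos, add_sub_add_right_eq_sub, ← map_sub, hη]

theorem radarized_isLightSpeed_iff (c' : Q) : I.radarized.IsLightSpeed c' ↔ c' = c := by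
  constructor
  · rintro ⟨hc', h⟩
    obtain ⟨e, he⟩ := hI.ether
    -- This vector is lightlike for `c`, so it tests whether `c'` has the same square.
    have h₁ := h e ((hI.iob_radarized hc e).2 he.1) 0 ![1, c, 0, 0]
    have h₂ := hI.radarized_lightSpeedIs hc he.1 0 ![1, c, 0, 0]
    have h₃ := h₁.symm.trans h₂
    rw [sdist_eq_iff hc.pos, sdist_eq_iff hc'] at h₃
    have := h₃.2 (by simp [minkowski, snorm])
    simp only [minkowski, snorm, Pi.sub_apply, Matrix.cons_val, Pi.zero_apply] at this
    exact (mul_self_inj hc'.le hc.pos.le).1 (by linear_combination -this)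
  · rintro rfl
    exact ⟨hc.pos, fun k hk => hI.radarized_lightSpeedIs hc hk.1⟩

theorem radarized_thExp (k : B) (hk : I.radarized.iob k) (x y : Fin 4 → Q)
    (h : ∃ c', I.radarized.IsLightSpeed c' ∧ sdist x y < c' * |x 0 - y 0|) :
    ∃ h, I.radarized.iob h ∧ I.radarized.W k h x ∧ I.radarized.W k h y := by
  obtain ⟨c', hc', h⟩ := h
  obtain rfl := (hI.radarized_isLightSpeed_iff hc c').1 hc'
  obtain ⟨e, he⟩ := hI.ether
  obtain ⟨M, b, hη, hM⟩ := hI.exists_chart hc he hk.1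
  obtain ⟨p, rfl⟩ := exists_affine_eq M b x
  obtain ⟨q, rfl⟩ := exists_affine_eq M b y
  rw [sdist_lt_iff hc.pos, add_sub_add_right_eq_sub, ← map_sub, hη, ← sdist_lt_iff hc.pos] at h
  obtain ⟨o, ho, hp, hq⟩ := hI.thExp e he p q ⟨_, (hc.iff _).2 rfl, h⟩
  exact ⟨o, (hI.iob_radarized hc o).2 ho, (hM _ _).2 hp, (hM _ _).2 hq⟩

end Frame.IsClassicalKin

end Radarized
end

noncomputable section

/-! ### Trivial transformations and radarization -/

section Triv

variable {Q : Type} [Field Q] [LinearOrder Q] [IsEuclideanField Q]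

theorem affineMap_eq (r : Fin 4 → Fin 4 → Q) (b x : Fin 4 → Q) :
    affineMap r b x = affineMap r 0 x + b := by
  funext i; simp [affineMap]

theorem affineMap_sub (r : Fin 4 → Fin 4 → Q) (b x y : Fin 4 → Q) :
    affineMap r b x - affineMap r b y = affineMap r 0 (x - y) := by
  funext i; simp only [affineMap, Pi.sub_apply, Pi.zero_apply]; ring

theorem affineMap_zero_add (r : Fin 4 → Fin 4 → Q) (x y : Fin 4 → Q) :
    affineMap r 0 (x + y) = affineMap r 0 x + affineMap r 0 y := by
  have := affineMap_zero_add_smul r x y 1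
  rwa [one_smul, one_smul] at this

theorem affineMap_zero_smul (r : Fin 4 → Fin 4 → Q) (x : Fin 4 → Q) (t : Q) :
    affineMap r 0 (t • x) = t • affineMap r 0 x := by
  funext i; simp only [affineMap, Pi.smul_apply, Pi.zero_apply, smul_eq_mul]; ring

/-- Every linear map is given by a matrix. -/
theorem exists_affineMap_eq (L : (Fin 4 → Q) ≃ₗ[Q] Fin 4 → Q) (b : Fin 4 → Q) :
    ∃ r, ∀ x, affineMap r b x = L x + b := by
  refine ⟨fun i j => L (Pi.single j 1) i, fun x => ?_⟩
  have hx : x = x 0 • Pi.single 0 1 + x 1 • Pi.single 1 1 + x 2 • Pi.single 2 1 +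
      x 3 • Pi.single 3 1 := by
    apply ext_four <;> simp
  conv_rhs => rw [hx]
  funext i
  simp only [affineMap, map_add, map_smul, Pi.add_apply, Pi.smul_apply, smul_eq_mul]
  ring

/-- Triviality concerns the linear part alone, so the translation vector can be exchanged freely. -/
theorem isTriv_iff (r : Fin 4 → Fin 4 → Q) (b : Fin 4 → Q) : IsTriv r b ↔
    ∀ d, affineMap r 0 d 0 = d 0 ∧ snorm (affineMap r 0 d) = snorm d := by
  have key : ∀ x y, (affineMap r b x 0 - affineMap r b y 0 = x 0 - y 0 ∧
      sdist (affineMap r b x) (affineMap r b y) = sdist x y) ↔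
      affineMap r 0 (x - y) 0 = (x - y) 0 ∧ snorm (affineMap r 0 (y - x)) = snorm (y - x) := by
    intro x y
    rw [← Pi.sub_apply, affineMap_sub, sdist, sdist,
      sqrt_inj (sdist2_nonneg _ _) (sdist2_nonneg _ _), sdist2_eq, sdist2_eq, affineMap_sub,
      Pi.sub_apply]
  constructor
  · intro h d
    have h₁ := ((key d 0).1 (h d 0)).1
    have h₂ := ((key 0 d).1 (h 0 d)).2
    rw [sub_zero] at h₁ h₂
    exact ⟨h₁, h₂⟩
  · intro h x y
    exact (key x y).2 ⟨(h _).1, (h _).2⟩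

theorem isTrivUpToReversal_iff (r : Fin 4 → Fin 4 → Q) (b : Fin 4 → Q) :
    IsTrivUpToReversal r b ↔ ∀ d, affineMap r 0 d 0 * affineMap r 0 d 0 = d 0 * d 0 ∧
      snorm (affineMap r 0 d) = snorm d := by
  have key : ∀ x y, (|affineMap r b x 0 - affineMap r b y 0| = |x 0 - y 0| ∧
      sdist (affineMap r b x) (affineMap r b y) = sdist x y) ↔
      affineMap r 0 (x - y) 0 * affineMap r 0 (x - y) 0 = (x - y) 0 * (x - y) 0 ∧
        snorm (affineMap r 0 (y - x)) = snorm (y - x) := by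
    intro x y
    rw [← Pi.sub_apply, affineMap_sub, sdist, sdist,
      sqrt_inj (sdist2_nonneg _ _) (sdist2_nonneg _ _), sdist2_eq, sdist2_eq, affineMap_sub,
      ← mul_self_inj (abs_nonneg _) (abs_nonneg _), abs_mul_abs_self, abs_mul_abs_self,
      Pi.sub_apply]
  constructor
  · intro h d
    have h₁ := ((key d 0).1 (h d 0)).1
    have h₂ := ((key 0 d).1 (h 0 d)).2
    rw [sub_zero] at h₁ h₂
    exact ⟨h₁, h₂⟩
  · intro h x y
    exact (key x y).2 ⟨(h _).1, (h _).2⟩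

/-- Spatial isometries commute with radarization. -/
theorem radMap_affineMap {r : Fin 4 → Fin 4 → Q} {b : Fin 4 → Q} (hr : IsTriv r b)
    (v : Fin 3 → Q) : ∃ w, norm2 w = norm2 v ∧ affineMap r 0 timeUnit = timeUnit ∧
      affineMap r 0 (spatial v) = spatial w ∧
      ∀ c x, radMap c w (affineMap r 0 x) = affineMap r 0 (radMap c v x) := by
  rw [isTriv_iff] at hr
  have ht : affineMap r 0 timeUnit = timeUnit := by
    obtain ⟨h₀, h₁⟩ := hr timeUnit
    obtain ⟨e₁, e₂, e₃⟩ := eq_zero_of_add_mul_self (h₁.trans (by simp [snorm]))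
    exact ext_four h₀ e₁ e₂ e₃
  set s := affineMap r 0 (spatial v) with hs
  have hw : s = spatial ![s 1, s 2, s 3] := by
    refine ext_four ?_ rfl rfl rfl
    rw [hs, (hr _).1]; rfl
  have hn : norm2 ![s 1, s 2, s 3] = norm2 v := (hr (spatial v)).2
  -- Polarization: a map preserving spatial lengths preserves inner products.
  have hp : ∀ x, sprod ![s 1, s 2, s 3] (affineMap r 0 x) = sprod v x := by
    intro x
    have h₁ := (hr (spatial v + x)).2
    have h₂ := (hr (spatial v)).2
    have h₃ := (hr x).2
    rw [affineMap_zero_add, ← hs] at h₁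
    rw [← hs] at h₂
    simp only [snorm, Pi.add_apply, spatial, Matrix.cons_val] at h₁ h₂ h₃
    simp only [sprod, Matrix.cons_val]
    linear_combination (h₁ - h₂ - h₃) / 2
  refine ⟨![s 1, s 2, s 3], hn, ht, hw, fun c x => ?_⟩
  rw [radMap_eq, radMap_eq c v x, affineMap_zero_add_smul, affineMap_zero_add_smul, hn, hp, ← hs,
    ht, (hr x).1, ← hw]

end Triv

/-! ### AxTriv and the primitive ether in the radarized structure -/

section Radarized

variable {B Q : Type} [Field Q] [LinearOrder Q] [IsEuclideanField Q] {I : Frame Empty B Q} {c : Q}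

/-- The direction of the worldline of `e` for `k`. -/
theorem Frame.IsGalilean.map_timeUnit {e k : B} {L : (Fin 4 → Q) ≃ₗ[Q] Fin 4 → Q}
    {b : Fin 4 → Q} {v : Fin 3 → Q} (h : I.IsGalilean e k L b v) :
    ∃ t : Q, t ≠ 0 ∧ L timeUnit = t • (timeUnit + spatial v) := by
  obtain ⟨h₁, h₂, h₃⟩ := driftNorm_eq_zero ((h.drift timeUnit).trans (by simp [snorm]))
  refine ⟨L timeUnit 0, fun h' => ?_, ?_⟩
  · have := h.time timeUnit
    simp [h'] at this
  · apply ext_four <;> simp [spatial, h₁, h₂, h₃, mul_comm, Matrix.vecHead, Matrix.vecTail]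

theorem spatial_injective : Function.Injective (spatial : (Fin 3 → Q) → Fin 4 → Q) := by
  intro v w h
  funext i
  fin_cases i
  exacts [congrFun h 1, congrFun h 2, congrFun h 3]

namespace Frame.IsClassicalKin

variable (hI : I.IsClassicalKin) (hc : I.IsSpeedOfLight c)
include hI hc

/-- The observer comes from the classical AxTriv with the same linear part and with the translation
pulled back by the radarization `S` for the rotated velocity `w`. That the new observer really sees
the ether move with `w` follows by comparing the images of the time unit. -/
theorem radarized_triv (r : Fin 4 → Fin 4 → Q) (b : Fin 4 → Q) (hr : IsTriv r b) (k : B)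
    (hk : I.radarized.iob k) : ∃ k', I.radarized.iob k' ∧
      ∀ x y, I.radarized.SameEv k k' x y ↔ affineMap r b x = y := by
  obtain ⟨e, he⟩ := hI.ether
  obtain ⟨v, R, hR⟩ := hI.exists_isRadarization hc hk.1
  obtain ⟨L, a, hL⟩ := hR.galilean e he
  obtain ⟨w, hn, ht, hs, hw⟩ := radMap_affineMap hr v
  obtain ⟨S, hS⟩ := exists_radEquiv (v := w) (c := c) (by rw [hn]; exact hR.lt)
  have hr₀ : IsTriv r (S.symm b) := (isTriv_iff r _).2 ((isTriv_iff r b).1 hr)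
  obtain ⟨k', hk', hkk'⟩ := hI.triv r (S.symm b) hr₀ k hk.1
  obtain ⟨v', R', hR'⟩ := hI.exists_isRadarization hc hk'
  obtain ⟨L', a', hL'⟩ := hR'.galilean e he
  have hcomp : ∀ x, affineMap r (S.symm b) (L x + a) = L' x + a' := fun x =>
    (hkk' _ _).1 (((hL.sameEv _ _).2 rfl).symm.trans ((hL'.sameEv _ _).2 rfl))
  have hlin : affineMap r 0 (L timeUnit) = L' timeUnit := by
    have := affineMap_sub r (S.symm b) (L timeUnit + a) (L 0 + a)
    rw [hcomp, hcomp] at this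
    simpa using this.symm
  obtain ⟨t, ht₀, hLt⟩ := hL.map_timeUnit
  obtain ⟨t', ht'₀, hLt'⟩ := hL'.map_timeUnit
  have hv' : v' = w := by
    rw [hLt, hLt', affineMap_zero_smul, affineMap_zero_add, ht, hs] at hlin
    -- Both directions are normalized to time component `1`, so the scalars agree and then the
    -- velocities.
    have h₀ : t = t' := by simpa [spatial, Matrix.vecHead] using congrFun hlin 0
    subst h₀
    exact (spatial_injective (add_left_cancel (smul_right_injective _ ht₀ hlin))).symm
  subst hv'
  refine ⟨k', (hI.iob_radarized hc k').2 hk', fun x y => ?_⟩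
  obtain ⟨x, rfl⟩ := R.surjective x
  obtain ⟨y, rfl⟩ := R'.surjective y
  rw [radarized_sameEv hR hR', hkk', affineMap_eq, affineMap_eq r b, hR.eq, ← hw, ← hR'.eq]
  have hb : R' (S.symm b) = b := by
    rw [hR'.eq, ← hS, S.apply_symm_apply]
  rw [← R'.injective.eq_iff, map_add, hb]

/-- Any ether observer can be the witness, its own radarization being the identity. A transformation
to `k` that is trivial up to reversal forces `v = 0`, and then the light cone of the ether is a
light cone for `k`. Conversely `v = 0` for an ether observer, and the Galilean map itself is trivial
up to reversal. -/
theorem radarized_ether : ∃ e, I.radarized.iob e ∧ ∀ k, (I.radarized.iob k ∧ ∃ r b,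
    IsTrivUpToReversal r b ∧ ∀ x y, I.radarized.SameEv e k x y ↔ affineMap r b x = y) ↔
      I.radarized.ext .E k := by
  obtain ⟨e, he⟩ := hI.ether
  refine ⟨e, (hI.iob_radarized hc e).2 he.1, fun k => ?_⟩
  change _ ↔ I.Ether k
  obtain ⟨v₀, R₀, hR₀⟩ := hI.exists_isRadarization hc he.1
  obtain ⟨L₀, a₀, hL₀⟩ := hR₀.galilean e he
  obtain rfl := hL₀.eq_zero_of_ether hc he he
  have hid₀ : ∀ x, R₀ x = x := fun x => by rw [hR₀.eq, radMap_zero]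
  constructor
  · rintro ⟨hk, r, b, hr, hrb⟩
    rw [isTrivUpToReversal_iff] at hr
    obtain ⟨v, R, hR⟩ := hI.exists_isRadarization hc hk.1
    obtain ⟨L, a, hL⟩ := hR.galilean e he
    have hcomp : ∀ x, affineMap r b x = R (L x + a) := fun x => by
      rw [← hrb]
      conv => arg 4; rw [← hid₀ x]
      exact (radarized_sameEv hR₀ hR _ _).2 ((hL.sameEv _ _).2 rfl)
    have hlin : ∀ d, affineMap r 0 d = R (L d) := fun d => by
      have := affineMap_sub r b d 0
      rw [hcomp, hcomp] at this
      simpa using this.symm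
    obtain ⟨t, ht₀, hLt⟩ := hL.map_timeUnit
    have hv : v = 0 := by
      have h₁ := (hr timeUnit).2
      rw [hlin, hLt, map_smul, hR.eq] at h₁
      obtain ⟨k, hk, hk', -⟩ := exists_factor hR.lt
      have hcp := hc.pos
      obtain ⟨e₁, e₂, e₃⟩ := eq_zero_of_add_mul_self (h₁.trans (by simp [snorm]))
      -- The radarized direction of the ether has spatial part `v` times this positive factor, and
      -- triviality makes that spatial part vanish.
      have hp : 0 < 1 + sprod v (timeUnit + spatial v) / (c * c * k * (1 + k)) := by
        have : sprod v (timeUnit + spatial v) = norm2 v := by simp [sprod, spatial, norm2]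
        have := norm2_nonneg v
        rw [‹sprod v (timeUnit + spatial v) = _›]
        positivity
      simp only [radMap, hk', Pi.smul_apply, Pi.add_apply, smul_eq_mul, Matrix.cons_val,
        mul_eq_zero, ht₀, false_or, timeUnit_one, timeUnit_two, timeUnit_three, zero_add] at e₁ e₂ e₃
      generalize sprod v (timeUnit + spatial v) / (c * c * k * (1 + k)) = q at *
      simp only [spatial, Matrix.cons_val] at e₁ e₂ e₃
      have : ∀ z : Q, z + q * z = 0 → z = 0 := fun z hz =>
        (mul_eq_zero.1 (show (1 + q) * z = 0 by linear_combination hz)).resolve_left hp.ne'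
      funext i
      fin_cases i
      exacts [this _ e₁, this _ e₂, this _ e₃]
    subst hv
    refine ⟨hk.1, c, hc.pos, fun x y => ?_⟩
    obtain ⟨p, rfl⟩ := exists_affine_eq L a x
    obtain ⟨q, rfl⟩ := exists_affine_eq L a y
    simp only [hL.W_iff]
    refine (hc.light e he p q).trans ?_
    rw [sdist_eq_iff hc.pos, sdist_eq_iff hc.pos, add_sub_add_right_eq_sub, ← map_sub, minkowski,
      minkowski, hL.time, ← hL.drift]
    simp [driftNorm, snorm]
  · intro hk
    refine ⟨(hI.iob_radarized hc k).2 hk.1, ?_⟩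
    obtain ⟨v, R, hR⟩ := hI.exists_isRadarization hc hk.1
    obtain ⟨L, a, hL⟩ := hR.galilean e he
    obtain rfl := hL.eq_zero_of_ether hc he hk
    have hid : ∀ x, R x = x := fun x => by rw [hR.eq, radMap_zero]
    obtain ⟨r, hr⟩ := exists_affineMap_eq L a
    have hr₀ : ∀ d, affineMap r 0 d = L d := fun d => by
      rw [← add_left_inj a, ← affineMap_eq, hr]
    refine ⟨r, a, (isTrivUpToReversal_iff r a).2 fun d => ?_, fun x y => ?_⟩
    · rw [hr₀, hL.time, ← hL.drift d]
      simp [driftNorm, snorm]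
    · rw [hr, ← hL.sameEv]
      have := radarized_sameEv hR₀ hR x y
      rwa [hid₀, hid] at this

end Frame.IsClassicalKin

end Radarized
end

/-! ## Free variables of the translation -/

theorem QTerm.VarsBelow.subst {m m' : ℕ} {σ : ℕ → QTerm} (hσ : ∀ i < m, (σ i).VarsBelow m')
    {t : QTerm} (ht : t.VarsBelow m) : (t.subst σ).VarsBelow m' := by
  induction t with
  | var n => exact hσ n ht
  | add s t hs ht' => exact ⟨hs ht.1, ht' ht.2⟩
  | mul s t hs ht' => exact ⟨hs ht.1, ht' ht.2⟩

section FreeBelow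

variable {ε : Type} {n m : ℕ}

theorem Formula.FreeBelow.subst {n' m' : ℕ} {φ : Formula ε} (h : φ.FreeBelow n m) {ρ : ℕ → ℕ}
    {σ : ℕ → QTerm} (hρ : ∀ i < n, ρ i < n') (hσ : ∀ i < m, (σ i).VarsBelow m') :
    (φ.subst ρ σ).FreeBelow n' m' := by
  induction φ generalizing n n' m m' ρ σ with
  | falsum => trivial
  | imp φ ψ hφ hψ => exact ⟨hφ h.1 hρ hσ, hψ h.2 hρ hσ⟩
  | allB φ ih =>
    refine ih h (fun i hi => ?_) hσ
    cases i with
    | zero => exact Nat.succ_pos _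
    | succ i => exact Nat.succ_lt_succ (hρ i (Nat.lt_of_succ_lt_succ hi))
  | allQ φ ih =>
    refine ih h hρ fun i hi => ?_
    cases i with
    | zero => exact Nat.succ_pos _
    | succ i =>
      exact QTerm.VarsBelow.subst (σ := fun j => .var (j + 1)) (fun j hj => Nat.succ_lt_succ hj)
        (hσ i (Nat.lt_of_succ_lt_succ hi))
  | eqB a b => exact ⟨hρ _ h.1, hρ _ h.2⟩
  | eqQ s t => exact ⟨h.1.subst hσ, h.2.subst hσ⟩
  | le s t => exact ⟨h.1.subst hσ, h.2.subst hσ⟩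
  | iob k => exact hρ _ h
  | ph p => exact hρ _ h
  | ext R b => exact hρ _ h
  | W k b x => exact ⟨hρ _ h.1, hρ _ h.2.1, fun i => (h.2.2 i).subst hσ⟩

@[simp] theorem freeBelow_neg (φ : Formula ε) : (∼φ).FreeBelow n m ↔ φ.FreeBelow n m :=
  and_iff_left trivial

@[simp] theorem freeBelow_imp (φ ψ : Formula ε) :
    (φ ⤇ ψ).FreeBelow n m ↔ φ.FreeBelow n m ∧ ψ.FreeBelow n m := Iff.rfl

@[simp] theorem freeBelow_and (φ ψ : Formula ε) :
    (φ ⩓ ψ).FreeBelow n m ↔ φ.FreeBelow n m ∧ ψ.FreeBelow n m := by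
  simp [Formula.and]

@[simp] theorem freeBelow_or (φ ψ : Formula ε) :
    (φ ⩔ ψ).FreeBelow n m ↔ φ.FreeBelow n m ∧ ψ.FreeBelow n m := by
  simp [Formula.or]

@[simp] theorem freeBelow_iff (φ ψ : Formula ε) :
    (φ ⬄ ψ).FreeBelow n m ↔ φ.FreeBelow n m ∧ ψ.FreeBelow n m := by
  simp [Formula.iff, and_comm]

@[simp] theorem freeBelow_allB (φ : Formula ε) : φ.allB.FreeBelow n m ↔ φ.FreeBelow (n + 1) m :=
  Iff.rfl

@[simp] theorem freeBelow_exB (φ : Formula ε) : φ.exB.FreeBelow n m ↔ φ.FreeBelow (n + 1) m := by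
  simp [Formula.exB]

@[simp] theorem freeBelow_allQ (φ : Formula ε) : φ.allQ.FreeBelow n m ↔ φ.FreeBelow n (m + 1) :=
  Iff.rfl

@[simp] theorem freeBelow_exQ (φ : Formula ε) : φ.exQ.FreeBelow n m ↔ φ.FreeBelow n (m + 1) := by
  simp [Formula.exQ]

@[simp] theorem freeBelow_allQs (k : ℕ) (φ : Formula ε) :
    (φ.allQs k).FreeBelow n m ↔ φ.FreeBelow n (m + k) := by
  induction k generalizing m with
  | zero => rfl
  | succ k ih => rw [Formula.allQs, freeBelow_allQ, ih, Nat.add_right_comm, Nat.add_assoc]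

@[simp] theorem freeBelow_exQs (k : ℕ) (φ : Formula ε) :
    (φ.exQs k).FreeBelow n m ↔ φ.FreeBelow n (m + k) := by
  induction k generalizing m with
  | zero => rfl
  | succ k ih => rw [Formula.exQs, freeBelow_exQ, ih, Nat.add_right_comm, Nat.add_assoc]

/-- All variables of the term are `< m`. -/
def PTerm.VarsBelow (m : ℕ) : PTerm → Prop
  | .var n => n < m
  | .zero => True
  | .one => True
  | .add s t => s.VarsBelow m ∧ t.VarsBelow m
  | .sub s t => s.VarsBelow m ∧ t.VarsBelow m
  | .mul s t => s.VarsBelow m ∧ t.VarsBelow m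
  | .div s t => s.VarsBelow m ∧ t.VarsBelow m
  | .sqrt t => t.VarsBelow m
  | .abs t => t.VarsBelow m

theorem freeBelow_moveTo {φ : Formula ε} (h : φ.FreeBelow n (m + 1)) {i j p : ℕ} (hi : i < p)
    (hj : m + j ≤ p) : (moveTo i j φ).FreeBelow n p := by
  refine h.subst (fun _ h => h) fun a ha => ?_
  cases a with
  | zero => exact hi
  | succ a => exact (Nat.add_lt_add_right (Nat.lt_of_succ_lt_succ ha) j).trans_le hj

theorem PTerm.VarsBelow.graph {t : PTerm} (h : t.VarsBelow m) :
    (t.graph : Formula ε).FreeBelow n (m + 1) := by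
  induction t with
  | var k => exact ⟨Nat.succ_pos _, Nat.succ_lt_succ h⟩
  | zero => simp [PTerm.graph, isZero, Formula.FreeBelow, QTerm.VarsBelow]
  | one => simp [PTerm.graph, isOne, isZero, Formula.FreeBelow, QTerm.VarsBelow]
  | add a b ha hb | sub a b ha hb | mul a b ha hb | div a b ha hb =>
    simp [PTerm.graph, isZero, Formula.FreeBelow, QTerm.VarsBelow,
      freeBelow_moveTo (j := 3) (p := m + 1 + 2) (ha h.1),
      freeBelow_moveTo (j := 3) (p := m + 1 + 2) (hb h.2)]
  | sqrt a ha | abs a ha =>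
    simp [PTerm.graph, isNonneg, isZero, Formula.FreeBelow, QTerm.VarsBelow,
      freeBelow_moveTo (j := 2) (p := m + 1 + 1) (ha h)]

theorem freeBelow_eqP {s t : PTerm} (hs : s.VarsBelow m) (ht : t.VarsBelow m) :
    (eqP s t : Formula ε).FreeBelow n m := by
  simp [eqP, hs.graph, ht.graph]

theorem freeBelow_ltP {s t : PTerm} (hs : s.VarsBelow m) (ht : t.VarsBelow m) :
    (ltP s t : Formula ε).FreeBelow n m := by
  simp [ltP, Formula.FreeBelow, QTerm.VarsBelow,
    freeBelow_moveTo (j := 2) (p := m + 2) hs.graph,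
    freeBelow_moveTo (j := 2) (p := m + 2) ht.graph]

theorem freeBelow_eqPt {x y : Point} (hx : ∀ i, (x i).VarsBelow m) (hy : ∀ i, (y i).VarsBelow m) :
    (eqPt x y : Formula ε).FreeBelow n m := by
  simp [eqPt, freeBelow_eqP, hx, hy]

theorem varsBelow_pt {o : ℕ} (h : o + 4 ≤ m) (i : Fin 4) : (pt o i).VarsBelow m :=
  show o + i < m by omega

theorem PTerm.VarsBelow.add {s t : PTerm} (hs : s.VarsBelow m) (ht : t.VarsBelow m) :
    (s + t).VarsBelow m := ⟨hs, ht⟩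

theorem PTerm.VarsBelow.sub {s t : PTerm} (hs : s.VarsBelow m) (ht : t.VarsBelow m) :
    (s - t).VarsBelow m := ⟨hs, ht⟩

theorem PTerm.VarsBelow.neg {s : PTerm} (hs : s.VarsBelow m) : (-s).VarsBelow m := ⟨trivial, hs⟩

theorem PTerm.VarsBelow.mul {s t : PTerm} (hs : s.VarsBelow m) (ht : t.VarsBelow m) :
    (s * t).VarsBelow m := ⟨hs, ht⟩

theorem PTerm.VarsBelow.div {s t : PTerm} (hs : s.VarsBelow m) (ht : t.VarsBelow m) :
    (s / t).VarsBelow m := ⟨hs, ht⟩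

theorem varsBelow_space {x y : Point} (hx : ∀ i, (x i).VarsBelow m) (hy : ∀ i, (y i).VarsBelow m) :
    (space x y).VarsBelow m :=
  .add (.add (.mul (.sub (hx 1) (hy 1)) (.sub (hx 1) (hy 1)))
    (.mul (.sub (hx 2) (hy 2)) (.sub (hx 2) (hy 2)))) (.mul (.sub (hx 3) (hy 3)) (.sub (hx 3) (hy 3)))

theorem varsBelow_time {x y : Point} (hx : ∀ i, (x i).VarsBelow m) (hy : ∀ i, (y i).VarsBelow m) :
    (time x y).VarsBelow m :=
  PTerm.VarsBelow.sub (hx 0) (hy 0)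

theorem varsBelow_vecNorm {v : ℕ} (h : v + 3 ≤ m) : (vecNorm v).VarsBelow m := by
  have key : ∀ j, j < v + 3 → (PTerm.var j * PTerm.var j).VarsBelow m := fun j hj =>
    .mul (show j < m by omega) (show j < m by omega)
  exact .add (.add (key _ (by omega)) (key _ (by omega))) (key _ (by omega))

theorem varsBelow_applyMatrix {M : Matrix (Fin 4) (Fin 4) PTerm} {x : Point}
    (hM : ∀ i j, (M i j).VarsBelow m) (hx : ∀ i, (x i).VarsBelow m) (i : Fin 4) :
    (applyMatrix M x i).VarsBelow m :=
  .add (.add (.add (.mul (hM i 0) (hx 0)) (.mul (hM i 1) (hx 1))) (.mul (hM i 2) (hx 2)))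
    (.mul (hM i 3) (hx 3))

theorem varsBelow_matrix {M : Matrix (Fin 4) (Fin 4) PTerm}
    (h₀ : (M 0 0).VarsBelow m ∧ (M 0 1).VarsBelow m ∧ (M 0 2).VarsBelow m ∧ (M 0 3).VarsBelow m)
    (h₁ : (M 1 0).VarsBelow m ∧ (M 1 1).VarsBelow m ∧ (M 1 2).VarsBelow m ∧ (M 1 3).VarsBelow m)
    (h₂ : (M 2 0).VarsBelow m ∧ (M 2 1).VarsBelow m ∧ (M 2 2).VarsBelow m ∧ (M 2 3).VarsBelow m)
    (h₃ : (M 3 0).VarsBelow m ∧ (M 3 1).VarsBelow m ∧ (M 3 2).VarsBelow m ∧ (M 3 3).VarsBelow m)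
    (i j : Fin 4) : (M i j).VarsBelow m := by
  fin_cases i <;> fin_cases j <;> simp_all

theorem varsBelow_rotationMatrix {v : ℕ} (h : v + 3 ≤ m) (i j : Fin 4) :
    (rotationMatrix v i j).VarsBelow m := by
  have h₀ : (PTerm.var v).VarsBelow m := show v < m by omega
  have h₁ : (PTerm.var (v + 1)).VarsBelow m := show v + 1 < m by omega
  have h₂ : (PTerm.var (v + 2)).VarsBelow m := show v + 2 < m by omega
  have hn : (vecNorm v).VarsBelow m := varsBelow_vecNorm h
  have hd : ((vecNorm v - .var v) / (.var (v + 1) * .var (v + 1) + .var (v + 2) * .var (v + 2))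
    : PTerm).VarsBelow m := .div (.sub hn h₀) (.add (.mul h₁ h₁) (.mul h₂ h₂))
  exact varsBelow_matrix (M := rotationMatrix v) (m := m) ⟨trivial, trivial, trivial, trivial⟩
    ⟨trivial, .div h₀.neg hn, .div h₁.neg hn, .div h₂.neg hn⟩
    ⟨trivial, .div h₁ hn, .div (.sub h₀.neg (.mul (.mul h₂ h₂) hd)) hn,
      .div (.mul (.mul h₁ h₂) hd) hn⟩
    ⟨trivial, .div h₂ hn, .div (.mul (.mul h₁ h₂) hd) hn,
      .div (.sub h₀.neg (.mul (.mul h₁ h₁) hd)) hn⟩ i j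

theorem freeBelow_rotationIs {v x y : ℕ} (hv : v + 3 ≤ m) (hx : x + 4 ≤ m) (hy : y + 4 ≤ m) :
    (rotationIs v (pt x) (pt y) : Formula ε).FreeBelow n m := by
  have h₀ : (PTerm.var v).VarsBelow m := show v < m by omega
  have h₁ : (eqP (.var (v + 1)) 0 : Formula ε).FreeBelow n m :=
    freeBelow_eqP (show v + 1 < m by omega) trivial
  have h₂ : (eqP (.var (v + 2)) 0 : Formula ε).FreeBelow n m :=
    freeBelow_eqP (show v + 2 < m by omega) trivial
  have h₃ : (ltP 0 (.var v) : Formula ε).FreeBelow n m := freeBelow_ltP trivial h₀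
  have hx' := varsBelow_pt hx
  have hy' := varsBelow_pt hy
  have h₄ : ∀ i, ((![pt x 0, -pt x 1, -pt x 2, -pt x 3] : Point) i).VarsBelow m := by
    intro i
    fin_cases i
    exacts [hx' 0, (hx' 1).neg, (hx' 2).neg, (hx' 3).neg]
  simp only [rotationIs, freeBelow_or, freeBelow_and, freeBelow_neg, h₁, h₂, h₃, true_and, and_true]
  exact ⟨freeBelow_eqPt (varsBelow_applyMatrix (varsBelow_rotationMatrix hv) hx') hy',
    freeBelow_eqPt hx' hy', freeBelow_eqPt h₄ hy'⟩

theorem varsBelow_coreMap {c s : PTerm} {x : Point} (hc : c.VarsBelow m) (hs : s.VarsBelow m)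
    (hx : ∀ i, (x i).VarsBelow m) (i : Fin 4) : (coreMap c s x i).VarsBelow m := by
  have hq : (1 - (s * s) / (c * c) : PTerm).VarsBelow m :=
    .sub trivial (.div (.mul hs hs) (.mul hc hc))
  have hS : (scaleFactor c s).VarsBelow m := hq
  refine .mul hS (varsBelow_applyMatrix (varsBelow_matrix ?_ ?_ ?_ ?_)
    (varsBelow_applyMatrix (varsBelow_matrix ?_ ?_ ?_ ?_) hx) i)
  · exact ⟨.div trivial hq, .div (.div hs.neg (.mul hc hc)) hq, trivial, trivial⟩
  · exact ⟨.div hs.neg hq, .div trivial hq, trivial, trivial⟩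
  · exact ⟨trivial, trivial, .div trivial hS, trivial⟩
  · exact ⟨trivial, trivial, trivial, .div trivial hS⟩
  · exact ⟨trivial, trivial, trivial, trivial⟩
  · exact ⟨hs, trivial, trivial, trivial⟩
  · exact ⟨trivial, trivial, trivial, trivial⟩
  · exact ⟨trivial, trivial, trivial, trivial⟩

theorem freeBelow_wl {k b x : ℕ} (hk : k < n) (hb : b < n) (hx : x + 4 ≤ m) :
    (wl k b x : Formula ε).FreeBelow n m :=
  ⟨hk, hb, varsBelow_pt hx⟩

theorem freeBelow_speedIs {k b v : ℕ} (hk : k < n) (hb : b < n) (hv : v < m) :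
    (speedIs k b v : Formula ε).FreeBelow n m := by
  have h₄ := varsBelow_pt (m := m + 8) (o := 4) (by omega)
  have h₀ := varsBelow_pt (m := m + 8) (o := 0) (by omega)
  have w₄ : (wl k b 4 : Formula ε).FreeBelow n (m + 8) := freeBelow_wl hk hb (by omega)
  have w₀ : (wl k b 0 : Formula ε).FreeBelow n (m + 8) := freeBelow_wl hk hb (by omega)
  simp only [speedIs, freeBelow_and, freeBelow_exQs, freeBelow_allQs, freeBelow_neg, freeBelow_imp,
    w₄, w₀, true_and]
  exact ⟨freeBelow_eqPt h₄ h₀, freeBelow_eqP (varsBelow_space h₄ h₀)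
    (.mul (show v + 8 < m + 8 by omega) (varsBelow_time h₄ h₀))⟩

theorem freeBelow_velocityIs {k b v : ℕ} (hk : k < n) (hb : b < n) (hv : v + 3 ≤ m) :
    (velocityIs k b v : Formula ε).FreeBelow n m := by
  have h₄ := varsBelow_pt (m := m + 8) (o := 4) (by omega)
  have h₀ := varsBelow_pt (m := m + 8) (o := 0) (by omega)
  have w₄ : (wl k b 4 : Formula ε).FreeBelow n (m + 8) := freeBelow_wl hk hb (by omega)
  have w₀ : (wl k b 0 : Formula ε).FreeBelow n (m + 8) := freeBelow_wl hk hb (by omega)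
  have key : ∀ i j, j < v + 11 → (eqP (pt 0 i - pt 4 i) (.var j * (pt 0 0 - pt 4 0)) :
      Formula ε).FreeBelow n (m + 8) := fun i j hj =>
    freeBelow_eqP (.sub (h₀ i) (h₄ i)) (.mul (show j < m + 8 by omega) (.sub (h₀ 0) (h₄ 0)))
  simp only [velocityIs, freeBelow_and, freeBelow_exQs, freeBelow_allQs, freeBelow_neg,
    freeBelow_imp, w₄, w₀, true_and]
  exact ⟨freeBelow_eqPt h₄ h₀, key _ _ (by omega), key _ _ (by omega), key _ _ (by omega)⟩

theorem freeBelow_lightSpeedIs {k c : ℕ} (hk : k < n) (hc : c < m) :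
    (lightSpeedIs k c : Formula ε).FreeBelow n m := by
  have h₄ := varsBelow_pt (m := m + 8) (o := 4) (by omega)
  have h₀ := varsBelow_pt (m := m + 8) (o := 0) (by omega)
  simp only [lightSpeedIs, freeBelow_allQs, freeBelow_iff, freeBelow_exB, freeBelow_and]
  exact ⟨⟨Nat.succ_pos n, freeBelow_wl (by omega) (by omega) (by omega),
    freeBelow_wl (by omega) (by omega) (by omega)⟩, freeBelow_eqP (varsBelow_space h₄ h₀)
    (.mul (show c + 8 < m + 8 by omega) (varsBelow_time h₄ h₀))⟩

theorem freeBelow_ether {e : ℕ} (he : e < n) : (ether e : Formula ε).FreeBelow n m := by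
  simp only [ether, freeBelow_and, freeBelow_exQ]
  exact ⟨he, freeBelow_ltP trivial (Nat.succ_pos m), freeBelow_lightSpeedIs he (Nat.succ_pos m)⟩

theorem freeBelow_isEtherLightSpeed {c : ℕ} (hc : c < m) :
    (isEtherLightSpeed c : Formula ε).FreeBelow n m := by
  simp only [isEtherLightSpeed, freeBelow_allB, freeBelow_imp]
  exact ⟨freeBelow_ether (by omega), Nat.succ_pos _, freeBelow_speedIs (by omega) (by omega) hc⟩

theorem freeBelow_slowerThanLight {e k : ℕ} (he : e < n) (hk : k < n) :
    (slowerThanLight e k : Formula ε).FreeBelow n m := by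
  simp only [slowerThanLight, freeBelow_exQs, freeBelow_and]
  exact ⟨freeBelow_speedIs he hk (by omega), freeBelow_isEtherLightSpeed (by omega),
    freeBelow_ltP (show 0 < m + 2 by omega) (show 1 < m + 2 by omega)⟩

theorem freeBelow_radIs {v x y : ℕ} (hv : v + 3 ≤ m) (hx : x + 4 ≤ m) (hy : y + 4 ≤ m) :
    (radIs v x y : Formula ε).FreeBelow n m := by
  simp only [radIs, freeBelow_exQ, freeBelow_and, freeBelow_exQs]
  exact ⟨freeBelow_isEtherLightSpeed (by omega),
    freeBelow_ltP (varsBelow_vecNorm (by omega)) (Nat.succ_pos m),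
    freeBelow_rotationIs (by omega) (by omega) (by omega),
    freeBelow_eqPt (varsBelow_coreMap (show 8 < m + 1 + 8 by omega) (varsBelow_vecNorm (by omega))
      (varsBelow_pt (by omega))) (varsBelow_pt (by omega)),
    freeBelow_rotationIs (by omega) (by omega) (by omega)⟩

theorem freeBelow_trIOb : (trIOb : Formula ε).FreeBelow 1 0 := by
  simp only [trIOb, freeBelow_and, freeBelow_allB, freeBelow_imp]
  exact ⟨Nat.one_pos, freeBelow_ether (by omega), freeBelow_slowerThanLight (by omega) (by omega)⟩

theorem freeBelow_trW : (trW : Formula ε).FreeBelow 2 4 := by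
  simp only [trW, freeBelow_and, freeBelow_allB, freeBelow_imp, freeBelow_exQs]
  exact ⟨freeBelow_ether (by omega), freeBelow_velocityIs (by omega) (by omega) (by omega),
    freeBelow_radIs (by omega) (by omega) (by omega),
    freeBelow_wl (by omega) (by omega) (by omega)⟩

/-! ## The translation -/

theorem PTerm.exists_varsBelow (t : PTerm) : ∃ m, t.VarsBelow m := by
  have mono : ∀ {m m' : ℕ}, m ≤ m' → ∀ {t : PTerm}, t.VarsBelow m → t.VarsBelow m' := by
    intro m m' h t ht
    induction t with
    | var n => exact lt_of_lt_of_le ht h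
    | zero | one => trivial
    | add a b ha hb | sub a b ha hb | mul a b ha hb | div a b ha hb => exact ⟨ha ht.1, hb ht.2⟩
    | sqrt a ha | abs a ha => exact ha ht
  induction t with
  | var n => exact ⟨n + 1, Nat.lt_succ_self n⟩
  | zero | one => exact ⟨0, trivial⟩
  | add a b ha hb | sub a b ha hb | mul a b ha hb | div a b ha hb =>
    obtain ⟨⟨k, hk⟩, l, hl⟩ := ha, hb
    exact ⟨max k l, mono (le_max_left k l) hk, mono (le_max_right k l) hl⟩
  | sqrt a ha | abs a ha => exact ha

theorem Formula.FreeBelow.subst_bodies {φ : Formula ε} (h : φ.FreeBelow 0 m) (ρ : ℕ → ℕ) :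
    φ.subst ρ .var = φ := by
  rw [h.subst_congr (ρ' := id) (σ' := .var) (fun i hi => absurd hi (Nat.not_lt_zero i))
    fun _ _ => rfl, Formula.subst_id]

theorem eqP_subst (s t : PTerm) (ρ : ℕ → ℕ) :
    (eqP s t : Formula ε).subst ρ .var = eqP s t := by
  obtain ⟨k, hk⟩ := (s + t).exists_varsBelow
  exact (freeBelow_eqP hk.1 hk.2).subst_bodies ρ

theorem ltP_subst (s t : PTerm) (ρ : ℕ → ℕ) :
    (ltP s t : Formula ε).subst ρ .var = ltP s t := by
  obtain ⟨k, hk⟩ := (s + t).exists_varsBelow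
  exact (freeBelow_ltP hk.1 hk.2).subst_bodies ρ

/-- A translation must use instances of one fixed formula, whereas `TrPlus` writes `ether b`
directly. The two agree because the subformulas about quantities contain no body variables. -/
theorem ether_app1 (b : ℕ) : (ether 0 : Formula ε).app1 b = ether b := by
  simp only [Formula.app1, ether, lightSpeedIs, wl, Formula.and, Formula.neg, Formula.iff,
    Formula.exQ, Formula.exB, Formula.allQs, Formula.subst, upQ_var, eqP_subst, ltP_subst,
    QTerm.subst_var, upB, scons]

end FreeBelow

theorem isTranslation_trPlus : IsTranslation TrPlus where
  falsum := rfl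
  imp _ _ := rfl
  allB _ := rfl
  allQ _ := rfl
  eqB _ _ := rfl
  eqQ _ _ := rfl
  le := ⟨.le (.var 0) (.var 1), by simp [Formula.FreeBelow, QTerm.VarsBelow], fun _ _ => rfl⟩
  iob := ⟨trIOb, freeBelow_trIOb, fun _ => rfl⟩
  ph := ⟨.ph 0, Nat.one_pos, fun _ => rfl⟩
  ext _ := ⟨ether 0, freeBelow_ether Nat.one_pos, fun b => (ether_app1 b).symm⟩
  W := ⟨trW, freeBelow_trW, fun _ _ _ => rfl⟩

theorem trPlus_embed (φ : Formula Empty) : TrPlus φ.embed = Tr φ := by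
  induction φ with
  | imp φ ψ hφ hψ => exact congrArg₂ Formula.imp hφ hψ
  | allB φ ih => exact congrArg Formula.allB ih
  | allQ φ ih => exact congrArg Formula.allQ ih
  | ext R _ => exact R.elim
  | _ => rfl

/-! ## Interpretation -/

theorem Frame.isClassicalKin_of_sat {B Q : Type} [Field Q] [LinearOrder Q] [IsEuclideanField Q]
    {I : Frame Empty B Q} {f : ℕ → B} {g : ℕ → Q}
    (h : ∀ ψ ∈ ClassicalKinSTLFull, I.Sat f g ψ) : I.IsClassicalKin where
  ev := (I.sat_AxEv f g).1 (h _ (by simp [ClassicalKinSTLFull, KinFull]))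
  self := (I.sat_AxSelf f g).1 (h _ (by simp [ClassicalKinSTLFull, KinFull]))
  symD := (I.sat_AxSymD f g).1 (h _ (by simp [ClassicalKinSTLFull, KinFull]))
  line := (I.sat_AxLine f g).1 (h _ (by simp [ClassicalKinSTLFull, KinFull]))
  triv := (Frame.sat_AxTriv (f := f) (g := g) I).1 (h _ (by simp [ClassicalKinSTLFull, KinFull]))
  noAcc := (I.sat_AxNoAcc f g).1 (h _ (by simp [ClassicalKinSTLFull, KinFull]))
  absTime := (I.sat_AxAbsTime f g).1 (h _ (by simp [ClassicalKinSTLFull]))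
  ether := (I.sat_AxEther f g).1 (h _ (by simp [ClassicalKinSTLFull]))
  noFTL := (I.sat_AxNoFTL f g).1 (h _ (by simp [ClassicalKinSTLFull]))
  thExp := ((I.sat_AxThExpSTL f g).1 (h _ (by simp [ClassicalKinSTLFull]))).2

/-- Radarization turns models of classical kinematics into models of special relativity. -/
theorem Frame.radarized_sat {B Q : Type} [Field Q] [LinearOrder Q] [IsEuclideanField Q]
    {I : Frame Empty B Q} {f : ℕ → B} {g : ℕ → Q}
    (h : ∀ ψ ∈ ClassicalKinSTLFull, I.Sat f g ψ) (ψ : Formula EtherSymbol) (hψ : ψ ∈ SpecRelEFull) :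
    I.radarized.Sat f g ψ := by
  have hI := Frame.isClassicalKin_of_sat h
  obtain ⟨c, hc⟩ := hI.exists_isSpeedOfLight
  simp only [SpecRelEFull, SpecRelFull, KinFull, Set.mem_union, Set.mem_insert_iff,
    Set.mem_singleton_iff] at hψ
  rcases hψ with ((rfl | rfl | rfl | rfl | rfl | rfl | rfl) | rfl | rfl) | rfl
  -- This axiom uses only symbols that the translation leaves alone, so its translation is the same
  -- axiom of the classical theory.
  · exact (Frame.sat_TrPlus f g I AxEField).1
      (h AxEField (by simp [ClassicalKinSTLFull, KinFull]))
  · exact (Frame.sat_AxEv _ f g).2 (hI.radarized_ev hc)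
  · exact (Frame.sat_AxSelf _ f g).2 (hI.radarized_self hc)
  · exact (Frame.sat_AxSymD _ f g).2 (hI.radarized_symD hc)
  · exact (Frame.sat_AxLine _ f g).2 (hI.radarized_line hc)
  · exact (Frame.sat_AxTriv (f := f) (g := g) _).2 (hI.radarized_triv hc)
  · exact (Frame.sat_AxNoAcc _ f g).2 (hI.radarized_noAcc hc)
  · exact (Frame.sat_AxPhc _ f g).2 ⟨c, (hI.radarized_isLightSpeed_iff hc c).2 rfl⟩
  · obtain ⟨e, he⟩ := hI.ether
    exact (Frame.sat_AxThExp _ f g).2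
      ⟨⟨e, (hI.iob_radarized hc e).2 he.1⟩, hI.radarized_thExp hc⟩
  · exact (Frame.sat_AxPrimitiveEther (f := f) (g := g) _).2 (hI.radarized_ether hc)

theorem isInterpretation_trPlus : IsInterpretation SpecRelEFull ClassicalKinSTLFull TrPlus := by
  refine ⟨isTranslation_trPlus, fun φ hφ => .of_forall_sat ?_⟩
  intro B Q _ _ _ I f g h
  -- The bare operations of the structure are identified with those of a Euclidean field, to which
  -- the semantic results apply.
  obtain ⟨_, _, _, rfl, rfl, rfl⟩ := exists_isEuclideanField I f g
    (h AxEField (by simp [ClassicalKinSTLFull, KinFull]))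
  exact (Frame.sat_TrPlus f g I φ).2 (hφ.sound I.radarized f g (Frame.radarized_sat h))

end Kinematics

theorem mainTheorem6 :
    Kinematics.IsInterpretation Kinematics.SpecRelEFull Kinematics.ClassicalKinSTLFull
      Kinematics.TrPlus ∧
    (∀ φ : Kinematics.Formula Empty, Kinematics.TrPlus φ.embed = Kinematics.Tr φ) ∧
    (∀ x : ℕ, Kinematics.TrPlus (.ext .E x) = Kinematics.ether x) :=
  ⟨Kinematics.isInterpretation_trPlus, Kinematics.trPlus_embed, fun _ => rfl⟩
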